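/- Let $n\ge 1$. Let $\mathcal T(n)$ be the set of planar planted bipartite (black/white) trees with black root, white leaves and $n$ white vertices labelled $1,\dots,n$. For $\tau\in\mathcal T(n)$ let $\Delta(\tau)=\prod_v|\Delta^{|v|}|$ (product over the white vertices $v$, where $|v|$ is the number of incoming edges of $v$), with one barycentric coordinate for each edge of $\tau$. A normalized spineless cactus $c$ with $n$ lobes is a tree $\tau\in\mathcal T(n)$ with an interior point of $\Delta(\tau)$. It corresponds to an isotopy class of tree-like configurations of $n$ labelled, positively oriented circles (lobes) of length $1$ in the plane, with a marked point (global zero) that is the base point of the lobe it lies on, where every circle that is attached to a lower one (closer to the global zero) is attached at its own base point: $\tau$ is the dual tree of the configuration, its root is the global zero, and the coordinates are the lengths of the arcs. The space $\mathcal Cact^1(n)$ of normalized spineless cacti is the CW complex with closed cells $\Delta(\tau)$, where points with vanishing coordinates are identified by contracting the corresponding arcs. The space of spineless cacti is $\mathcal Cact(n)=\mathcal Cact^1(n)\times\mathbb R_{>0}^n$, the second factor recording the lengths $r_1,\dots,r_n$ of the lobes. Let $p'\colon\mathcal Cact^1(n+1)\to\mathcal Cact^1(n)$ be the map that contracts the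 $(n+1)$-st lobe to a point (if the global zero lies on that lobe, this point becomes the global zero), and let $p\colon\mathcal Cact(n+1)\to\mathcal Cact(n)$, $p(c',(r_1,\dots,r_{n+1}))=(p'(c'),(r_1,\dots,r_n))$. The completed chord diagram of a spineless cactus $c$ is the following space. Cut the outside circle of $c$ at the global zero, so that it becomes an interval $[0,R]$ with $R=\sum_i r_i$. Draw a chord joining $0$ and $R$, and for each lobe a chord joining the parameters at which the outside circle first enters and last leaves this lobe. For each maximal set of $k$ endpoints of chords that are connected to each other by sequences of chords, glue a $(k-1)$-simplex to the interval, by identifying its vertices with these $k$ points. The result carries the quotient topology. Then: (1) for every $c\in\mathcal Cact(n)$, the fibre $p^{-1}(c)$ is homeomorphic to the product of the completed chord diagram of $c$ with $\mathbb R_{>0}$; (2) for every $c\in\mathcal Cact^1(n)$, the fibre $p'^{-1}(c)$ is homeomorphic to the completed chord diagram of $c$; (3) for every $c\in\mathcal Cact(n)$, the fibre $p^{-1}(c)$ is homotopy equivalent to the image in $\mathbb R^2$ of any planar configuration of circles representing $c$, and it is homotopy equivalent to the bouquet $\bigvee_n S^1$ of $n$ circles; for every $c\in\mathcal Cact^1(n)$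 the same holds for $p'^{-1}(c)$. -/

import Mathlib

namespace Cacti

/-! ### Planar planted bipartite trees with decorated edges -/

mutual

/-- The ordered sequence of white vertices sitting on (i.e. with outgoing edge ending at) a black
vertex of a planar planted bipartite tree. White vertices are labelled by `ι`, edges are decorated
by `A`. A whole tree with black root is given by the sequence of white vertices on its root. -/
inductive Branches (ι A : Type) : Type
  | nil : Branches ι A
  | cons (i : ι) (v : Lobe ι A) (rest : Branches ι A) : Branches ι A

/-- The edges at a white vertex, in the cyclic order of the plane starting after the outgoing edge.
`arc x b rest` is an incoming edge decorated by `x`, from a black vertex carrying the branches `b`;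
`close x` is the outgoing edge, decorated by `x`.

In the cactus, an edge at a white vertex is an arc of the corresponding lobe: the local zero is where the
lobe meets the black vertex below it (or the global zero), and the edge to a black vertex is the arc
that ends at that black vertex. So `arc x₁ b₁ (arc x₂ b₂ (close x₃))` is a lobe of length
`x₁ + x₂ + x₃`, the branches `b₁` sit at distance `x₁` from the local zero, `b₂` at distance
`x₁ + x₂`. -/
inductive Lobe (ι A : Type) : Type
  | close (x : A) : Lobe ι A
  | arc (x : A) (b : Branches ι A) (rest : Lobe ι A) : Lobe ι A

end

section Combinatorics

variable {ι A B : Type}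

/-- Juxtaposition of two sequences of white vertices on one black vertex. -/
def Branches.append : Branches ι A → Branches ι A → Branches ι A
  | .nil, b => b
  | .cons i v rest, b => .cons i v (rest.append b)

/-- There is no white vertex. -/
def Branches.IsNil : Branches ι A → Prop
  | .nil => True
  | .cons _ _ _ => False

mutual

/-- The labels of the white vertices. -/
def Branches.labels : Branches ι A → List ι
  | .nil => []
  | .cons i v rest => i :: (v.labels ++ rest.labels)

/-- The labels of the white vertices above the given one. -/
def Lobe.labels : Lobe ι A → List ι
  | .close _ => []
  | .arc _ b rest => b.labels ++ rest.labels

end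

mutual

/-- All leaves are white: no black vertex, except possibly the root, is without branches. -/
def Branches.WhiteLeaves : Branches ι A → Prop
  | .nil => True
  | .cons _ v rest => v.WhiteLeaves ∧ rest.WhiteLeaves

/-- See `Branches.WhiteLeaves`. -/
def Lobe.WhiteLeaves : Lobe ι A → Prop
  | .close _ => True
  | .arc _ b rest => ¬ b.IsNil ∧ b.WhiteLeaves ∧ rest.WhiteLeaves

end

mutual

/-- The set of edges of the tree. -/
def Branches.Edge : Branches ι A → Type
  | .nil => Empty
  | .cons _ v rest => v.Edge ⊕ rest.Edge

/-- The edges at a white vertex and above it. -/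
def Lobe.Edge : Lobe ι A → Type
  | .close _ => Unit
  | .arc _ b rest => Unit ⊕ (b.Edge ⊕ rest.Edge)

end

mutual

/-- The same tree, with the edges decorated by the values of `x`. -/
def Branches.decorate : (τ : Branches ι A) → (τ.Edge → B) → Branches ι B
  | .nil, _ => .nil
  | .cons i v rest, x =>
      .cons i (v.decorate fun e => x (Sum.inl e)) (rest.decorate fun e => x (Sum.inr e))

/-- See `Branches.decorate`. -/
def Lobe.decorate : (v : Lobe ι A) → (v.Edge → B) → Lobe ι B
  | .close _, x => .close (x ())
  | .arc _ b rest, x =>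
      .arc (x (Sum.inl ())) (b.decorate fun e => x (Sum.inr (Sum.inl e)))
        (rest.decorate fun e => x (Sum.inr (Sum.inr e)))

end

/-- `𝒯(n)`: planar planted bipartite trees with black root, white leaves, and `n` white vertices
labelled by `Fin n`. -/
def BWTree (n : ℕ) : Type :=
  {τ : Branches (Fin n) Unit // (∀ i, τ.labels.count i = 1) ∧ τ.WhiteLeaves}

end Combinatorics

/-! ### Trees with real edge lengths -/

section Metric

variable {ι : Type}

/-- The length of a lobe: the sum of the lengths of its own arcs. -/
def Lobe.perim : Lobe ι ℝ → ℝ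
  | .close x => x
  | .arc x _ rest => x + rest.perim

mutual

/-- All edge lengths satisfy `P`. -/
def Branches.AllEdges (P : ℝ → Prop) : Branches ι ℝ → Prop
  | .nil => True
  | .cons _ v rest => v.AllEdges P ∧ rest.AllEdges P

/-- See `Branches.AllEdges`. -/
def Lobe.AllEdges (P : ℝ → Prop) : Lobe ι ℝ → Prop
  | .close x => P x
  | .arc x b rest => P x ∧ b.AllEdges P ∧ rest.AllEdges P

end

mutual

/-- Every lobe has length one. -/
def Branches.UnitLobes : Branches ι ℝ → Prop
  | .nil => True
  | .cons _ v rest => v.perim = 1 ∧ v.UnitLobesAbove ∧ rest.UnitLobes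

/-- Every lobe above the given one has length one. -/
def Lobe.UnitLobesAbove : Lobe ι ℝ → Prop
  | .close _ => True
  | .arc _ b rest => b.UnitLobes ∧ rest.UnitLobesAbove

end

open Classical in
mutual

/-- Contraction of all edges (arcs) of length zero. -/
noncomputable def Branches.collapse : Branches ι ℝ → Branches ι ℝ
  | .nil => .nil
  | .cons i v rest =>
      match v.collapse with
      | (pre, none) => pre.append rest.collapse
      | (pre, some (v', post)) => pre.append (.cons i v' (post.append rest.collapse))

/-- Contraction of the arcs of length zero of a lobe (or of a terminal piece of it) and above it.
The result consists of the branches that have been moved to the starting point of the piece,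
followed by `none` if the entire piece has been contracted to a point, and otherwise by what
remains of the piece and the branches that have been moved to its end point. -/
noncomputable def Lobe.collapse : Lobe ι ℝ → Branches ι ℝ × Option (Lobe ι ℝ × Branches ι ℝ)
  | .close x => if x = 0 then (.nil, none) else (.nil, some (.close x, .nil))
  | .arc x b rest =>
      if x = 0 then (b.collapse.append rest.collapse.1, rest.collapse.2)
      else
        match rest.collapse with
        | (pre, none) => (.nil, some (.close x, b.collapse.append pre))
        | (pre, some (v', post)) => (.nil, some (.arc x (b.collapse.append pre) v', post))

end

/-- Lengthen the first arc by `x`. -/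
def Lobe.addFirst (x : ℝ) : Lobe ι ℝ → Lobe ι ℝ
  | .close y => .close (x + y)
  | .arc y b rest => .arc (x + y) b rest

/-- All branches sitting on a lobe, in their order; this is what remains of the lobe when it is
contracted to a point. -/
def Lobe.branches : Lobe ι ℝ → Branches ι ℝ
  | .close _ => .nil
  | .arc _ b rest => b.append rest.branches

open Classical in
mutual

/-- The white vertex with the last label is coloured black and all edges at it are contracted. If
a black vertex other than the root is left without branches, it is deleted, and the two arcs it
separated become one arc. -/
noncomputable def Branches.forget {n : ℕ} : Branches (Fin (n + 1)) ℝ → Branches (Fin n) ℝ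
  | .nil => .nil
  | .cons i v rest =>
      if h : i = Fin.last n then v.forget.branches.append rest.forget
      else .cons (i.castPred h) v.forget rest.forget

/-- See `Branches.forget`. -/
noncomputable def Lobe.forget {n : ℕ} : Lobe (Fin (n + 1)) ℝ → Lobe (Fin n) ℝ
  | .close x => .close x
  | .arc x b rest =>
      if b.forget.IsNil then rest.forget.addFirst x else .arc x b.forget rest.forget

end

end Metric

/-! ### The spaces of spineless cacti -/

/-- The data of a normalized spineless cactus with `n` lobes: a tree in `𝒯(n)` (the topological
type) with positive arc lengths, such that every lobe has length one. -/
structure IsCactus {n : ℕ} (t : Branches (Fin n) ℝ) : Prop where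
  count_labels : ∀ i, t.labels.count i = 1
  whiteLeaves : t.WhiteLeaves
  pos : t.AllEdges (0 < ·)
  unitLobes : t.UnitLobes

/-- The set of normalized spineless cacti with `n` lobes, i.e. the disjoint union over `τ ∈ 𝒯(n)`
of the open cells `∏ᵥ interior |Δ^|v||`. -/
def NCact (n : ℕ) : Type := {t : Branches (Fin n) ℝ // IsCactus t}

/-- The closed cell `Δ(τ) = ∏ᵥ |Δ^|v||`: one barycentric coordinate for each edge, with the
coordinates of the edges at each white vertex adding up to one. -/
def Cell {n : ℕ} (τ : BWTree n) : Type :=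
  {x : τ.1.Edge → ℝ // (∀ e, 0 ≤ x e) ∧ (τ.1.decorate x).UnitLobes}

instance {n : ℕ} (τ : BWTree n) : TopologicalSpace (Cell τ) :=
  inferInstanceAs (TopologicalSpace
    {x : τ.1.Edge → ℝ // (∀ e, 0 ≤ x e) ∧ (τ.1.decorate x).UnitLobes})

section Facts

variable {ι A B : Type}

theorem Branches.labels_append (a b : Branches ι A) :
    (a.append b).labels = a.labels ++ b.labels := by
  induction a using Branches.rec (motive_2 := fun _ => True) with
  | nil => simp [Branches.append, Branches.labels]
  | cons i v rest _ ih => simp [Branches.append, Branches.labels, ih]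
  | close => trivial
  | arc => trivial

theorem Branches.isNil_append (a b : Branches ι A) :
    (a.append b).IsNil ↔ a.IsNil ∧ b.IsNil := by
  cases a <;> simp [Branches.append, Branches.IsNil]

theorem Branches.whiteLeaves_append (a b : Branches ι A) :
    (a.append b).WhiteLeaves ↔ a.WhiteLeaves ∧ b.WhiteLeaves := by
  induction a using Branches.rec (motive_2 := fun _ => True) with
  | nil => simp [Branches.append, Branches.WhiteLeaves]
  | cons i v rest _ ih => simp [Branches.append, Branches.WhiteLeaves, ih, and_assoc]
  | close => trivial
  | arc => trivial

theorem Branches.allEdges_append (P : ℝ → Prop) (a b : Branches ι ℝ) :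
    (a.append b).AllEdges P ↔ a.AllEdges P ∧ b.AllEdges P := by
  induction a using Branches.rec (motive_2 := fun _ => True) with
  | nil => simp [Branches.append, Branches.AllEdges]
  | cons i v rest _ ih => simp [Branches.append, Branches.AllEdges, ih, and_assoc]
  | close => trivial
  | arc => trivial

theorem Branches.unitLobes_append (a b : Branches ι ℝ) :
    (a.append b).UnitLobes ↔ a.UnitLobes ∧ b.UnitLobes := by
  induction a using Branches.rec (motive_2 := fun _ => True) with
  | nil => simp [Branches.append, Branches.UnitLobes]
  | cons i v rest _ ih => simp [Branches.append, Branches.UnitLobes, ih, and_assoc]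
  | close => trivial
  | arc => trivial

theorem Branches.isNil_decorate (t : Branches ι A) (x : t.Edge → B) :
    (t.decorate x).IsNil ↔ t.IsNil := by
  cases t <;> simp [Branches.decorate, Branches.IsNil]

mutual

theorem Branches.labels_decorate : ∀ (t : Branches ι A) (x : t.Edge → B),
    (t.decorate x).labels = t.labels
  | .nil, _ => by simp [Branches.decorate, Branches.labels]
  | .cons i v rest, x => by
      simp [Branches.decorate, Branches.labels, Lobe.labels_decorate v, Branches.labels_decorate rest]

theorem Lobe.labels_decorate : ∀ (v : Lobe ι A) (x : v.Edge → B),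
    (v.decorate x).labels = v.labels
  | .close _, _ => by simp [Lobe.decorate, Lobe.labels]
  | .arc _ b rest, x => by
      simp [Lobe.decorate, Lobe.labels, Lobe.labels_decorate rest, Branches.labels_decorate b]

end

mutual

theorem Branches.whiteLeaves_decorate : ∀ (t : Branches ι A) (x : t.Edge → B),
    (t.decorate x).WhiteLeaves ↔ t.WhiteLeaves
  | .nil, _ => by simp [Branches.decorate, Branches.WhiteLeaves]
  | .cons i v rest, x => by
      simp [Branches.decorate, Branches.WhiteLeaves, Lobe.whiteLeaves_decorate v,
        Branches.whiteLeaves_decorate rest]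

theorem Lobe.whiteLeaves_decorate : ∀ (v : Lobe ι A) (x : v.Edge → B),
    (v.decorate x).WhiteLeaves ↔ v.WhiteLeaves
  | .close _, _ => by simp [Lobe.decorate, Lobe.WhiteLeaves]
  | .arc _ b rest, x => by
      simp [Lobe.decorate, Lobe.WhiteLeaves, Lobe.whiteLeaves_decorate rest,
        Branches.whiteLeaves_decorate b, Branches.isNil_decorate]

end

mutual

theorem Branches.allEdges_decorate (P : ℝ → Prop) : ∀ (t : Branches ι A) (x : t.Edge → ℝ),
    (∀ e, P (x e)) → (t.decorate x).AllEdges P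
  | .nil, _, _ => by simp [Branches.decorate, Branches.AllEdges]
  | .cons i v rest, x, h => by
      simp only [Branches.decorate, Branches.AllEdges]
      exact ⟨Lobe.allEdges_decorate P v _ fun e => h _,
        Branches.allEdges_decorate P rest _ fun e => h _⟩

theorem Lobe.allEdges_decorate (P : ℝ → Prop) : ∀ (v : Lobe ι A) (x : v.Edge → ℝ),
    (∀ e, P (x e)) → (v.decorate x).AllEdges P
  | .close _, x, h => by simpa [Lobe.decorate, Lobe.AllEdges] using h ()
  | .arc _ b rest, x, h => by
      simp only [Lobe.decorate, Lobe.AllEdges]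
      exact ⟨h _, Branches.allEdges_decorate P b _ fun e => h _,
        Lobe.allEdges_decorate P rest _ fun e => h _⟩

end

/-- White leaves, positive arcs and lobes of length one. -/
def Branches.Good (t : Branches ι ℝ) : Prop :=
  t.WhiteLeaves ∧ t.AllEdges (0 < ·) ∧ t.UnitLobes

theorem Branches.good_append (a b : Branches ι ℝ) : (a.append b).Good ↔ a.Good ∧ b.Good := by
  simp only [Branches.Good, Branches.whiteLeaves_append, Branches.allEdges_append,
    Branches.unitLobes_append]
  tauto

theorem Branches.good_nil : (Branches.nil : Branches ι ℝ).Good := by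
  simp [Branches.Good, Branches.WhiteLeaves, Branches.AllEdges, Branches.UnitLobes]

/-- The analogue of `Branches.Good` for a piece of a lobe. -/
def Lobe.Good (v : Lobe ι ℝ) : Prop :=
  v.WhiteLeaves ∧ v.AllEdges (0 < ·) ∧ v.UnitLobesAbove

theorem Branches.good_cons (i : ι) (v : Lobe ι ℝ) (rest : Branches ι ℝ) :
    (Branches.cons i v rest).Good ↔ v.Good ∧ v.perim = 1 ∧ rest.Good := by
  simp only [Branches.Good, Lobe.Good, Branches.WhiteLeaves, Branches.AllEdges, Branches.UnitLobes]
  tauto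

theorem Lobe.good_arc (x : ℝ) (b : Branches ι ℝ) (rest : Lobe ι ℝ) :
    (Lobe.arc x b rest).Good ↔ 0 < x ∧ ¬ b.IsNil ∧ b.Good ∧ rest.Good := by
  simp only [Branches.Good, Lobe.Good, Lobe.WhiteLeaves, Lobe.AllEdges, Lobe.UnitLobesAbove]
  tauto

theorem Lobe.good_close (x : ℝ) : (Lobe.close x : Lobe ι ℝ).Good ↔ 0 < x := by
  simp [Lobe.Good, Lobe.WhiteLeaves, Lobe.AllEdges, Lobe.UnitLobesAbove]

theorem Lobe.perim_nonneg (v : Lobe ι ℝ) (h : v.AllEdges (0 ≤ ·)) : 0 ≤ v.perim := by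
  induction v using Lobe.rec (motive_1 := fun _ => True) with
  | nil => trivial
  | cons => trivial
  | close x => simpa [Lobe.perim, Lobe.AllEdges] using h
  | arc x b rest _ ih =>
    simp only [Lobe.perim, Lobe.AllEdges] at h ⊢
    linarith [ih h.2.2, h.1]

mutual

theorem Branches.collapse_spec [DecidableEq ι] : ∀ t : Branches ι ℝ, t.WhiteLeaves →
    t.AllEdges (0 ≤ ·) → t.UnitLobes →
    t.collapse.Good ∧ (t.collapse.IsNil → t.IsNil) ∧
      ∀ i, t.collapse.labels.count i = t.labels.count i
  | .nil, _, _, _ => by simp [Branches.collapse, Branches.good_nil]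
  | .cons j v rest, hw, hp, hu => by
      simp only [Branches.WhiteLeaves, Branches.AllEdges, Branches.UnitLobes] at hw hp hu
      obtain ⟨h1, h2⟩ := Lobe.collapse_spec v hw.1 hp.1 hu.2.1
      obtain ⟨g, -, hc⟩ := Branches.collapse_spec rest hw.2 hp.2 hu.2.2
      rcases hv : v.collapse with ⟨pre, _ | ⟨v', post⟩⟩
      · have := (h1 pre hv).1
        linarith [hu.1]
      · obtain ⟨hper, hpre, hv', hpost, hcnt⟩ := h2 pre v' post hv
        simp only [Branches.collapse, hv]
        refine ⟨?_, ?_, ?_⟩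
        · rw [Branches.good_append, Branches.good_cons, Branches.good_append]
          exact ⟨hpre, hv', by rw [hper, hu.1], hpost, g⟩
        · intro h
          exact ((Branches.isNil_append _ _).1 h).2.elim
        · intro i
          have := hcnt i
          simp only [Branches.labels_append, Branches.labels, List.count_append,
            List.count_cons, hc i]
          omega

theorem Lobe.collapse_spec [DecidableEq ι] : ∀ v : Lobe ι ℝ, v.WhiteLeaves →
    v.AllEdges (0 ≤ ·) → v.UnitLobesAbove →
    (∀ pre, v.collapse = (pre, none) → v.perim = 0 ∧ pre.Good ∧
      ∀ i, pre.labels.count i = v.labels.count i) ∧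
    (∀ pre v' post, v.collapse = (pre, some (v', post)) → v'.perim = v.perim ∧ pre.Good ∧
      v'.Good ∧ post.Good ∧ ∀ i, pre.labels.count i + v'.labels.count i + post.labels.count i =
        v.labels.count i)
  | .close x, _, hp, _ => by
      simp only [Lobe.AllEdges] at hp
      by_cases hx : x = 0
      · simp [Lobe.collapse, hx, Lobe.perim, Branches.good_nil, Lobe.labels, Branches.labels]
      · simp [Lobe.collapse, hx, Lobe.perim, Branches.good_nil, Lobe.labels, Branches.labels,
          Lobe.good_close, lt_of_le_of_ne hp (Ne.symm hx)]
  | .arc x b rest, hw, hp, hu => by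
      simp only [Lobe.WhiteLeaves, Lobe.AllEdges, Lobe.UnitLobesAbove] at hw hp hu
      obtain ⟨h1, h2⟩ := Lobe.collapse_spec rest hw.2.2 hp.2.2 hu.2
      obtain ⟨g, hn, hc⟩ := Branches.collapse_spec b hw.2.1 hp.2.1 hu.1
      rcases hv : rest.collapse with ⟨pre, _ | ⟨v', post⟩⟩
      · obtain ⟨hper, hpre, hcnt⟩ := h1 pre hv
        by_cases hx : x = 0
        · simp [Lobe.collapse, hx, hv, Lobe.perim, hper, Branches.good_append, g, hpre,
            Branches.labels_append, Lobe.labels, hc, hcnt]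
        · simp [Lobe.collapse, hx, hv, Lobe.perim, hper, Branches.good_append, g, hpre,
            Branches.labels_append, Branches.labels, Lobe.labels, hc, hcnt, Lobe.good_close,
            lt_of_le_of_ne hp.1 (Ne.symm hx), Branches.good_nil]
      · obtain ⟨hper, hpre, hv', hpost, hcnt⟩ := h2 pre v' post hv
        by_cases hx : x = 0
        · simp only [Lobe.collapse, hx, hv, if_true, Prod.mk.injEq, reduceCtorEq, and_false,
            false_imp_iff, implies_true, Option.some.injEq, true_and]
          rintro _ _ _ ⟨rfl, rfl, rfl⟩
          refine ⟨by simp [Lobe.perim, hper], (Branches.good_append _ _).2 ⟨g, hpre⟩, hv', hpost, ?_⟩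
          intro i
          have := hcnt i
          simp only [Branches.labels_append, Lobe.labels, List.count_append, hc i]
          omega
        · simp only [Lobe.collapse, hx, hv, if_false, Prod.mk.injEq, reduceCtorEq, and_false,
            false_imp_iff, implies_true, Option.some.injEq, true_and]
          rintro _ _ _ ⟨rfl, rfl, rfl⟩
          refine ⟨by simp [Lobe.perim, hper], Branches.good_nil, ?_, hpost, ?_⟩
          · rw [Lobe.good_arc, Branches.good_append, Branches.isNil_append]
            exact ⟨lt_of_le_of_ne hp.1 (Ne.symm hx), fun h => hw.1 (hn h.1), ⟨g, hpre⟩, hv'⟩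
          · intro i
            have := hcnt i
            simp only [Branches.labels_append, Branches.labels, Lobe.labels, List.count_append,
              hc i, List.count_nil]
            omega

end

theorem Lobe.branches_good (v : Lobe ι ℝ) (h : v.Good) : v.branches.Good := by
  induction v using Lobe.rec (motive_1 := fun _ => True) with
  | nil => trivial
  | cons => trivial
  | close x => exact Branches.good_nil
  | arc x b rest _ ih =>
    rw [Lobe.good_arc] at h
    exact (Branches.good_append _ _).2 ⟨h.2.2.1, ih h.2.2.2⟩

theorem Lobe.labels_branches (v : Lobe ι ℝ) : v.branches.labels = v.labels := by
  induction v using Lobe.rec (motive_1 := fun _ => True) with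
  | nil => trivial
  | cons => trivial
  | close x => simp [Lobe.branches, Lobe.labels, Branches.labels]
  | arc x b rest _ ih => simp [Lobe.branches, Lobe.labels, Branches.labels_append, ih]

theorem Branches.labels_of_isNil (t : Branches ι A) (h : t.IsNil) : t.labels = [] := by
  cases t
  · simp [Branches.labels]
  · exact h.elim

mutual

theorem Branches.forget_spec {n : ℕ} : ∀ t : Branches (Fin (n + 1)) ℝ, t.Good →
    t.forget.Good ∧ ∀ i : Fin n, t.forget.labels.count i = t.labels.count i.castSucc
  | .nil, _ => by simp [Branches.forget, Branches.good_nil, Branches.labels]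
  | .cons j v rest, h => by
      rw [Branches.good_cons] at h
      obtain ⟨gv, pv, cv⟩ := Lobe.forget_spec v h.1
      obtain ⟨gr, cr⟩ := Branches.forget_spec rest h.2.2
      by_cases hj : j = Fin.last n
      · simp only [Branches.forget, hj, dif_pos]
        refine ⟨(Branches.good_append _ _).2 ⟨Lobe.branches_good _ gv, gr⟩, fun i => ?_⟩
        have : Fin.last n ≠ i.castSucc := (Fin.castSucc_lt_last i).ne'
        simp [Branches.labels_append, Branches.labels, Lobe.labels_branches, cv, cr, this]
      · simp only [Branches.forget, hj, dif_neg, not_false_eq_true]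
        refine ⟨(Branches.good_cons _ _ _).2 ⟨gv, by rw [pv, h.2.1], gr⟩, fun i => ?_⟩
        have : j.castPred hj = i ↔ j = i.castSucc := by
          constructor
          · rintro rfl; simp
          · rintro rfl; simp
        simp [Branches.labels, cv, cr, List.count_cons, this]

theorem Lobe.forget_spec {n : ℕ} : ∀ v : Lobe (Fin (n + 1)) ℝ, v.Good →
    v.forget.Good ∧ v.forget.perim = v.perim ∧
      ∀ i : Fin n, v.forget.labels.count i = v.labels.count i.castSucc
  | .close x, h => by
      simpa [Lobe.forget, Lobe.good_close, Lobe.labels, Lobe.perim] using h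
  | .arc x b rest, h => by
      rw [Lobe.good_arc] at h
      obtain ⟨gr, pr, cr⟩ := Lobe.forget_spec rest h.2.2.2
      obtain ⟨gb, cb⟩ := Branches.forget_spec b h.2.2.1
      by_cases hb : b.forget.IsNil
      · have hl := Branches.labels_of_isNil _ hb
        rw [hl] at cb
        simp only [Lobe.forget, hb, if_true]
        rcases hr : rest.forget with y | ⟨y, b', r'⟩
        · rw [hr] at gr pr cr
          rw [Lobe.good_close] at gr
          refine ⟨(Lobe.good_close _).2 (add_pos h.1 gr), by simpa [Lobe.addFirst, Lobe.perim]
            using pr, fun i => ?_⟩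
          simpa [Lobe.addFirst, Lobe.labels, ← cb] using cr i
        · rw [hr] at gr pr cr
          rw [Lobe.good_arc] at gr
          refine ⟨(Lobe.good_arc _ _ _).2 ⟨add_pos h.1 gr.1, gr.2⟩, ?_, fun i => ?_⟩
          · simp only [Lobe.addFirst, Lobe.perim] at pr ⊢
            linarith
          · simpa [Lobe.addFirst, Lobe.labels, ← cb] using cr i
      · simp only [Lobe.forget, hb, if_false]
        refine ⟨(Lobe.good_arc _ _ _).2 ⟨h.1, hb, gb, gr⟩, by simp [Lobe.perim, pr], fun i => ?_⟩
        simp [Lobe.labels, cb, cr]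

end

end Facts

/-- The characteristic map `e_τ : Δ(τ) → Cact¹(n)` of the cell `Δ(τ)`: realize the coordinates as
arc lengths and contract the arcs of length zero. -/
noncomputable def charMap {n : ℕ} (τ : BWTree n) (x : Cell τ) : NCact n :=
  ⟨(τ.1.decorate x.1).collapse, by
    obtain ⟨h1, -, h3⟩ := Branches.collapse_spec (τ.1.decorate x.1)
      ((Branches.whiteLeaves_decorate _ _).2 τ.2.2)
      (Branches.allEdges_decorate _ _ _ x.2.1) x.2.2
    exact ⟨fun i => by rw [h3, Branches.labels_decorate, τ.2.1], h1.1, h1.2.1, h1.2.2⟩⟩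

/-- The topology of the CW complex `K(n)`: the finest one for which all characteristic maps
`e_τ : Δ(τ) → Cact¹(n)` are continuous. -/
noncomputable instance (n : ℕ) : TopologicalSpace (NCact n) :=
  TopologicalSpace.coinduced (fun y : Σ τ : BWTree n, Cell τ => charMap y.1 y.2) inferInstance

/-- The space `Cact(n) = Cact¹(n) × ℝ_{>0}ⁿ` of spineless cacti with `n` lobes; the second
component consists of the lengths of the lobes. -/
abbrev Cact (n : ℕ) : Type := NCact n × (Fin n → Set.Ioi (0 : ℝ))

/-- A normalized spineless cactus, regarded as a spineless cactus. -/
def NCact.toCact {n : ℕ} (c : NCact n) : Cact n := (c, fun _ => ⟨1, Set.mem_Ioi.2 zero_lt_one⟩)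

/-- The map `p' : Cact¹(n+1) → Cact¹(n)` that contracts the last lobe. -/
noncomputable def forgetLobe' {n : ℕ} (c : NCact (n + 1)) : NCact n :=
  ⟨c.1.forget, by
    obtain ⟨h1, h2⟩ := Branches.forget_spec c.1 ⟨c.2.whiteLeaves, c.2.pos, c.2.unitLobes⟩
    exact ⟨fun i => by rw [h2, c.2.count_labels], h1.1, h1.2.1, h1.2.2⟩⟩

/-- The map `p : Cact(n+1) → Cact(n)` that contracts the last lobe. -/
noncomputable def forgetLobe {n : ℕ} (c : Cact (n + 1)) : Cact n :=
  (forgetLobe' c.1, fun i => c.2 i.castSucc)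

/-- The fibre of a map, with the subspace topology. -/
abbrev Fibre {X Y : Type} (f : X → Y) (y : Y) : Type := {x : X // f x = y}

/-! ### The completed chord diagram -/

section Chords

variable {ι : Type}

mutual

/-- Multiply the arc lengths of each lobe by a factor. -/
def Branches.scale (r : ι → ℝ) : Branches ι ℝ → Branches ι ℝ
  | .nil => .nil
  | .cons i v rest => .cons i (v.scale r (r i)) (rest.scale r)

/-- See `Branches.scale`; `a` is the factor for the lobe under consideration. -/
def Lobe.scale (r : ι → ℝ) (a : ℝ) : Lobe ι ℝ → Lobe ι ℝ
  | .close x => .close (a * x)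
  | .arc x b rest => .arc (a * x) (b.scale r) (rest.scale r a)

end

mutual

/-- The sum of all arc lengths. -/
def Branches.total : Branches ι ℝ → ℝ
  | .nil => 0
  | .cons _ v rest => v.total + rest.total

/-- See `Branches.total`. -/
def Lobe.total : Lobe ι ℝ → ℝ
  | .close x => x
  | .arc x b rest => x + (b.total + rest.total)

end

mutual

/-- The chords of the lobes. The outside circle runs along the branches in their order, starting at
the parameter `s`; the chord of a lobe consists of the parameters at which the outside circle enters
the lobe for the first time and leaves it for the last time. -/
def Branches.chords (s : ℝ) : Branches ι ℝ → List (ℝ × ℝ)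
  | .nil => []
  | .cons _ v rest => (s, s + v.total) :: (v.chords s ++ rest.chords (s + v.total))

/-- See `Branches.chords`. -/
def Lobe.chords (s : ℝ) : Lobe ι ℝ → List (ℝ × ℝ)
  | .close _ => []
  | .arc x b rest => b.chords (s + x) ++ rest.chords (s + x + b.total)

end

/-- The chords of the outside circle cut open at the global zero, which is the interval `[0, R]`:
the chord `a_z` between its end points, and one chord for each lobe. -/
def Branches.cutChords (t : Branches ι ℝ) : List (ℝ × ℝ) :=
  (0, t.total) :: t.chords 0

/-- The marked points: the end points of the chords. -/
def Branches.Marked (t : Branches ι ℝ) : Type :=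
  {s : ℝ // ∃ a ∈ t.cutChords, s = a.1 ∨ s = a.2}

/-- Two marked points are equivalent if they are connected by a sequence of chords. -/
def Branches.markedSetoid (t : Branches ι ℝ) : Setoid t.Marked :=
  Relation.EqvGen.setoid fun s s' => (s.1, s'.1) ∈ t.cutChords

instance (t : Branches ι ℝ) : Finite t.Marked := by
  have : {s : ℝ | ∃ a ∈ t.cutChords, s = a.1 ∨ s = a.2} ⊆
      ↑((t.cutChords.map Prod.fst ++ t.cutChords.map Prod.snd).toFinset) := by
    rintro s ⟨⟨a, b⟩, ha, h⟩
    rw [Finset.mem_coe, List.mem_toFinset, List.mem_append]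
    rcases h with rfl | rfl
    · exact Or.inl (List.mem_map_of_mem (f := Prod.fst) ha)
    · exact Or.inr (List.mem_map_of_mem (f := Prod.snd) ha)
  exact ((Finset.finite_toSet _).subset this).to_subtype

/-- The marked points connected by a sequence of chords to each other: an equivalence class. -/
abbrev Branches.ChordClass (t : Branches ι ℝ) (q : Quotient t.markedSetoid) : Type :=
  {m : t.Marked // Quotient.mk t.markedSetoid m = q}

noncomputable instance (t : Branches ι ℝ) (q : Quotient t.markedSetoid) :
    Fintype (t.ChordClass q) := Fintype.ofFinite _

open Classical in
/-- The vertex of the simplex of an equivalence class that belongs to the marked point `m`. -/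
noncomputable def Branches.vertex (t : Branches ι ℝ) (m : t.Marked) :
    stdSimplex ℝ (t.ChordClass (Quotient.mk t.markedSetoid m)) :=
  ⟨Pi.single ⟨m, rfl⟩ 1, single_mem_stdSimplex ℝ _⟩

/-- The pieces of the completed chord diagram: the outside circle cut open at the global zero, and
for each maximal set of `k` points connected by chords a `(k-1)`-simplex with these vertices. -/
abbrev Branches.Pieces (t : Branches ι ℝ) : Type :=
  Set.Icc (0 : ℝ) t.total ⊕ Σ q : Quotient t.markedSetoid, stdSimplex ℝ (t.ChordClass q)

/-- The gluing relation: each vertex of a simplex is glued to its marked point. -/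
inductive Branches.Glue (t : Branches ι ℝ) : t.Pieces → t.Pieces → Prop
  | vertex (s : Set.Icc (0 : ℝ) t.total) (m : t.Marked) (h : s.1 = m.1) :
      t.Glue (Sum.inl s) (Sum.inr ⟨Quotient.mk t.markedSetoid m, t.vertex m⟩)

/-- The completed chord diagram, with the quotient topology. -/
def Branches.CompletedChordDiagram (t : Branches ι ℝ) : Type := Quot t.Glue

instance (t : Branches ι ℝ) : TopologicalSpace t.CompletedChordDiagram :=
  inferInstanceAs (TopologicalSpace (Quot t.Glue))

end Chords

/-- The tree of a spineless cactus, with the actual lengths of the arcs. -/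
def metricTree {n : ℕ} (c : Cact n) : Branches (Fin n) ℝ := c.1.1.scale fun i => (c.2 i : ℝ)

/-! ### Planar configurations of circles -/

section Planar

/-- `γ` is a positively oriented embedded circle of length `r` in the plane `ℝ² = ℂ`: it is
injective and has winding number one about some point. -/
structure IsPlaneCircle {r : ℝ} (γ : AddCircle r → ℂ) : Prop where
  continuous : Continuous γ
  injective : Function.Injective γ
  orientation : ∃ z, z ∉ Set.range γ ∧ ∃ θ : ℝ → ℝ, Continuous θ ∧
    (∀ s : ℝ, γ s - z = ‖γ s - z‖ * Complex.exp (θ s * Complex.I)) ∧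
    θ r = θ 0 + 2 * Real.pi

/-- The closed disc bounded by an embedded circle. -/
def closedDisc {r : ℝ} (γ : AddCircle r → ℂ) : Set ℂ :=
  Set.range γ ∪
    {z | z ∉ Set.range γ ∧ Bornology.IsBounded (connectedComponentIn (Set.range γ)ᶜ z)}

variable {ι : Type}

/-- The base points (local zeros) of the lobes sitting on a black vertex. -/
def Branches.heads {A : Type} : Branches ι A → List (ι × ℝ)
  | .nil => []
  | .cons i _ rest => (i, 0) :: rest.heads

mutual

/-- For each black vertex other than the root, the list of the points that are identified there;
`(i, u)` is the point at distance `u` from the local zero on the lobe `i`. -/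
def Branches.nodes : Branches ι ℝ → List (List (ι × ℝ))
  | .nil => []
  | .cons i v rest => v.nodes i 0 ++ rest.nodes

/-- See `Branches.nodes`; the piece of the lobe `i` under consideration starts at `u`. -/
def Lobe.nodes (i : ι) (u : ℝ) : Lobe ι ℝ → List (List (ι × ℝ))
  | .close _ => []
  | .arc x b rest => ((i, u + x) :: b.heads) :: (b.nodes ++ rest.nodes i (u + x))

end

mutual

/-- The arcs in the order in which the outside circle traverses them: `(i, u, x)` is the arc of
length `x` on the lobe `i` that starts at distance `u` from the local zero. -/
def Branches.arcs : Branches ι ℝ → List (ι × ℝ × ℝ)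
  | .nil => []
  | .cons i v rest => v.arcs i 0 ++ rest.arcs

/-- See `Branches.arcs`; the piece of the lobe `i` under consideration starts at `u`. -/
def Lobe.arcs (i : ι) (u : ℝ) : Lobe ι ℝ → List (ι × ℝ × ℝ)
  | .close x => [(i, u, x)]
  | .arc x b rest => (i, u, x) :: (b.arcs ++ rest.arcs i (u + x))

end

/-- Traverse a list of arcs of a family of circles at unit speed. -/
noncomputable def traverse {r : ι → ℝ} (f : ∀ i, AddCircle (r i) → ℂ) :
    List (ι × ℝ × ℝ) → ℝ → ℂ
  | [], _ => 0
  | (i, u, x) :: l, s => if s ≤ x then f i ((u + s : ℝ) : AddCircle (r i)) else traverse f l (s - x)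

/-- The family `f` of circles in the plane is a rooted tree-like configuration that represents the
spineless cactus `c` (whose `i`-th lobe has length `c.2 i`). -/
structure IsPlanarRepresentative {n : ℕ} (c : Cact n)
    (f : ∀ i, AddCircle (c.2 i : ℝ) → ℂ) : Prop where
  /-- Each lobe is a positively oriented embedded circle. -/
  circle : ∀ i, IsPlaneCircle (f i)
  /-- No circle is contained in the disc bounded by another one. -/
  not_contained : ∀ i j, i ≠ j → ¬ Set.range (f i) ⊆ closedDisc (f j)
  /-- The incidences are those of the dual tree and the arc lengths of `c`: two points of the
  circles agree if and only if they are equal or meet at the same black vertex. -/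
  incidence : ∀ a b : Σ i, AddCircle (c.2 i : ℝ), f a.1 a.2 = f b.1 b.2 ↔
    a = b ∨ ∃ C ∈ (metricTree c).heads :: (metricTree c).nodes, ∃ u v : ℝ,
      (a.1, u) ∈ C ∧ (b.1, v) ∈ C ∧ a.2 = (u : AddCircle (c.2 a.1 : ℝ)) ∧
        b.2 = (v : AddCircle (c.2 b.1 : ℝ))
  /-- The lobes are arranged around each intersection point in the cyclic order given by the dual
  tree. Equivalently, the closed path that traverses the arcs in the order of the outside circle of
  `c` does not cross itself: it is a uniform limit of embedded closed curves. -/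
  planar : ∀ ε : ℝ, 0 < ε → ∃ g : AddCircle (metricTree c).total → ℂ, Continuous g ∧
    Function.Injective g ∧ ∀ s ∈ Set.Icc 0 (metricTree c).total,
      dist (g (s : AddCircle (metricTree c).total)) (traverse f (metricTree c).arcs s) < ε

/-- The image in the plane of a family of circles. -/
def planarImage {r : ι → ℝ} (f : ∀ i, AddCircle (r i) → ℂ) : Set ℂ := ⋃ i, Set.range (f i)

end Planar

/-! ### Bouquets of circles -/

/-- All base points of `n` circles are glued to one point. -/
inductive BouquetGlue (n : ℕ) : Unit ⊕ (Fin n × Circle) → Unit ⊕ (Fin n × Circle) → Prop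
  | base (i : Fin n) : BouquetGlue n (Sum.inl ()) (Sum.inr (i, 1))

/-- The bouquet (wedge) of `n` circles. -/
def Bouquet (n : ℕ) : Type := Quot (BouquetGlue n)

instance (n : ℕ) : TopologicalSpace (Bouquet n) :=
  inferInstanceAs (TopologicalSpace (Quot (BouquetGlue n)))

end Cacti

open Topology

namespace Cacti

open scoped unitInterval

/-! ### Pointed homotopy equivalences -/

section PointedEquiv

variable {X Y Z : Type} [TopologicalSpace X] [TopologicalSpace Y] [TopologicalSpace Z]

/-- The pointed spaces `(X, x)` and `(Y, y)` are homotopy equivalent, relative to the base points. -/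
def PointedEquiv (X Y : Type) [TopologicalSpace X] [TopologicalSpace Y] (x : X) (y : Y) : Prop :=
  ∃ (f : C(X, Y)) (g : C(Y, X)), f x = y ∧ g y = x ∧
    (g.comp f).HomotopicRel (.id X) {x} ∧ (f.comp g).HomotopicRel (.id Y) {y}

theorem HomotopicRel.precomp {f₀ f₁ : C(X, Y)} {S : Set X} (h : f₀.HomotopicRel f₁ S)
    (g : C(Z, X)) {T : Set Z} (hT : ∀ z ∈ T, g z ∈ S) :
    (f₀.comp g).HomotopicRel (f₁.comp g) T := by
  obtain ⟨F⟩ := h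
  exact ⟨{ toFun := fun p => F (p.1, g p.2)
           continuous_toFun := by fun_prop
           map_zero_left := fun z => by simp
           map_one_left := fun z => by simp
           prop' := fun t z hz => F.eq_fst t (hT z hz) }⟩

theorem PointedEquiv.symm {x : X} {y : Y} (h : PointedEquiv X Y x y) : PointedEquiv Y X y x := by
  obtain ⟨f, g, h1, h2, h3, h4⟩ := h
  exact ⟨g, f, h2, h1, h4, h3⟩

theorem PointedEquiv.trans {x : X} {y : Y} {z : Z} (h : PointedEquiv X Y x y)
    (h' : PointedEquiv Y Z y z) : PointedEquiv X Z x z := by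
  obtain ⟨f, g, h1, h2, h3, h4⟩ := h
  obtain ⟨f', g', h1', h2', h3', h4'⟩ := h'
  refine ⟨f'.comp f, g.comp g', by simp [h1, h1'], by simp [h2, h2'], ?_, ?_⟩
  · have a := HomotopicRel.precomp (h3'.comp_continuousMap g) f (T := {x})
      (by rintro _ rfl; exact h1)
    exact a.trans h3
  · have a := HomotopicRel.precomp (h4.comp_continuousMap f') g' (T := {z})
      (by rintro _ rfl; exact h2')
    exact a.trans h4'

theorem PointedEquiv.of_homeomorph (e : X ≃ₜ Y) (x : X) : PointedEquiv X Y x (e x) := by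
  refine ⟨⟨e, e.continuous⟩, ⟨e.symm, e.symm.continuous⟩, rfl, by simp, ?_, ?_⟩
  · convert ContinuousMap.HomotopicRel.refl _
    ext; simp
  · convert ContinuousMap.HomotopicRel.refl _
    ext; simp

theorem PointedEquiv.homotopyEquiv {x : X} {y : Y} (h : PointedEquiv X Y x y) :
    Nonempty (ContinuousMap.HomotopyEquiv X Y) := by
  obtain ⟨f, g, -, -, h3, h4⟩ := h
  exact ⟨⟨f, g, h3.homotopic, h4.homotopic⟩⟩

end PointedEquiv

/-! ### Attaching an edge -/

section Attach

variable {X Y : Type} [TopologicalSpace X] [TopologicalSpace Y]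

/-- The end points of the edge are glued to `a` and `b`. -/
inductive AttachRel (a b : X) : X ⊕ I → X ⊕ I → Prop
  | source : AttachRel a b (.inr 0) (.inl a)
  | target : AttachRel a b (.inr 1) (.inl b)

/-- The space obtained from `X` by attaching an edge from `a` to `b`. -/
def Attach (a b : X) : Type := Quot (AttachRel a b)

instance (a b : X) : TopologicalSpace (Attach a b) :=
  inferInstanceAs (TopologicalSpace (Quot (AttachRel a b)))

namespace Attach

variable {a b : X}

/-- The inclusion of the space to which the edge is attached. -/
def incl : C(X, Attach a b) := ⟨fun x => Quot.mk _ (.inl x), continuous_quot_mk.comp continuous_inl⟩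

/-- The attached edge. -/
def edge : C(I, Attach a b) := ⟨fun t => Quot.mk _ (.inr t), continuous_quot_mk.comp continuous_inr⟩

theorem edge_zero : (edge 0 : Attach a b) = incl a := Quot.sound .source

theorem edge_one : (edge 1 : Attach a b) = incl b := Quot.sound .target

/-- Maps out of the space with an attached edge. -/
def desc (j : C(X, Y)) (p : C(I, Y)) (h₀ : p 0 = j a) (h₁ : p 1 = j b) : C(Attach a b, Y) where
  toFun := Quot.lift (Sum.elim j p) (by rintro _ _ (_ | _) <;> simp [h₀, h₁])
  continuous_toFun := continuous_quot_lift _ (j.continuous.sumElim p.continuous)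

@[simp] theorem desc_incl (j : C(X, Y)) (p : C(I, Y)) (h₀ : p 0 = j a) (h₁ : p 1 = j b) (x : X) :
    desc j p h₀ h₁ (incl x) = j x := rfl

@[simp] theorem desc_edge (j : C(X, Y)) (p : C(I, Y)) (h₀ : p 0 = j a) (h₁ : p 1 = j b) (t : I) :
    desc j p h₀ h₁ (edge t) = p t := rfl

theorem ind {P : Attach a b → Prop} (h₀ : ∀ x, P (incl x)) (h₁ : ∀ t, P (edge t)) (z) : P z := by
  rcases z with ⟨x | t⟩
  exacts [h₀ x, h₁ t]

/-- Homotopies of maps out of a space with an attached edge. -/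
theorem homotopicRel {f g : C(Attach a b, Y)} {S : Set (Attach a b)} (J : C(I × X, Y))
    (P : C(I × I, Y))
    (h₀ : ∀ t, P (t, 0) = J (t, a)) (h₁ : ∀ t, P (t, 1) = J (t, b))
    (hf : ∀ x, J (0, x) = f (incl x)) (hf' : ∀ x, P (0, x) = f (edge x))
    (hg : ∀ x, J (1, x) = g (incl x)) (hg' : ∀ x, P (1, x) = g (edge x))
    (hS : ∀ x, incl x ∈ S → ∀ t, J (t, x) = f (incl x))
    (hS' : ∀ x, edge x ∈ S → ∀ t, P (t, x) = f (edge x)) : f.HomotopicRel g S := by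
  let J' : C(X, C(I, Y)) := (J.comp ⟨Prod.swap, continuous_swap⟩).curry
  let P' : C(I, C(I, Y)) := (P.comp ⟨Prod.swap, continuous_swap⟩).curry
  let D : C(Attach a b, C(I, Y)) := desc J' P' (by ext t; exact h₀ t) (by ext t; exact h₁ t)
  have key : ∀ z t, D z t = D.uncurry (z, t) := fun _ _ => rfl
  refine ⟨{ toFun := fun p => D.uncurry (p.2, p.1)
            continuous_toFun := by fun_prop
            map_zero_left := fun z => ?_
            map_one_left := fun z => ?_
            prop' := fun t z hz => ?_ }⟩
  · exact ind (P := fun z => D.uncurry (z, 0) = f z) hf hf' z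
  · exact ind (P := fun z => D.uncurry (z, 1) = g z) hg hg' z
  · exact ind (P := fun z => z ∈ S → D.uncurry (z, t) = f z) (fun x hx => hS x hx t)
      (fun x hx => hS' x hx t) z hz

theorem desc_homotopicRel {j : C(X, Y)} {p q : Path (j a) (j b)} (h : p.Homotopic q) (x₀ : X) :
    (desc j p.toContinuousMap p.source p.target : C(Attach a b, Y)).HomotopicRel
      (desc j q.toContinuousMap q.source q.target) {incl x₀} := by
  obtain ⟨K⟩ := h
  refine homotopicRel ⟨fun z => j z.2, by fun_prop⟩ ⟨fun z => K z, K.continuous⟩ (fun t => ?_)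
    (fun t => ?_) (fun x => rfl) (fun x => ?_) (fun x => rfl) (fun x => ?_) (fun x _ t => rfl)
    (fun x hx t => ?_)
  · simp
  · simp
  · exact K.apply_zero x
  · exact K.apply_one x
  · have e0 : ∀ y : I, (edge y : Attach a b) = incl x₀ → y = 0 ∨ y = 1 := by
      intro y hy
      by_contra! hne
      have h : (y = y) = False := congrArg (Quot.lift (r := AttachRel a b) (Sum.elim (fun _ => False)
        (fun t : I => t = y)) (by rintro _ _ (_ | _) <;> simp [hne.1.symm, hne.2.symm])) hy
      simp at h
    rcases e0 x hx with rfl | rfl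
    · change K (t, 0) = p 0
      simp
    · change K (t, 1) = p 1
      simp

/-- The edge as a path. -/
def path : Path (incl a : Attach a b) (incl b) := ⟨edge, edge_zero, edge_one⟩

theorem slide {a' b' : X} (γ : Path a' a) (δ : Path b b') (x₀ : X) :
    PointedEquiv (Attach a b) (Attach a' b') (incl x₀) (incl x₀) := by
  let p : Path ((incl : C(X, Attach a' b')) a) (incl b) :=
    ((γ.map incl.continuous).symm.trans path).trans (δ.map incl.continuous).symm
  let q : Path ((incl : C(X, Attach a b)) a') (incl b') :=
    ((γ.map incl.continuous).trans path).trans (δ.map incl.continuous)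
  let f : C(Attach a b, Attach a' b') := desc incl p.toContinuousMap p.source p.target
  let g : C(Attach a' b', Attach a b) := desc incl q.toContinuousMap q.source q.target
  refine ⟨f, g, rfl, rfl, ?_, ?_⟩
  · let p' : Path ((incl : C(X, Attach a b)) a) (incl b) := p.map g.continuous
    have e1 : g.comp f = desc incl p'.toContinuousMap p'.source p'.target := by
      ext z; exact ind (P := fun z => g.comp f z =
        desc incl p'.toContinuousMap p'.source p'.target z) (fun x => rfl) (fun t => rfl) z
    have e2 : ContinuousMap.id (Attach a b) = desc incl (path (a := a) (b := b)).toContinuousMap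
        path.source path.target := by
      ext z; exact ind (P := fun z => z = _) (fun x => rfl) (fun t => rfl) z
    rw [e1, e2]
    refine desc_homotopicRel ?_ x₀
    have e3 : p' = ((γ.map incl.continuous).symm.trans q).trans (δ.map incl.continuous).symm := by
      simp only [p', p, Path.map_trans, Path.map_symm, Path.map_map]
      rfl
    rw [e3, ← Path.Homotopic.Quotient.eq]
    simp only [q, Path.Homotopic.Quotient.mk_trans, Path.Homotopic.Quotient.mk_symm]
    simp only [Path.Homotopic.Quotient.trans_assoc, Path.Homotopic.Quotient.trans_symm,
      Path.Homotopic.Quotient.trans_refl]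
    rw [← Path.Homotopic.Quotient.trans_assoc]
    simp
  · let p' : Path ((incl : C(X, Attach a' b')) a') (incl b') := q.map f.continuous
    have e1 : f.comp g = desc incl p'.toContinuousMap p'.source p'.target := by
      ext z; exact ind (P := fun z => f.comp g z =
        desc incl p'.toContinuousMap p'.source p'.target z) (fun x => rfl) (fun t => rfl) z
    have e2 : ContinuousMap.id (Attach a' b') = desc incl
        (path (a := a') (b := b')).toContinuousMap path.source path.target := by
      ext z; exact ind (P := fun z => z = _) (fun x => rfl) (fun t => rfl) z
    rw [e1, e2]
    refine desc_homotopicRel ?_ x₀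
    have e3 : p' = ((γ.map incl.continuous).trans p).trans (δ.map incl.continuous) := by
      simp only [p', q, Path.map_trans, Path.map_map]
      rfl
    rw [e3, ← Path.Homotopic.Quotient.eq]
    simp only [p, Path.Homotopic.Quotient.mk_trans, Path.Homotopic.Quotient.mk_symm]
    simp only [Path.Homotopic.Quotient.trans_assoc, Path.Homotopic.Quotient.symm_trans,
      Path.Homotopic.Quotient.trans_refl]
    rw [← Path.Homotopic.Quotient.trans_assoc]
    simp

theorem congr {x : X} {y : Y} (h : PointedEquiv X Y x y) :
    PointedEquiv (Attach x x) (Attach y y) (incl x) (incl y) := by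
  obtain ⟨f, g, h1, h2, ⟨H⟩, ⟨K⟩⟩ := h
  refine ⟨desc (incl.comp f) edge (by simp [h1, edge_zero]) (by simp [h1, edge_one]),
    desc (incl.comp g) edge (by simp [h2, edge_zero]) (by simp [h2, edge_one]), by simp [h1],
    by simp [h2], ?_, ?_⟩
  · have hx : ∀ t, H (t, x) = x := fun t => (H.eq_fst t rfl).trans (by simp [h1, h2])
    refine homotopicRel ⟨fun z => incl (H z), by fun_prop⟩ ⟨fun z => edge z.2, by fun_prop⟩
      (fun t => ?_) (fun t => ?_) (fun z => ?_) (fun z => ?_) (fun z => ?_) (fun z => ?_)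
      (fun z hz t => ?_) (fun z hz t => ?_)
    · simp [hx, edge_zero]
    · simp [hx, edge_one]
    · simp
    · simp
    · simp
    · simp
    · rw [Set.mem_singleton_iff] at hz
      have hz' : z = x := congrArg (desc (Y := X) (.id X) (.const _ x) rfl rfl) hz
      subst hz'
      simp [hx, h1, h2]
    · simp
  · have hx : ∀ t, K (t, y) = y := fun t => (K.eq_fst t rfl).trans (by simp [h1, h2])
    refine homotopicRel ⟨fun z => incl (K z), by fun_prop⟩ ⟨fun z => edge z.2, by fun_prop⟩
      (fun t => ?_) (fun t => ?_) (fun z => ?_) (fun z => ?_) (fun z => ?_) (fun z => ?_)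
      (fun z hz t => ?_) (fun z hz t => ?_)
    · simp [hx, edge_zero]
    · simp [hx, edge_one]
    · simp
    · simp
    · simp
    · simp
    · rw [Set.mem_singleton_iff] at hz
      have hz' : z = y := congrArg (desc (Y := Y) (.id Y) (.const _ y) rfl rfl) hz
      subst hz'
      simp [hx, h1, h2]
    · simp

instance [CompactSpace X] (a b : X) : CompactSpace (Attach a b) :=
  inferInstanceAs (CompactSpace (Quot (AttachRel a b)))

/-- An edge in a Hausdorff space whose end points, and no other points, lie in a given compact
subspace. -/
theorem nonempty_homeomorph [T2Space X] {A : Set X} (hA : IsCompact A) (p : C(I, X))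
    (h₀ : p 0 ∈ A) (h₁ : p 1 ∈ A) (hA' : ∀ t, p t ∈ A → t = 0 ∨ t = 1)
    (hp : ∀ s t, p s = p t → s = t ∨ s = 0 ∨ s = 1) :
    ∃ e : Attach (⟨p 0, h₀⟩ : A) ⟨p 1, h₁⟩ ≃ₜ ↥(A ∪ Set.range p),
      ∀ x : A, e (incl x) = ⟨x, Or.inl x.2⟩ := by
  have : CompactSpace A := isCompact_iff_compactSpace.1 hA
  let j : C(A, ↥(A ∪ Set.range p)) := ⟨fun x => ⟨x, Or.inl x.2⟩, by fun_prop⟩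
  let q : C(I, ↥(A ∪ Set.range p)) := ⟨fun t => ⟨p t, Or.inr ⟨t, rfl⟩⟩, by fun_prop⟩
  let f : C(Attach (⟨p 0, h₀⟩ : A) ⟨p 1, h₁⟩, ↥(A ∪ Set.range p)) := desc j q rfl rfl
  have hE : ∀ t x, f (edge t) = f (incl x) → (edge t : Attach (⟨p 0, h₀⟩ : A) ⟨p 1, h₁⟩) = incl x := by
    intro t x h
    have h' : p t = x := congrArg (fun z : ↥(A ∪ Set.range p) => (z : X)) h
    rcases hA' t (h' ▸ x.2) with rfl | rfl
    · rw [edge_zero]; congr 1; exact Subtype.ext h'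
    · rw [edge_one]; congr 1; exact Subtype.ext h'
  have hI : Function.Injective f := by
    intro z w
    refine ind (P := fun z => f z = f w → z = w) (fun x => ?_) (fun t => ?_) z
    · refine ind (P := fun w => f (incl x) = f w → incl x = w) (fun y h => ?_) (fun t h => ?_) w
      · have h' : (x : X) = y := congrArg (fun z : ↥(A ∪ Set.range p) => (z : X)) h
        rw [Subtype.ext h']
      · exact (hE _ _ h.symm).symm
    · refine ind (P := fun w => f (edge t) = f w → edge t = w) (fun y h => hE _ _ h)
        (fun s h => ?_) w
      have h' : p t = p s := congrArg (fun z : ↥(A ∪ Set.range p) => (z : X)) h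
      rcases hp t s h' with rfl | h0 | h0
      · rfl
      · have hs : p s ∈ A := by rw [← h', h0]; exact h₀
        have e : (edge s : Attach (⟨p 0, h₀⟩ : A) ⟨p 1, h₁⟩) = incl ⟨p s, hs⟩ := hE _ _ rfl
        rw [e]
        exact hE _ _ (Subtype.ext h')
      · have hs : p s ∈ A := by rw [← h', h0]; exact h₁
        have e : (edge s : Attach (⟨p 0, h₀⟩ : A) ⟨p 1, h₁⟩) = incl ⟨p s, hs⟩ := hE _ _ rfl
        rw [e]
        exact hE _ _ (Subtype.ext h')
  have hS : Function.Surjective f := by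
    rintro ⟨x, hx | ⟨t, rfl⟩⟩
    · exact ⟨incl ⟨x, hx⟩, rfl⟩
    · exact ⟨edge t, rfl⟩
  exact ⟨Continuous.homeoOfEquivCompactToT2 (f := Equiv.ofBijective f ⟨hI, hS⟩) f.continuous,
    fun x => rfl⟩

end Attach

end Attach

/-! ### Subspaces that are bouquets up to homotopy -/

/-- A space with a base point. -/
structure PSpace : Type 1 where
  carrier : Type
  top : TopologicalSpace carrier
  pt : carrier

instance (X : PSpace) : TopologicalSpace X.carrier := X.top

/-- A point with `m` loops attached to it one after the other. -/
def loopModel : ℕ → PSpace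
  | 0 => ⟨Unit, inferInstance, ()⟩
  | m + 1 => ⟨Attach (loopModel m).pt (loopModel m).pt, inferInstance, Attach.incl (loopModel m).pt⟩

section BouquetLike

variable {X : Type} [TopologicalSpace X]

/-- `A` is a compact path connected subspace that is, relative to the base point `a₀`, homotopy
equivalent to a bouquet of `m` circles. -/
structure IsBouquetLike (a₀ : X) (A : Set X) (m : ℕ) : Prop where
  compact : IsCompact A
  connected : IsPathConnected A
  equiv : ∃ h : a₀ ∈ A, PointedEquiv A (loopModel m).carrier ⟨a₀, h⟩ (loopModel m).pt

theorem IsBouquetLike.mem {a₀ : X} {A : Set X} {m : ℕ} (h : IsBouquetLike a₀ A m) : a₀ ∈ A :=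
  h.equiv.1

theorem IsBouquetLike.homotopyEquiv {Y : Type} [TopologicalSpace Y] {a : X} {A : Set X} {b : Y}
    {B : Set Y} {m : ℕ} (hA : IsBouquetLike a A m) (hB : IsBouquetLike b B m) :
    Nonempty (ContinuousMap.HomotopyEquiv A B) := by
  obtain ⟨_, h⟩ := hA.equiv
  obtain ⟨_, h'⟩ := hB.equiv
  exact (h.trans h'.symm).homotopyEquiv

theorem IsBouquetLike.singleton (a₀ : X) : IsBouquetLike a₀ {a₀} 0 where
  compact := isCompact_singleton
  connected := isPathConnected_singleton a₀
  equiv := by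
    refine ⟨rfl, ?_⟩
    let e : ({a₀} : Set X) ≃ₜ Unit := Homeomorph.homeomorphOfUnique _ _
    exact PointedEquiv.of_homeomorph e _

/-- Attaching a loop. -/
theorem IsBouquetLike.loop [T2Space X] {a₀ : X} {A : Set X} {m : ℕ} (h : IsBouquetLike a₀ A m)
    (p : C(I, X)) (h₀ : p 0 ∈ A) (h₁ : p 1 ∈ A) (hA' : ∀ t, p t ∈ A → t = 0 ∨ t = 1)
    (hp : ∀ s t, p s = p t → s = t ∨ s = 0 ∨ s = 1) :
    IsBouquetLike a₀ (A ∪ Set.range p) (m + 1) := by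
  refine ⟨h.compact.union (isCompact_range p.continuous), ?_, Or.inl h.mem, ?_⟩
  · have : PathConnectedSpace I := isPathConnected_iff_pathConnectedSpace.1
      ((convex_Icc (0 : ℝ) 1).isPathConnected ⟨0, by simp⟩)
    exact h.connected.union (isPathConnected_range p.continuous) ⟨p 0, h₀, 0, rfl⟩
  · obtain ⟨hm, he⟩ := h.equiv
    obtain ⟨e, he'⟩ := Attach.nonempty_homeomorph h.compact p h₀ h₁ hA' hp
    have : PathConnectedSpace A := isPathConnected_iff_pathConnectedSpace.1 h.connected
    have s1 := PointedEquiv.of_homeomorph e.symm ⟨a₀, Or.inl hm⟩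
    rw [← he' ⟨a₀, hm⟩, e.symm_apply_apply] at s1
    have s2 := Attach.slide (a := (⟨p 0, h₀⟩ : A)) (b := ⟨p 1, h₁⟩) (a' := ⟨a₀, hm⟩)
      (b' := ⟨a₀, hm⟩) (PathConnectedSpace.somePath _ _) (PathConnectedSpace.somePath _ _) ⟨a₀, hm⟩
    have := (s1.trans s2).trans (Attach.congr he)
    rw [he'] at this
    exact this

/-- `V` can be contracted to its point `v`, which is not moved. -/
def StrongContractible (V : Set X) (v : X) : Prop :=
  ∃ (hv : v ∈ V) (H : C(I × V, V)), (∀ x, H (0, x) = x) ∧ (∀ x, H (1, x) = ⟨v, hv⟩) ∧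
    ∀ t, H (t, ⟨v, hv⟩) = ⟨v, hv⟩

theorem StrongContractible.isPathConnected {V : Set X} {v : X} (h : StrongContractible V v) :
    IsPathConnected V := by
  obtain ⟨hv, H, h0, h1, -⟩ := h
  refine ⟨v, hv, fun {x} hx => ?_⟩
  refine ⟨⟨⟨fun t => (H (unitInterval.symm t, ⟨x, hx⟩) : X), by fun_prop⟩, ?_, ?_⟩, fun t => ?_⟩
  · simp [h1]
  · simp [h0]
  · exact Subtype.coe_prop _

/-- Attaching a contractible space at one point. -/
theorem IsBouquetLike.wedge [T2Space X] {a₀ : X} {A V : Set X} {m : ℕ} {v : X}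
    (h : IsBouquetLike a₀ A m) (hc : IsCompact V) (hV : StrongContractible V v) (hv : v ∈ A)
    (hAV : ∀ x ∈ A, x ∈ V → x = v) : IsBouquetLike a₀ (A ∪ V) m := by
  have hVc := hV.isPathConnected
  obtain ⟨hvV, H, H0, H1, Hv⟩ := hV
  refine ⟨h.compact.union hc, h.connected.union hVc ⟨v, hv, hvV⟩, Or.inl h.mem, ?_⟩
  obtain ⟨hm, he⟩ := h.equiv
  refine PointedEquiv.trans ?_ he
  have cA : IsClosed {x : ↥(A ∪ V) | (x : X) ∈ A} := h.compact.isClosed.preimage continuous_subtype_val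
  have cV : IsClosed {x : ↥(A ∪ V) | (x : X) ∈ V} := hc.isClosed.preimage continuous_subtype_val
  classical
  let F : I × ↥(A ∪ V) → ↥(A ∪ V) := fun z =>
    if hz : (z.2 : X) ∈ V then ⟨H (z.1, ⟨z.2, hz⟩), Or.inr (Subtype.coe_prop _)⟩ else z.2
  have FA : ∀ z : I × ↥(A ∪ V), (z.2 : X) ∈ A → F z = z.2 := by
    rintro ⟨t, x⟩ hx
    by_cases hz : (x : X) ∈ V
    · have hxv := hAV x hx hz
      simp only [F, hz, dif_pos]
      have : (⟨x, hz⟩ : V) = ⟨v, hvV⟩ := Subtype.ext hxv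
      refine Subtype.ext ?_
      simp only [Hv, hxv]
    · simp only [F, hz, dif_neg, not_false_eq_true]
  have FV : ∀ z : I × ↥(A ∪ V), ∀ hz : (z.2 : X) ∈ V, (F z : X) = H (z.1, ⟨z.2, hz⟩) := by
    intro z hz
    simp only [F, hz, dif_pos]
  have Fc : Continuous F := by
    have hcov : (Prod.snd ⁻¹' {x : ↥(A ∪ V) | (x : X) ∈ A}) ∪
        (Prod.snd ⁻¹' {x : ↥(A ∪ V) | (x : X) ∈ V}) = (Set.univ : Set (I × ↥(A ∪ V))) := by
      ext ⟨t, x, hx⟩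
      simpa using hx
    rw [← continuousOn_univ, ← hcov]
    refine ContinuousOn.union_of_isClosed ?_ ?_ (cA.preimage continuous_snd)
      (cV.preimage continuous_snd)
    · exact continuous_snd.continuousOn.congr fun z hz => FA z hz
    · rw [continuousOn_iff_continuous_domRestrict, continuous_induced_rng]
      have : (Subtype.val ∘ (Prod.snd ⁻¹' {x : ↥(A ∪ V) | (x : X) ∈ V}).domRestrict F) =
          fun z => (H (z.1.1, ⟨z.1.2, z.2⟩) : X) := by
        funext z
        exact FV z.1 z.2
      rw [this]
      have : Continuous fun z : ↥(Prod.snd ⁻¹' {x : ↥(A ∪ V) | (x : X) ∈ V} : Set (I × ↥(A ∪ V))) =>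
          ((z.1.1, ⟨z.1.2, z.2⟩) : I × V) := by
        refine (continuous_fst.comp continuous_subtype_val).prodMk ?_
        exact Continuous.subtype_mk (by fun_prop) _
      fun_prop
  have F1 : ∀ x : ↥(A ∪ V), (F (1, x) : X) ∈ A := by
    rintro ⟨x, hx⟩
    by_cases hz : x ∈ V
    · rw [FV (1, ⟨x, hx⟩) hz, H1]; exact hv
    · simp only [F, hz, dif_neg, not_false_eq_true]
      exact hx.resolve_right hz
  let r : C(↥(A ∪ V), A) := ⟨fun x => ⟨F (1, x), F1 x⟩, by fun_prop⟩
  let j : C(A, ↥(A ∪ V)) := ⟨fun x => ⟨x, Or.inl x.2⟩, by fun_prop⟩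
  have rj : r.comp j = .id A := by
    ext x
    change (F (1, j x) : X) = x
    rw [FA (1, j x) x.2]
    rfl
  refine ⟨r, j, ?_, rfl, ⟨ContinuousMap.HomotopyRel.symm
    { toFun := F
      continuous_toFun := Fc
      map_zero_left := fun x => ?_
      map_one_left := fun x => rfl
      prop' := ?_ }⟩, rj ▸ ContinuousMap.HomotopicRel.refl _⟩
  · exact congrArg (fun f => f ⟨a₀, hm⟩) rj
  · by_cases hz : (x : X) ∈ V
    · refine Subtype.ext ?_
      rw [FV (0, x) hz, H0]
      rfl
    · simp only [F, hz, dif_neg, not_false_eq_true]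
      rfl
  · rintro t x rfl
    exact FA _ hm

end BouquetLike

end Cacti

namespace Cacti

/-! ### The word of arcs -/

section Word

variable {ι κ : Type}

mutual

/-- The arcs in the order in which the outside circle traverses them, each given by the label of its
lobe, read through `g`, and its length. -/
def Branches.word (g : ι → κ) : Branches ι ℝ → List (κ × ℝ)
  | .nil => []
  | .cons i v rest => v.word g (g i) ++ rest.word g

/-- See `Branches.word`; the lobe under consideration has the label `k`. -/
def Lobe.word (g : ι → κ) (k : κ) : Lobe ι ℝ → List (κ × ℝ)
  | .close x => [(k, x)]
  | .arc x b rest => (k, x) :: (b.word g ++ rest.word g k)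

end

theorem Branches.word_append (g : ι → κ) (a b : Branches ι ℝ) :
    (a.append b).word g = a.word g ++ b.word g := by
  induction a using Branches.rec (motive_2 := fun _ => True) with
  | nil => simp [Branches.append, Branches.word]
  | cons i v rest _ ih => simp [Branches.append, Branches.word, ih]
  | close => trivial
  | arc => trivial

/-- Delete the letters of length zero. -/
noncomputable def dropZeros (l : List (κ × ℝ)) : List (κ × ℝ) := l.filter fun p => p.2 ≠ 0

theorem dropZeros_append (l l' : List (κ × ℝ)) :
    dropZeros (l ++ l') = dropZeros l ++ dropZeros l' := by simp [dropZeros]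

theorem dropZeros_eq_self (l : List (κ × ℝ)) (h : ∀ p ∈ l, 0 < p.2) : dropZeros l = l := by
  simp only [dropZeros, List.filter_eq_self]
  intro p hp
  simpa using (h p hp).ne'

/-- The word of what is left of a lobe by `Lobe.collapse`. -/
def collapseWord (g : ι → κ) (k : κ) : Branches ι ℝ × Option (Lobe ι ℝ × Branches ι ℝ) →
    List (κ × ℝ)
  | (pre, none) => pre.word g
  | (pre, some (v, post)) => pre.word g ++ (v.word g k ++ post.word g)

mutual

theorem Branches.word_collapse (g : ι → κ) : ∀ b : Branches ι ℝ,
    b.collapse.word g = dropZeros (b.word g)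
  | .nil => by simp [Branches.collapse, Branches.word, dropZeros]
  | .cons i v rest => by
      have h1 := Lobe.word_collapse g (g i) v
      have h2 := Branches.word_collapse g rest
      rcases hv : v.collapse with ⟨pre, _ | ⟨v', post⟩⟩ <;>
        simp [hv, collapseWord, Branches.collapse, Branches.word, dropZeros_append,
          Branches.word_append, ← h1, h2]

theorem Lobe.word_collapse (g : ι → κ) (k : κ) : ∀ v : Lobe ι ℝ,
    collapseWord g k v.collapse = dropZeros (v.word g k)
  | .close x => by
      by_cases hx : x = 0 <;>
        simp [hx, Lobe.collapse, collapseWord, Lobe.word, Branches.word, dropZeros]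
  | .arc x b rest => by
      have h1 := Lobe.word_collapse g k rest
      have h2 := Branches.word_collapse g b
      have h3 : dropZeros ((Lobe.arc x b rest).word g k) =
          (if x = 0 then [] else [(k, x)]) ++ (dropZeros (b.word g) ++ dropZeros (rest.word g k)) := by
        rw [← dropZeros_append, Lobe.word]
        by_cases hx : x = 0 <;> simp [hx, dropZeros]
      rw [h3, ← h2, ← h1]
      rcases hv : rest.collapse with ⟨pre, _ | ⟨v', post⟩⟩ <;> by_cases hx : x = 0 <;>
        simp [hx, hv, Lobe.collapse, collapseWord, Lobe.word, Branches.word, Branches.word_append]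

end

mutual

theorem Branches.word_pos (g : ι → κ) : ∀ b : Branches ι ℝ, b.AllEdges (0 < ·) →
    ∀ p ∈ b.word g, 0 < p.2
  | .nil, _ => by simp [Branches.word]
  | .cons i v rest, h => by
      intro p hp
      rw [Branches.word, List.mem_append] at hp
      exact hp.elim (Lobe.word_pos g _ v h.1 p) (Branches.word_pos g rest h.2 p)

theorem Lobe.word_pos (g : ι → κ) (k : κ) : ∀ v : Lobe ι ℝ, v.AllEdges (0 < ·) →
    ∀ p ∈ v.word g k, 0 < p.2
  | .close x, h => by simpa [Lobe.word, Lobe.AllEdges] using h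
  | .arc x b rest, h => by
      intro p hp
      rw [Lobe.word, List.mem_cons, List.mem_append] at hp
      rcases hp with rfl | hp | hp
      · exact h.1
      · exact Branches.word_pos g b h.2.1 p hp
      · exact Lobe.word_pos g k rest h.2.2 p hp

end

end Word

/-! ### Invariants of words -/

section Invariants

variable {κ : Type}

/-- The part of the time `u` that is spent on an arc of length `x` starting at time `0`. -/
noncomputable def clip (x u : ℝ) : ℝ := max 0 (min x u)

theorem clip_zero (u : ℝ) : clip 0 u = 0 := by simp [clip]

theorem clip_add {x y : ℝ} (hx : 0 ≤ x) (hy : 0 ≤ y) (u : ℝ) :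
    clip x u + clip y (u - x) = clip (x + y) u := by
  simp only [clip]
  rcases le_total u 0 with h | h
  · rw [min_eq_right (h.trans hx), max_eq_left h, min_eq_right (by linarith),
      max_eq_left (by linarith), min_eq_right (by linarith), max_eq_left h, add_zero]
  · rcases le_total u x with h' | h'
    · rw [min_eq_right h', max_eq_right h, min_eq_right (by linarith),
        max_eq_left (by linarith), min_eq_right (by linarith), max_eq_right h, add_zero]
    · rw [min_eq_left h', max_eq_right hx]
      rcases le_total u (x + y) with h'' | h''
      · rw [min_eq_right (by linarith), max_eq_right (by linarith), min_eq_right h'',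
          max_eq_right h]; ring
      · rw [min_eq_left (by linarith), max_eq_right hy, min_eq_left h'',
          max_eq_right (by linarith)]

/-- The sum of the lengths, scaled by `r`, of the arcs not labelled `none`. -/
def baseLength (r : κ → ℝ) : List (Option κ × ℝ) → ℝ
  | [] => 0
  | (none, _) :: l => baseLength r l
  | (some j, x) :: l => r j * x + baseLength r l

/-- The arcs labelled `none` as point masses on the scaled time axis, whose origin is at `s`. -/
noncomputable def mu (r : κ → ℝ) : List (Option κ × ℝ) → ℝ → (ℝ →₀ ℝ)
  | [], _ => 0
  | (none, x) :: l, s => Finsupp.single s x + mu r l s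
  | (some j, x) :: l, s => mu r l (s + r j * x)

theorem baseLength_append (r : κ → ℝ) (l l' : List (Option κ × ℝ)) :
    baseLength r (l ++ l') = baseLength r l + baseLength r l' := by
  induction l with
  | nil => simp [baseLength]
  | cons p l ih => rcases p with ⟨_ | j, x⟩ <;> simp [baseLength, ih, add_assoc]

theorem mu_append (r : κ → ℝ) (l l' : List (Option κ × ℝ)) (s : ℝ) :
    mu r (l ++ l') s = mu r l s + mu r l' (s + baseLength r l) := by
  induction l generalizing s with
  | nil => simp [mu, baseLength]
  | cons p l ih => rcases p with ⟨_ | j, x⟩ <;> simp [mu, baseLength, ih, add_assoc]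

theorem mu_dropZeros (r : κ → ℝ) (l : List (Option κ × ℝ)) (s : ℝ) :
    mu r (dropZeros l) s = mu r l s := by
  induction l generalizing s with
  | nil => rfl
  | cons p l ih =>
    by_cases hp : p.2 = 0
    · have : dropZeros (p :: l) = dropZeros l := by simp [dropZeros, hp]
      rw [this, ih]
      rcases p with ⟨_ | j, x⟩ <;> simp only at hp <;> simp [mu, hp]
    · have : dropZeros (p :: l) = p :: dropZeros l := by simp [dropZeros, hp]
      rw [this]
      rcases p with ⟨_ | j, x⟩ <;> simp [mu, ih]

theorem mu_eq_zero (r : κ → ℝ) (l : List (Option κ × ℝ)) (h : ∀ p ∈ l, p.1 ≠ none) (s : ℝ) :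
    mu r l s = 0 := by
  induction l generalizing s with
  | nil => rfl
  | cons p l ih =>
    rcases p with ⟨_ | j, x⟩
    · exact absurd rfl (h _ List.mem_cons_self)
    · exact ih (fun p hp => h p (List.mem_cons_of_mem _ hp)) _

theorem mu_nonneg (r : κ → ℝ) (l : List (Option κ × ℝ)) (h : ∀ p ∈ l, 0 < p.2) (s y : ℝ) :
    0 ≤ mu r l s y := by
  induction l generalizing s with
  | nil => simp [mu]
  | cons p l ih =>
    have ih' := ih fun p hp => h p (List.mem_cons_of_mem _ hp)
    rcases p with ⟨_ | j, x⟩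
    · have := h _ List.mem_cons_self
      rw [mu, Finsupp.add_apply, Finsupp.single_apply]
      split_ifs <;> linarith [ih' s]
    · exact ih' _

theorem mu_apply_of_lt {r : κ → ℝ} (hr : ∀ i, 0 < r i) (l : List (Option κ × ℝ))
    (h : ∀ p ∈ l, 0 < p.2) {s y : ℝ} (hy : y < s) : mu r l s y = 0 := by
  induction l generalizing s with
  | nil => simp [mu]
  | cons p l ih =>
    have ih' := fun s => @ih (fun p hp => h p (List.mem_cons_of_mem _ hp)) s
    rcases p with ⟨_ | j, x⟩
    · rw [mu, Finsupp.add_apply, Finsupp.single_apply, if_neg hy.ne', ih' s hy, add_zero]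
    · exact ih' _ (by linarith [mul_pos (hr j) (h _ List.mem_cons_self)])

/-- Words of positive arcs in which adjacent arcs belong to different lobes. -/
structure ReducedWord (l : List (κ × ℝ)) : Prop where
  pos : ∀ p ∈ l, 0 < p.2
  chain : l.IsChain fun p q => p.1 ≠ q.1

theorem ReducedWord.tail {p : κ × ℝ} {l : List (κ × ℝ)} (h : ReducedWord (p :: l)) :
    ReducedWord l := ⟨fun q hq => h.pos q (List.mem_cons_of_mem _ hq), h.chain.tail⟩

variable [DecidableEq κ]

/-- The time spent on the lobe `i` up to the time `u`, where no time passes on arcs labelled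
`none`. -/
noncomputable def phi (i : κ) : List (Option κ × ℝ) → ℝ → ℝ
  | [], _ => 0
  | (none, _) :: l, u => phi i l u
  | (some j, x) :: l, u => (if j = i then clip x u else 0) + phi i l (u - x)

theorem phi_append (i : κ) (l l' : List (Option κ × ℝ)) (u : ℝ) :
    phi i (l ++ l') u = phi i l u + phi i l' (u - baseLength (fun _ => 1) l) := by
  induction l generalizing u with
  | nil => simp [phi, baseLength]
  | cons p l ih =>
    rcases p with ⟨_ | j, x⟩ <;> simp [phi, baseLength, ih, add_assoc, sub_sub]

/-- The words have the same arcs, up to subdivision, if the letters `none` are ignored. -/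
def SameBase (l l' : List (Option κ × ℝ)) : Prop :=
  (∀ r, baseLength r l = baseLength r l') ∧ ∀ i u, phi i l u = phi i l' u

theorem SameBase.refl (l : List (Option κ × ℝ)) : SameBase l l := ⟨fun _ => rfl, fun _ _ => rfl⟩

theorem SameBase.symm {l l' : List (Option κ × ℝ)} (h : SameBase l l') : SameBase l' l :=
  ⟨fun r => (h.1 r).symm, fun i u => (h.2 i u).symm⟩

theorem SameBase.trans {l l' l'' : List (Option κ × ℝ)} (h : SameBase l l')
    (h' : SameBase l' l'') : SameBase l l'' :=
  ⟨fun r => (h.1 r).trans (h'.1 r), fun i u => (h.2 i u).trans (h'.2 i u)⟩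

theorem SameBase.append {l l' m m' : List (Option κ × ℝ)} (h : SameBase l l')
    (h' : SameBase m m') : SameBase (l ++ m) (l' ++ m') :=
  ⟨fun r => by simp [baseLength_append, h.1, h'.1], fun i u => by
    simp [phi_append, h.1, h.2, h'.2]⟩

theorem SameBase.cons {l l' : List (Option κ × ℝ)} (p : Option κ × ℝ) (h : SameBase l l') :
    SameBase (p :: l) (p :: l') := (SameBase.refl [p]).append h

theorem SameBase.cons_none {l l' : List (Option κ × ℝ)} (x : ℝ) (h : SameBase l l') :
    SameBase ((none, x) :: l) l' :=
  ⟨fun r => by simp [baseLength, h.1], fun i u => by simp [phi, h.2]⟩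

theorem sameBase_merge {x y : ℝ} (hx : 0 ≤ x) (hy : 0 ≤ y) (k : Option κ)
    (l : List (Option κ × ℝ)) : SameBase ((k, x + y) :: l) ((k, x) :: (k, y) :: l) := by
  rcases k with _ | j
  · exact ⟨fun r => rfl, fun i u => rfl⟩
  · refine ⟨fun r => by simp [baseLength]; ring, fun i u => ?_⟩
    by_cases h : j = i <;> simp [phi, h, ← clip_add hx hy, add_assoc, sub_sub]

theorem sameBase_dropZeros (l : List (Option κ × ℝ)) : SameBase (dropZeros l) l := by
  induction l with
  | nil => exact SameBase.refl _
  | cons p l ih =>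
    by_cases hp : p.2 = 0
    · have : dropZeros (p :: l) = dropZeros l := by simp [dropZeros, hp]
      rw [this]
      refine ih.trans ⟨fun r => ?_, fun i u => ?_⟩ <;> rcases p with ⟨_ | j, x⟩ <;>
        simp only at hp <;> simp [baseLength, phi, hp, clip_zero]
    · have : dropZeros (p :: l) = p :: dropZeros l := by simp [dropZeros, hp]
      rw [this]
      exact ih.cons p

theorem phi_of_nonpos (i : κ) (l : List (Option κ × ℝ)) (h : ∀ p ∈ l, 0 < p.2) {u : ℝ}
    (hu : u ≤ 0) : phi i l u = 0 := by
  induction l generalizing u with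
  | nil => rfl
  | cons p l ih =>
    have ih' := fun u => @ih (fun p hp => h p (List.mem_cons_of_mem _ hp)) u
    have hp := h _ List.mem_cons_self
    rcases p with ⟨_ | j, x⟩
    · exact ih' _ hu
    · simp only at hp
      rw [phi, ih' _ (by linarith), clip, max_eq_left (min_le_of_right_le hu)]
      simp

theorem phi_cons_of_le {i j : κ} {x : ℝ} (l : List (Option κ × ℝ))
    (h : ∀ p ∈ (some j, x) :: l, 0 < p.2) {u : ℝ} (h0 : 0 ≤ u) (hu : u ≤ x) :
    phi i ((some j, x) :: l) u = if j = i then u else 0 := by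
  rw [phi, phi_of_nonpos i l (fun p hp => h p (List.mem_cons_of_mem _ hp)) (by linarith), clip,
    min_eq_right hu, max_eq_right h0, add_zero]

theorem ReducedWord.first_arc_le {r : κ → ℝ} (hr : ∀ i, 0 < r i) {i : κ} {x y s : ℝ}
    {l l' : List (Option κ × ℝ)}
    (h : ReducedWord ((some i, x) :: l)) (h' : ReducedWord ((some i, y) :: l'))
    (hmu : mu r ((some i, x) :: l) s = mu r ((some i, y) :: l') s)
    (hphi : ∀ k u, phi k ((some i, x) :: l) u = phi k ((some i, y) :: l') u) : y ≤ x := by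
  by_contra! hlt
  have hx := h.pos _ List.mem_cons_self
  simp only at hx
  rcases l with _ | ⟨⟨_ | k, z⟩, l⟩
  · have := hphi i y
    rw [phi_cons_of_le _ h'.pos (by linarith) le_rfl] at this
    simp [phi, clip, min_eq_left hlt.le, max_eq_right hx.le] at this
    linarith
  · have hz := h.tail.pos _ List.mem_cons_self
    simp only at hz
    have := DFunLike.congr_fun hmu (s + r i * x)
    rw [mu, mu, mu, mu_apply_of_lt hr l' h'.tail.pos (by linarith [mul_lt_mul_of_pos_left hlt (hr i)]),
      Finsupp.add_apply, Finsupp.single_eq_same] at this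
    linarith [mu_nonneg r l h.tail.tail.pos (s + r i * x) (s + r i * x)]
  · have hz := h.tail.pos _ List.mem_cons_self
    simp only at hz
    have hik : i ≠ k := (List.isChain_cons_cons.1 h.chain).1 ∘ congrArg some
    have hu : x < min y (x + z) := lt_min hlt (by linarith)
    have := hphi k (min y (x + z))
    rw [phi_cons_of_le _ h'.pos (by linarith) (min_le_left _ _), if_neg hik, phi, if_neg hik,
      phi_cons_of_le _ h.tail.pos (by linarith) (by linarith [min_le_right y (x + z)]),
      if_pos rfl] at this
    linarith

theorem ReducedWord.ext {r : κ → ℝ} (hr : ∀ i, 0 < r i) {l l' : List (Option κ × ℝ)} {s : ℝ}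
    (h : ReducedWord l) (h' : ReducedWord l') (hmu : mu r l s = mu r l' s)
    (hphi : ∀ i u, phi i l u = phi i l' u) : l = l' := by
  have aux : ∀ {i : κ} {x y s : ℝ} {l l' : List (Option κ × ℝ)}, ReducedWord ((none, x) :: l) →
      ReducedWord ((some i, y) :: l') → mu r ((none, x) :: l) s ≠ mu r ((some i, y) :: l') s := by
    intro i x y s l l' h h' he
    have hx := h.pos _ List.mem_cons_self
    have hy := h'.pos _ List.mem_cons_self
    simp only at hx hy
    have := DFunLike.congr_fun he s
    rw [mu, mu, mu_apply_of_lt hr l' h'.tail.pos (by linarith [mul_pos (hr i) hy]),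
      Finsupp.add_apply, Finsupp.single_eq_same] at this
    linarith [mu_nonneg r l h.tail.pos s s]
  have aux0 : ∀ {p : Option κ × ℝ} {s : ℝ} {l : List (Option κ × ℝ)}, ReducedWord (p :: l) →
      mu r (p :: l) s = 0 → (∀ i u, phi i (p :: l) u = 0) → False := by
    rintro ⟨_ | i, x⟩ s l h he hp
    · have hx := h.pos _ List.mem_cons_self
      simp only at hx
      have := DFunLike.congr_fun he s
      rw [mu, Finsupp.add_apply, Finsupp.single_eq_same, Finsupp.zero_apply] at this
      linarith [mu_nonneg r l h.tail.pos s s]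
    · have hx := h.pos _ List.mem_cons_self
      simp only at hx
      have := hp i x
      rw [phi_cons_of_le _ h.pos hx.le le_rfl, if_pos rfl] at this
      linarith
  have aux2 : ∀ {x s : ℝ} {l : List (Option κ × ℝ)}, ReducedWord ((none, x) :: l) →
      mu r l s s = 0 := by
    rintro x s (_ | ⟨⟨_ | i, y⟩, l⟩) h
    · rfl
    · exact absurd rfl (List.isChain_cons_cons.1 h.chain).1
    · have hy := h.tail.pos _ List.mem_cons_self
      exact mu_apply_of_lt hr l h.tail.tail.pos (by linarith [mul_pos (hr i) hy])
  induction l generalizing l' s with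
  | nil =>
    rcases l' with _ | ⟨p, l'⟩
    · rfl
    · exact (aux0 h' hmu.symm fun i u => (hphi i u).symm).elim
  | cons p l ih =>
    rcases l' with _ | ⟨q, l'⟩
    · exact (aux0 h hmu hphi).elim
    rcases p with ⟨_ | i, x⟩ <;> rcases q with ⟨_ | j, y⟩
    · have hxy : x = y := by
        have := DFunLike.congr_fun hmu s
        rwa [mu, mu, Finsupp.add_apply, Finsupp.add_apply, aux2 h, aux2 h',
          Finsupp.single_eq_same, Finsupp.single_eq_same, add_zero, add_zero] at this
      subst hxy
      rw [mu, mu, add_right_inj] at hmu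
      rw [ih h.tail h'.tail hmu hphi]
    · exact (aux h h' hmu).elim
    · exact (aux h' h hmu.symm).elim
    · have hx := h.pos _ List.mem_cons_self
      have hy := h'.pos _ List.mem_cons_self
      simp only at hx hy
      have hij : i = j := by
        by_contra hij
        have := hphi i (min x y)
        rw [phi_cons_of_le _ h.pos (le_min hx.le hy.le) (min_le_left _ _), if_pos rfl,
          phi_cons_of_le _ h'.pos (le_min hx.le hy.le) (min_le_right _ _),
          if_neg (Ne.symm hij)] at this
        linarith [lt_min hx hy]
      subst hij
      have hxy : x = y := le_antisymm
        (h'.first_arc_le hr h hmu.symm fun k u => (hphi k u).symm) (h.first_arc_le hr h' hmu hphi)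
      subst hxy
      rw [mu, mu] at hmu
      rw [ih h.tail h'.tail hmu fun k u => ?_]
      have := hphi k (u + x)
      rwa [phi, phi, add_sub_cancel_right, add_right_inj] at this

end Invariants

end Cacti

namespace Cacti

/-! ### Trees are determined by their words -/

section Parse

variable {ι κ : Type}

mutual

theorem Branches.label_of_mem_word (g : ι → κ) : ∀ (b : Branches ι ℝ) (p : κ × ℝ),
    p ∈ b.word g → ∃ i ∈ b.labels, p.1 = g i
  | .nil, p, h => by simp [Branches.word] at h
  | .cons i v rest, p, h => by
      rw [Branches.word, List.mem_append] at h
      simp only [Branches.labels, List.mem_cons, List.mem_append]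
      rcases h with h | h
      · rcases Lobe.label_of_mem_word g (g i) v p h with h | ⟨j, hj, h⟩
        · exact ⟨i, Or.inl rfl, h⟩
        · exact ⟨j, Or.inr (Or.inl hj), h⟩
      · obtain ⟨j, hj, h⟩ := Branches.label_of_mem_word g rest p h
        exact ⟨j, Or.inr (Or.inr hj), h⟩

theorem Lobe.label_of_mem_word (g : ι → κ) (k : κ) : ∀ (v : Lobe ι ℝ) (p : κ × ℝ),
    p ∈ v.word g k → p.1 = k ∨ ∃ i ∈ v.labels, p.1 = g i
  | .close x, p, h => by
      simp only [Lobe.word, List.mem_singleton] at h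
      exact Or.inl (by rw [h])
  | .arc x b rest, p, h => by
      rw [Lobe.word, List.mem_cons, List.mem_append] at h
      simp only [Lobe.labels, List.mem_append]
      rcases h with rfl | h | h
      · exact Or.inl rfl
      · obtain ⟨j, hj, h⟩ := Branches.label_of_mem_word g b p h
        exact Or.inr ⟨j, Or.inl hj, h⟩
      · rcases Lobe.label_of_mem_word g k rest p h with h | ⟨j, hj, h⟩
        · exact Or.inl h
        · exact Or.inr ⟨j, Or.inr hj, h⟩

end

theorem Lobe.word_eq_cons (g : ι → κ) (k : κ) (v : Lobe ι ℝ) :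
    ∃ x l, v.word g k = (k, x) :: l := by
  cases v
  exacts [⟨_, _, rfl⟩, ⟨_, _, rfl⟩]

theorem Branches.word_ne_nil (g : ι → κ) (b : Branches ι ℝ) (h : ¬ b.IsNil) : b.word g ≠ [] := by
  cases b with
  | nil => exact absurd trivial h
  | cons i v rest =>
    obtain ⟨x, l, hv⟩ := v.word_eq_cons g (g i)
    simp [Branches.word, hv]

theorem isChain_append_of_disjoint {l l' : List (κ × ℝ)}
    (h : l.IsChain fun p q => p.1 ≠ q.1) (h' : l'.IsChain fun p q => p.1 ≠ q.1)
    (hd : ∀ p ∈ l, ∀ q ∈ l', p.1 ≠ q.1) : (l ++ l').IsChain fun p q => p.1 ≠ q.1 := by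
  refine List.isChain_append.2 ⟨h, h', fun p hp q hq => hd p ?_ q ?_⟩
  · exact List.mem_of_getLast? hp
  · exact List.mem_of_head? hq

mutual

theorem Branches.isChain_word {g : ι → κ} (hg : g.Injective) : ∀ b : Branches ι ℝ,
    b.labels.Nodup → b.WhiteLeaves → (b.word g).IsChain fun p q => p.1 ≠ q.1
  | .nil, _, _ => by simp [Branches.word]
  | .cons i v rest, hn, hw => by
      simp only [Branches.labels, List.nodup_cons, List.mem_append, List.nodup_append] at hn
      obtain ⟨hi, hnv, hnr, hd⟩ := hn
      rw [not_or] at hi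
      refine isChain_append_of_disjoint (Lobe.isChain_word hg i v hnv hi.1 hw.1)
        (Branches.isChain_word hg rest hnr hw.2) fun p hp q hq hpq => ?_
      obtain ⟨j, hj, hjq⟩ := Branches.label_of_mem_word g rest q hq
      rcases Lobe.label_of_mem_word g _ v p hp with h | ⟨j', hj', h⟩
      · exact hi.2 (hg (h.symm.trans (hpq.trans hjq)) ▸ hj)
      · exact hd j' hj' j hj (hg (h.symm.trans (hpq.trans hjq)))

theorem Lobe.isChain_word {g : ι → κ} (hg : g.Injective) (i : ι) : ∀ v : Lobe ι ℝ,
    v.labels.Nodup → i ∉ v.labels → v.WhiteLeaves →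
      (v.word g (g i)).IsChain fun p q => p.1 ≠ q.1
  | .close x, _, _, _ => by simp [Lobe.word]
  | .arc x b rest, hn, hi, hw => by
      simp only [Lobe.labels, List.nodup_append, List.mem_append, not_or] at hn hi
      obtain ⟨hnb, hnr, hd⟩ := hn
      have hb : ∀ p ∈ b.word g, g i ≠ p.1 := fun p hp h => by
        obtain ⟨j, hj, hj'⟩ := Branches.label_of_mem_word g b p hp
        exact hi.1 (hg (h.trans hj') ▸ hj)
      rw [Lobe.word]
      refine List.isChain_cons.2 ⟨fun p hp => ?_, isChain_append_of_disjoint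
        (Branches.isChain_word hg b hnb hw.2.1) (Lobe.isChain_word hg i rest hnr hi.2 hw.2.2)
        fun p hp q hq hpq => ?_⟩
      · obtain ⟨q, l, hq⟩ := List.exists_cons_of_ne_nil (b.word_ne_nil g hw.1)
        simp only [hq, List.cons_append, List.head?_cons, Option.mem_some_iff] at hp
        exact hb p (by simp [hq, hp])
      · rcases Lobe.label_of_mem_word g _ rest q hq with h | ⟨j, hj, h⟩
        · exact hb p hp (hpq.trans h).symm
        · obtain ⟨j', hj', h'⟩ := Branches.label_of_mem_word g b p hp
          exact hd j' hj' j hj (hg (h'.symm.trans (hpq.trans h)))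

end

theorem eq_of_append_cons_eq {k : κ} {x x' : ℝ} : ∀ {l l' m m' : List (κ × ℝ)},
    (∀ p ∈ l, p.1 ≠ k) → (∀ p ∈ l', p.1 ≠ k) → l ++ (k, x) :: m = l' ++ (k, x') :: m' →
      l = l' ∧ (k, x) :: m = (k, x') :: m'
  | [], [], _, _, _, _, h => ⟨rfl, h⟩
  | [], q :: l', _, _, _, h', h => by
      simp only [List.nil_append, List.cons_append, List.cons.injEq] at h
      exact absurd (congrArg Prod.fst h.1).symm (h' q List.mem_cons_self)
  | p :: l, [], _, _, h, _, he => by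
      simp only [List.nil_append, List.cons_append, List.cons.injEq] at he
      exact absurd (congrArg Prod.fst he.1) (h p List.mem_cons_self)
  | p :: l, q :: l', m, m', h, h', he => by
      simp only [List.cons_append, List.cons.injEq] at he
      obtain ⟨h1, h2⟩ := eq_of_append_cons_eq (fun p hp => h p (List.mem_cons_of_mem _ hp))
        (fun p hp => h' p (List.mem_cons_of_mem _ hp)) he.2
      exact ⟨by rw [he.1, h1], h2⟩

theorem Lobe.perim_pos {v : Lobe ι ℝ} (h : v.AllEdges (0 < ·)) : 0 < v.perim := by
  induction v using Lobe.rec (motive_1 := fun _ => True) with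
  | nil => trivial
  | cons => trivial
  | close x => exact h
  | arc x b rest _ ih => exact add_pos h.1 (ih h.2.2)

mutual

theorem Branches.eq_of_word_eq {g : ι → κ} (hg : g.Injective) : ∀ b b' : Branches ι ℝ,
    b.Good → b'.Good → b.labels.Nodup → b'.labels.Nodup → b.word g = b'.word g → b = b'
  | .nil, .nil, _, _, _, _, _ => rfl
  | .nil, .cons i v rest, _, _, _, _, h => by
      exact absurd h.symm (Branches.word_ne_nil g (.cons i v rest) id)
  | .cons i v rest, .nil, _, _, _, _, h => by
      exact absurd h (Branches.word_ne_nil g (.cons i v rest) id)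
  | .cons i v rest, .cons i' v' rest', hb, hb', hn, hn', h => by
      rw [Branches.good_cons] at hb hb'
      simp only [Branches.labels, List.nodup_cons, List.mem_append, List.nodup_append] at hn hn'
      obtain ⟨hi, hnv, hnr, hd⟩ := hn
      obtain ⟨hi', hnv', hnr', hd'⟩ := hn'
      rw [not_or] at hi hi'
      have hii : i = i' := by
        obtain ⟨x, l, e⟩ := v.word_eq_cons g (g i)
        obtain ⟨x', l', e'⟩ := v'.word_eq_cons g (g i')
        simp only [Branches.word, e, e', List.cons_append, List.cons.injEq, Prod.mk.injEq] at h
        exact hg h.1.1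
      subst hii
      obtain ⟨rfl, h2⟩ := Lobe.eq_of_word_append_eq hg i v v' hb.1 hb'.1
        (hb.2.1.trans hb'.2.1.symm) hnv hnv' hi.1 hi'.1 _ _ h
      rw [Branches.eq_of_word_eq hg rest rest' hb.2.2 hb'.2.2 hnr hnr' h2]

theorem Lobe.eq_of_word_append_eq {g : ι → κ} (hg : g.Injective) (i : ι) : ∀ v v' : Lobe ι ℝ,
    v.Good → v'.Good → v.perim = v'.perim → v.labels.Nodup → v'.labels.Nodup →
    i ∉ v.labels → i ∉ v'.labels → ∀ m m' : List (κ × ℝ),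
    v.word g (g i) ++ m = v'.word g (g i) ++ m' → v = v' ∧ m = m'
  | .close x, .close x', _, _, _, _, _, _, _, m, m', h => by
      simp only [Lobe.word, List.cons_append, List.nil_append, List.cons.injEq, Prod.mk.injEq] at h
      exact ⟨by rw [h.1.2], h.2⟩
  | .close x, .arc x' b' rest', _, hv', hp, _, _, _, _, m, m', h => by
      simp only [Lobe.word, List.cons_append, List.nil_append, List.cons.injEq, Prod.mk.injEq] at h
      have := Lobe.perim_pos ((Lobe.good_arc _ _ _).1 hv').2.2.2.2.1
      simp only [Lobe.perim] at hp
      linarith [h.1.2]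
  | .arc x b rest, .close x', hv, _, hp, _, _, _, _, m, m', h => by
      simp only [Lobe.word, List.cons_append, List.nil_append, List.cons.injEq, Prod.mk.injEq] at h
      have := Lobe.perim_pos ((Lobe.good_arc _ _ _).1 hv).2.2.2.2.1
      simp only [Lobe.perim] at hp
      linarith [h.1.2]
  | .arc x b rest, .arc x' b' rest', hv, hv', hp, hn, hn', hi, hi', m, m', h => by
      rw [Lobe.good_arc] at hv hv'
      simp only [Lobe.labels, List.nodup_append, List.mem_append, not_or] at hn hn' hi hi'
      simp only [Lobe.word, List.cons_append, List.cons.injEq, Prod.mk.injEq, true_and] at h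
      obtain ⟨rfl, h⟩ := h
      have key : ∀ b : Branches ι ℝ, i ∉ b.labels → ∀ p ∈ b.word g, p.1 ≠ g i := by
        intro b hi p hp h
        obtain ⟨j, hj, hj'⟩ := Branches.label_of_mem_word g b p hp
        exact hi (hg (h.symm.trans hj') ▸ hj)
      obtain ⟨y, l, e⟩ := rest.word_eq_cons g (g i)
      obtain ⟨y', l', e'⟩ := rest'.word_eq_cons g (g i)
      have h' := h
      rw [e, e', List.append_assoc, List.append_assoc, List.cons_append, List.cons_append] at h'
      obtain ⟨h1, h2⟩ := eq_of_append_cons_eq (key b hi.1) (key b' hi'.1) h'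
      rw [← List.cons_append, ← List.cons_append, ← e, ← e'] at h2
      simp only [Lobe.perim, add_right_inj] at hp
      obtain ⟨rfl, h3⟩ := Lobe.eq_of_word_append_eq hg i rest rest' hv.2.2.2 hv'.2.2.2 hp
        hn.2.1 hn'.2.1 hi.2 hi'.2 _ _ h2
      exact ⟨by rw [Branches.eq_of_word_eq hg b b' hv.2.2.1 hv'.2.2.1 hn.1 hn'.1 h1], h3⟩

end

end Parse

section Cactus

variable {n : ℕ}

theorem IsCactus.good {t : Branches (Fin n) ℝ} (h : IsCactus t) : t.Good :=
  ⟨h.whiteLeaves, h.pos, h.unitLobes⟩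

theorem IsCactus.nodup {t : Branches (Fin n) ℝ} (h : IsCactus t) : t.labels.Nodup :=
  List.nodup_iff_count_le_one.2 fun i => (h.count_labels i).le

theorem IsCactus.reducedWord {κ : Type} {t : Branches (Fin n) ℝ} (h : IsCactus t)
    {g : Fin n → κ} (hg : g.Injective) : ReducedWord (t.word g) :=
  ⟨Branches.word_pos g t h.pos, Branches.isChain_word hg t h.nodup h.whiteLeaves⟩

/-- A cactus is determined by the invariants of its word. -/
theorem IsCactus.ext {κ : Type} [DecidableEq κ] {t t' : Branches (Fin n) ℝ} (h : IsCactus t)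
    (h' : IsCactus t') {g : Fin n → Option κ} (hg : g.Injective) {r : κ → ℝ} (hr : ∀ i, 0 < r i)
    (hmu : mu r (t.word g) 0 = mu r (t'.word g) 0)
    (hphi : ∀ i u, phi i (t.word g) u = phi i (t'.word g) u) : t = t' :=
  Branches.eq_of_word_eq hg t t' h.good h'.good h.nodup h'.nodup
    (ReducedWord.ext hr (h.reducedWord hg) (h'.reducedWord hg) hmu hphi)

theorem IsCactus.collapse_eq {t : Branches (Fin n) ℝ} (h : IsCactus t) : t.collapse = t := by
  have h0 : ∀ t : Branches (Fin n) ℝ, t.AllEdges (0 < ·) → t.AllEdges (0 ≤ ·) := by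
    intro t
    refine Branches.rec (motive_1 := fun b => b.AllEdges (0 < ·) → b.AllEdges (0 ≤ ·))
      (motive_2 := fun v => v.AllEdges (0 < ·) → v.AllEdges (0 ≤ ·)) id ?_ ?_ ?_ t
    · exact fun i v rest h1 h2 h => ⟨h1 h.1, h2 h.2⟩
    · exact fun x (h : 0 < x) => le_of_lt h
    · exact fun x b rest h1 h2 h => ⟨le_of_lt h.1, h1 h.2.1, h2 h.2.2⟩
  obtain ⟨hg, -, hc⟩ := Branches.collapse_spec t h.whiteLeaves (h0 t h.pos) h.unitLobes
  refine Branches.eq_of_word_eq (g := id) Function.injective_id _ _ hg h.good ?_ h.nodup ?_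
  · exact List.nodup_iff_count_le_one.2 fun i => by rw [hc, h.count_labels]
  · rw [Branches.word_collapse, dropZeros_eq_self _ (Branches.word_pos _ _ h.pos)]

end Cactus

/-! ### Contracting the last lobe -/

section Forget

variable {n : ℕ}

theorem Lobe.sameBase_addFirst {ι κ : Type} [DecidableEq κ] (g : ι → Option κ) (k : Option κ)
    {x : ℝ} (hx : 0 < x) (v : Lobe ι ℝ) (hv : v.Good) :
    SameBase ((v.addFirst x).word g k) ((k, x) :: v.word g k) := by
  cases v with
  | close y => exact sameBase_merge hx.le (((Lobe.good_close _).1 hv)).le k []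
  | arc y b rest => exact sameBase_merge hx.le (((Lobe.good_arc _ _ _).1 hv).1).le k _

theorem Lobe.sameBase_branches {ι κ : Type} [DecidableEq κ] (g : ι → Option κ) (v : Lobe ι ℝ) :
    SameBase (v.branches.word g) (v.word g none) := by
  induction v using Lobe.rec (motive_1 := fun _ => True) with
  | nil => trivial
  | cons => trivial
  | close x => exact ((SameBase.refl []).cons_none x).symm
  | arc x b rest _ ih =>
    rw [Lobe.branches, Branches.word_append, Lobe.word]
    exact (((SameBase.refl _).append ih.symm).cons_none x).symm

theorem Branches.word_of_isNil {ι κ : Type} (g : ι → κ) (b : Branches ι ℝ) (h : b.IsNil) :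
    b.word g = [] := by
  cases b
  exacts [rfl, h.elim]

mutual

theorem Branches.sameBase_forget : ∀ b : Branches (Fin (n + 1)) ℝ, b.Good →
    SameBase (b.forget.word some) (b.word finSuccEquivLast)
  | .nil, _ => SameBase.refl _
  | .cons i v rest, h => by
      rw [Branches.good_cons] at h
      have hr := Branches.sameBase_forget rest h.2.2
      have hv := fun k => Lobe.sameBase_forget k v h.1
      by_cases hi : i = Fin.last n
      · subst hi
        simp only [Branches.forget, dif_pos, Branches.word_append, Branches.word,
          finSuccEquivLast_last]
        exact ((Lobe.sameBase_branches some _).trans (hv none)).append hr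
      · simp only [Branches.forget, hi, dif_neg, not_false_eq_true, Branches.word]
        have : finSuccEquivLast i = some (i.castPred hi) :=
          (Equiv.eq_symm_apply _).1 (by simp)
        rw [this]
        exact (hv _).append hr

theorem Lobe.sameBase_forget (k : Option (Fin n)) : ∀ v : Lobe (Fin (n + 1)) ℝ, v.Good →
    SameBase (v.forget.word some k) (v.word finSuccEquivLast k)
  | .close x, _ => by simp only [Lobe.forget, Lobe.word]; exact SameBase.refl _
  | .arc x b rest, h => by
      rw [Lobe.good_arc] at h
      have hb := Branches.sameBase_forget b h.2.2.1
      have hr := Lobe.sameBase_forget k rest h.2.2.2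
      by_cases hn : b.forget.IsNil
      · rw [Branches.word_of_isNil _ _ hn] at hb
        simp only [Lobe.forget, hn, if_true, Lobe.word]
        exact (Lobe.sameBase_addFirst _ _ h.1 _ (Lobe.forget_spec _ h.2.2.2).1).trans
          ((hb.append hr).cons _)
      · simp only [Lobe.forget, hn, if_false, Lobe.word]
        exact (hb.append hr).cons _

end

theorem forgetLobe'_eq_iff (c' : NCact (n + 1)) (c : NCact n) : forgetLobe' c' = c ↔
    ∀ i u, phi i (c'.1.word finSuccEquivLast) u = phi i (c.1.word some) u := by
  have h := Branches.sameBase_forget c'.1 c'.2.good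
  constructor
  · rintro rfl i u
    exact (h.2 i u).symm
  · intro h'
    refine Subtype.ext (IsCactus.ext (forgetLobe' c').2 c.2 (g := some) (Option.some_injective _)
      (r := fun _ => 1) (fun _ => one_pos) ?_ fun i u => (h.2 i u).trans (h' i u))
    have : ∀ t : Branches (Fin n) ℝ, mu (fun _ => 1) (t.word some) 0 = 0 := fun t =>
      mu_eq_zero _ _ (fun p hp => by
        obtain ⟨j, -, hj⟩ := Branches.label_of_mem_word _ _ p hp
        simp [hj]) _
    rw [this, this]

end Forget

end Cacti

namespace Cacti

/-! ### Finitely supported measures on the line -/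

section Measures

/-- Integration of the function `h`. -/
noncomputable def pairing (h : ℝ → ℝ) : (ℝ →₀ ℝ) →ₗ[ℝ] ℝ := Finsupp.linearCombination ℝ h

@[simp] theorem pairing_single (h : ℝ → ℝ) (y a : ℝ) :
    pairing h (Finsupp.single y a) = a * h y := by simp [pairing]

theorem pairing_apply (h : ℝ → ℝ) (μ : ℝ →₀ ℝ) :
    pairing h μ = ∑ y ∈ μ.support, μ y * h y := by
  simp [pairing, Finsupp.linearCombination_apply, Finsupp.sum]

/-- The weak topology. -/
noncomputable instance measureTopology : TopologicalSpace (ℝ →₀ ℝ) :=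
  TopologicalSpace.induced (fun μ (h : C(ℝ, ℝ)) => pairing h μ) inferInstance

theorem continuous_measure_iff {X : Type*} [TopologicalSpace X] {f : X → (ℝ →₀ ℝ)} :
    Continuous f ↔ ∀ h : C(ℝ, ℝ), Continuous fun x => pairing h (f x) := by
  rw [continuous_induced_rng, continuous_pi_iff]
  rfl

theorem continuous_pairing (h : C(ℝ, ℝ)) : Continuous (pairing h : (ℝ →₀ ℝ) → ℝ) :=
  continuous_measure_iff.1 continuous_id h

theorem pairing_injective :
    Function.Injective fun (μ : ℝ →₀ ℝ) (h : C(ℝ, ℝ)) => pairing h μ := by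
  intro μ ν hμν
  by_contra hne
  obtain ⟨y₀, hy₀⟩ : ∃ y, (μ - ν) y ≠ 0 := by
    by_contra! h
    exact hne (sub_eq_zero.1 (Finsupp.ext h))
  let F := (μ - ν).support.erase y₀
  let h : C(ℝ, ℝ) := ⟨fun y => ∏ m ∈ F, (y - m), by fun_prop⟩
  have h1 : pairing h (μ - ν) = 0 := by
    rw [map_sub, sub_eq_zero]
    exact congrFun hμν h
  rw [pairing_apply, Finset.sum_eq_single_of_mem y₀ (Finsupp.mem_support_iff.2 hy₀)] at h1
  · refine mul_ne_zero hy₀ (Finset.prod_ne_zero_iff.2 fun m hm => ?_) h1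
    exact sub_ne_zero.2 (Finset.ne_of_mem_erase hm).symm
  · intro m hm hne
    exact mul_eq_zero_of_right _ (Finset.prod_eq_zero (Finset.mem_erase.2 ⟨hne, hm⟩) (sub_self m))

instance : T2Space (ℝ →₀ ℝ) :=
  T2Space.of_injective_continuous pairing_injective continuous_induced_dom

theorem continuous_single : Continuous fun y : ℝ => (Finsupp.single y 1 : ℝ →₀ ℝ) := by
  refine continuous_measure_iff.2 fun h => ?_
  simp only [pairing_single, one_mul]
  exact h.continuous

end Measures

/-! ### Continuity of the invariants -/

section Continuity

variable {ι κ A : Type}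

mutual

theorem Branches.exists_word_decorate (g : ι → κ) : ∀ τ : Branches ι A,
    ∃ L : List (κ × τ.Edge), ∀ x, (τ.decorate x).word g = L.map fun p => (p.1, x p.2)
  | .nil => ⟨[], fun _ => rfl⟩
  | .cons i v rest => by
      obtain ⟨L, hL⟩ := Lobe.exists_word_decorate g (g i) v
      obtain ⟨M, hM⟩ := Branches.exists_word_decorate g rest
      have key : ∀ x : v.Edge ⊕ rest.Edge → ℝ,
          (L.map fun p : κ × v.Edge => (p.1, x (Sum.inl p.2))) ++
            (M.map fun p : κ × rest.Edge => (p.1, x (Sum.inr p.2))) =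
          (L.map (fun p : κ × v.Edge => (p.1, Sum.inl p.2)) ++
            M.map (fun p : κ × rest.Edge => (p.1, Sum.inr p.2))).map
            fun p : κ × (v.Edge ⊕ rest.Edge) => (p.1, x p.2) :=
        fun x => by simp [Function.comp_def]
      refine ⟨L.map (fun p => (p.1, Sum.inl p.2)) ++ M.map (fun p => (p.1, Sum.inr p.2)),
        fun x => ?_⟩
      rw [Branches.decorate, Branches.word, hL, hM]
      exact key x

theorem Lobe.exists_word_decorate (g : ι → κ) (k : κ) : ∀ v : Lobe ι A,
    ∃ L : List (κ × v.Edge), ∀ x, (v.decorate x).word g k = L.map fun p => (p.1, x p.2)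
  | .close _ => ⟨[(k, ())], fun _ => rfl⟩
  | .arc _ b rest => by
      obtain ⟨L, hL⟩ := Branches.exists_word_decorate g b
      obtain ⟨M, hM⟩ := Lobe.exists_word_decorate g k rest
      have key : ∀ x : Unit ⊕ (b.Edge ⊕ rest.Edge) → ℝ,
          (k, x (Sum.inl ())) :: ((L.map fun p => (p.1, x (Sum.inr (Sum.inl p.2)))) ++
            (M.map fun p => (p.1, x (Sum.inr (Sum.inr p.2))))) =
            ((k, Sum.inl ()) :: (L.map (fun p => (p.1, Sum.inr (Sum.inl p.2))) ++
              M.map (fun p => (p.1, Sum.inr (Sum.inr p.2))))).map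
              fun p => (p.1, x p.2) := fun x => by simp [Function.comp_def]
      refine ⟨(k, Sum.inl ()) :: (L.map (fun p => (p.1, Sum.inr (Sum.inl p.2))) ++
        M.map (fun p => (p.1, Sum.inr (Sum.inr p.2)))), fun x => ?_⟩
      rw [Lobe.decorate, Lobe.word, hL, hM]
      exact key x

end

theorem continuous_phi [DecidableEq κ] {E : Type} (i : κ) (L : List (Option κ × E))
    {u : (E → ℝ) → ℝ} (hu : Continuous u) :
    Continuous fun x : E → ℝ => phi i (L.map fun p => (p.1, x p.2)) (u x) := by
  induction L generalizing u with
  | nil => exact continuous_const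
  | cons p L ih =>
    rcases p with ⟨_ | j, e⟩
    · exact ih hu
    · refine Continuous.add ?_ (ih (by fun_prop))
      split_ifs
      · unfold clip; fun_prop
      · exact continuous_const

theorem continuous_pairing_mu {E : Type} (r : κ → ℝ) (h : C(ℝ, ℝ)) (L : List (Option κ × E))
    {s : (E → ℝ) → ℝ} (hs : Continuous s) :
    Continuous fun x : E → ℝ => pairing h (mu r (L.map fun p => (p.1, x p.2)) (s x)) := by
  induction L generalizing s with
  | nil =>
    simp only [List.map_nil, mu, map_zero]
    exact continuous_const
  | cons p L ih =>
    rcases p with ⟨_ | j, e⟩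
    · simp only [List.map_cons, mu, map_add, pairing_single]
      exact Continuous.add (by fun_prop) (ih hs)
    · simp only [List.map_cons, mu]
      exact ih (by fun_prop)

variable {m : ℕ}

theorem NCact.continuous_iff {Y : Type*} [TopologicalSpace Y] {f : NCact m → Y} :
    Continuous f ↔ ∀ τ : BWTree m, Continuous fun x : Cell τ => f (charMap τ x) := by
  rw [continuous_coinduced_dom, continuous_sigma_iff]
  rfl

theorem NCact.continuous_phi_word [DecidableEq κ] (g : Fin m → Option κ) (i : κ) (u : ℝ) :
    Continuous fun c : NCact m => phi i (c.1.word g) u := by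
  refine NCact.continuous_iff.2 fun τ => ?_
  obtain ⟨L, hL⟩ := Branches.exists_word_decorate g τ.1
  have : ∀ x : Cell τ, phi i ((charMap τ x).1.word g) u =
      phi i (L.map fun p => (p.1, x.1 p.2)) u := fun x => by
    rw [charMap, Branches.word_collapse, (sameBase_dropZeros _).2, hL]
  simp only [this]
  exact (continuous_phi i L continuous_const).comp continuous_subtype_val

theorem NCact.continuous_mu_word (r : κ → ℝ) (g : Fin m → Option κ) :
    Continuous fun c : NCact m => mu r (c.1.word g) 0 := by
  refine continuous_measure_iff.2 fun h => NCact.continuous_iff.2 fun τ => ?_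
  obtain ⟨L, hL⟩ := Branches.exists_word_decorate g τ.1
  have : ∀ x : Cell τ, pairing h (mu r ((charMap τ x).1.word g) 0) =
      pairing h (mu r (L.map fun p => (p.1, x.1 p.2)) 0) := fun x => by
    rw [charMap, Branches.word_collapse, mu_dropZeros, hL]
  simp only [this]
  exact (continuous_pairing_mu r h L continuous_const).comp continuous_subtype_val

end Continuity

/-! ### Compactness -/

section Compactness

variable {ι : Type}

mutual

/-- A measure for the size of a tree. -/
def Branches.size {A : Type} : Branches ι A → ℕ
  | .nil => 0
  | .cons _ v rest => 1 + (v.size + rest.size)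

/-- See `Branches.size`. -/
def Lobe.size {A : Type} : Lobe ι A → ℕ
  | .close _ => 0
  | .arc _ b rest => 1 + (b.size + rest.size)

end

theorem finite_size_le [Finite ι] (N : ℕ) : {b : Branches ι Unit | b.size ≤ N}.Finite ∧
    {v : Lobe ι Unit | v.size ≤ N}.Finite := by
  induction N with
  | zero =>
    refine ⟨(Set.finite_singleton .nil).subset ?_, (Set.finite_singleton (.close ())).subset ?_⟩
    · rintro (_ | _) h
      · rfl
      · simp [Branches.size] at h
    · rintro (_ | _) h
      · rfl
      · simp [Lobe.size] at h
  | succ N ih =>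
    refine ⟨((Set.finite_singleton .nil).union (Set.finite_univ.image2
      (fun (i : ι) (p : Lobe ι Unit × Branches ι Unit) => .cons i p.1 p.2)
      (ih.2.prod ih.1))).subset ?_, ((Set.finite_singleton (.close ())).union
      ((ih.1.prod ih.2).image (fun p : Branches ι Unit × Lobe ι Unit =>
        .arc () p.1 p.2))).subset ?_⟩
    · rintro (_ | ⟨i, v, rest⟩) h
      · exact Or.inl rfl
      · simp only [Branches.size, Set.mem_ofPred_eq] at h
        exact Or.inr ⟨i, Set.mem_univ _, (v, rest),
          ⟨show v.size ≤ N by omega, show rest.size ≤ N by omega⟩, rfl⟩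
    · rintro (_ | ⟨_, b, rest⟩) h
      · exact Or.inl rfl
      · simp only [Lobe.size, Set.mem_ofPred_eq] at h
        exact Or.inr ⟨(b, rest), ⟨show b.size ≤ N by omega, show rest.size ≤ N by omega⟩, rfl⟩

mutual

theorem Branches.size_le {A : Type} : ∀ b : Branches ι A, b.WhiteLeaves →
    b.size ≤ 2 * b.labels.length ∧ (¬ b.IsNil → b.size + 1 ≤ 2 * b.labels.length)
  | .nil, _ => by simp [Branches.size, Branches.IsNil]
  | .cons i v rest, h => by
      have h1 := Lobe.size_le v h.1
      have h2 := (Branches.size_le rest h.2).1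
      simp only [Branches.size, Branches.labels, List.length_cons, List.length_append]
      omega

theorem Lobe.size_le {A : Type} : ∀ v : Lobe ι A, v.WhiteLeaves →
    v.size ≤ 2 * v.labels.length
  | .close _, _ => by simp [Lobe.size]
  | .arc _ b rest, h => by
      have h1 := (Branches.size_le b h.2.1).2 h.1
      have h2 := Lobe.size_le rest h.2.2
      simp only [Lobe.size, Lobe.labels, List.length_append]
      omega

end

theorem length_eq_of_count_eq_one {n : ℕ} {l : List (Fin n)} (h : ∀ i, l.count i = 1) :
    l.length = n := by
  have hn : l.Nodup := List.nodup_iff_count_le_one.2 fun i => (h i).le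
  rw [← List.toFinset_card_of_nodup hn]
  have : l.toFinset = Finset.univ := Finset.eq_univ_iff_forall.2 fun i =>
    List.mem_toFinset.2 (List.count_pos_iff.1 (by simp [h i]))
  simp [this]

instance (n : ℕ) : Finite (BWTree n) := by
  refine Set.Finite.to_subtype (Set.Finite.subset (finite_size_le (2 * n)).1 ?_)
  rintro τ ⟨h1, h2⟩
  have := (Branches.size_le τ h2).1
  rwa [length_eq_of_count_eq_one h1] at this

theorem Lobe.continuous_perim_decorate {A Z : Type} [TopologicalSpace Z] (v : Lobe ι A)
    {x : Z → v.Edge → ℝ} (hx : Continuous x) : Continuous fun z => (v.decorate (x z)).perim := by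
  induction v using Lobe.rec (motive_1 := fun _ => True) with
  | nil => trivial
  | cons => trivial
  | close _ => exact (continuous_apply ()).comp hx
  | arc _ b rest _ ih =>
    exact ((continuous_apply (A := fun _ => ℝ) (Sum.inl ())).comp hx).add
      (ih (x := fun z e => x z (Sum.inr (Sum.inr e))) (continuous_pi fun e =>
        (continuous_apply (A := fun _ => ℝ) (Sum.inr (Sum.inr e))).comp hx))

mutual

theorem Branches.isClosed_unitLobes {A Z : Type} [TopologicalSpace Z] : ∀ (τ : Branches ι A)
    (x : Z → τ.Edge → ℝ), Continuous x → IsClosed {z | (τ.decorate (x z)).UnitLobes}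
  | .nil, _, _ => by simp [Branches.decorate, Branches.UnitLobes]
  | .cons i v rest, x, hx => by
      have hl : Continuous fun z e => x z (Sum.inl e) := continuous_pi fun e =>
        (continuous_apply (A := fun _ => ℝ) (Sum.inl e)).comp hx
      have hr : Continuous fun z e => x z (Sum.inr e) := continuous_pi fun e =>
        (continuous_apply (A := fun _ => ℝ) (Sum.inr e)).comp hx
      exact (isClosed_eq (Lobe.continuous_perim_decorate v hl) continuous_const).inter
        ((Lobe.isClosed_unitLobesAbove v _ hl).inter (Branches.isClosed_unitLobes rest _ hr))

theorem Lobe.isClosed_unitLobesAbove {A Z : Type} [TopologicalSpace Z] : ∀ (v : Lobe ι A)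
    (x : Z → v.Edge → ℝ), Continuous x → IsClosed {z | (v.decorate (x z)).UnitLobesAbove}
  | .close _, _, _ => by simp [Lobe.decorate, Lobe.UnitLobesAbove]
  | .arc _ b rest, x, hx => by
      have hl : Continuous fun z e => x z (Sum.inr (Sum.inl e)) := continuous_pi fun e =>
        (continuous_apply (A := fun _ => ℝ) (Sum.inr (Sum.inl e))).comp hx
      have hr : Continuous fun z e => x z (Sum.inr (Sum.inr e)) := continuous_pi fun e =>
        (continuous_apply (A := fun _ => ℝ) (Sum.inr (Sum.inr e))).comp hx
      exact (Branches.isClosed_unitLobes b _ hl).inter (Lobe.isClosed_unitLobesAbove rest _ hr)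

end

mutual

theorem Branches.le_one_of_unitLobes {A : Type} : ∀ (τ : Branches ι A) (x : τ.Edge → ℝ),
    (∀ e, 0 ≤ x e) → (τ.decorate x).UnitLobes → ∀ e, x e ≤ 1
  | .nil, _, _, _, e => e.elim
  | .cons i v rest, x, hx, h, e => by
      rcases e with e | e
      · exact Lobe.le_one_of_unitLobes v (fun e => x (Sum.inl e)) (fun _ => hx _) h.1.le h.2.1 e
      · exact Branches.le_one_of_unitLobes rest (fun e => x (Sum.inr e)) (fun _ => hx _) h.2.2 e

theorem Lobe.le_one_of_unitLobes {A : Type} : ∀ (v : Lobe ι A) (x : v.Edge → ℝ),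
    (∀ e, 0 ≤ x e) → (v.decorate x).perim ≤ 1 → (v.decorate x).UnitLobesAbove → ∀ e, x e ≤ 1
  | .close _, x, _, h, _, () => h
  | .arc _ b rest, x, hx, h, h', e => by
      have h1 : 0 ≤ (rest.decorate fun e => x (Sum.inr (Sum.inr e))).perim :=
        Lobe.perim_nonneg _ (Lobe.allEdges_decorate _ _ _ fun _ => hx _)
      have h2 : x (Sum.inl ()) + (rest.decorate fun e => x (Sum.inr (Sum.inr e))).perim ≤ 1 := h
      rcases e with ⟨⟩ | e | e
      · change x (Sum.inl ()) ≤ 1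
        linarith
      · exact Branches.le_one_of_unitLobes b (fun e => x (Sum.inr (Sum.inl e))) (fun _ => hx _)
          h'.1 e
      · exact Lobe.le_one_of_unitLobes rest (fun e => x (Sum.inr (Sum.inr e))) (fun _ => hx _)
          (by linarith [hx (Sum.inl ())]) h'.2 e

end

instance {n : ℕ} (τ : BWTree n) : CompactSpace (Cell τ) := by
  have hc : IsClosed {x : τ.1.Edge → ℝ | (∀ e, 0 ≤ x e) ∧ (τ.1.decorate x).UnitLobes} := by
    refine IsClosed.inter ?_ (Branches.isClosed_unitLobes τ.1 _ continuous_id)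
    exact (isClosed_Ici : IsClosed (Set.Ici (0 : τ.1.Edge → ℝ)))
  refine isCompact_iff_compactSpace.1 ((isCompact_univ_pi fun _ : τ.1.Edge =>
    isCompact_Icc (a := (0 : ℝ)) (b := 1)).of_isClosed_subset hc ?_)
  exact fun x hx e _ => ⟨hx.1 e, Branches.le_one_of_unitLobes _ x hx.1 hx.2 e⟩

mutual

theorem Branches.exists_decorate_eq {A : Type} : ∀ t : Branches ι A,
    ∃ (τ : Branches ι Unit) (x : τ.Edge → A), τ.decorate x = t
  | .nil => ⟨.nil, Empty.elim, rfl⟩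
  | .cons i v rest => by
      obtain ⟨τ, x, h⟩ := Lobe.exists_decorate_eq v
      obtain ⟨σ, y, h'⟩ := Branches.exists_decorate_eq rest
      exact ⟨.cons i τ σ, Sum.elim x y, by simp [Branches.decorate, h, h']⟩

theorem Lobe.exists_decorate_eq {A : Type} : ∀ v : Lobe ι A,
    ∃ (τ : Lobe ι Unit) (x : τ.Edge → A), τ.decorate x = v
  | .close a => ⟨.close (), fun _ => a, rfl⟩
  | .arc a b rest => by
      obtain ⟨τ, x, h⟩ := Branches.exists_decorate_eq b
      obtain ⟨σ, y, h'⟩ := Lobe.exists_decorate_eq rest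
      exact ⟨.arc () τ σ, Sum.elim (fun _ => a) (Sum.elim x y), by simp [Lobe.decorate, h, h']⟩

end

mutual

theorem Branches.allEdges_decorate_iff (P : ℝ → Prop) {A : Type} : ∀ (τ : Branches ι A)
    (x : τ.Edge → ℝ), (τ.decorate x).AllEdges P → ∀ e, P (x e)
  | .nil, _, _, e => e.elim
  | .cons _ v rest, x, h, e => by
      rcases e with e | e
      · exact Lobe.allEdges_decorate_iff P v _ h.1 e
      · exact Branches.allEdges_decorate_iff P rest _ h.2 e

theorem Lobe.allEdges_decorate_iff (P : ℝ → Prop) {A : Type} : ∀ (v : Lobe ι A)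
    (x : v.Edge → ℝ), (v.decorate x).AllEdges P → ∀ e, P (x e)
  | .close _, _, h, () => h
  | .arc _ b rest, x, h, e => by
      rcases e with ⟨⟩ | e | e
      · exact h.1
      · exact Branches.allEdges_decorate_iff P b _ h.2.1 e
      · exact Lobe.allEdges_decorate_iff P rest _ h.2.2 e

end

theorem exists_charMap_eq {n : ℕ} (c : NCact n) : ∃ (τ : BWTree n) (x : Cell τ),
    charMap τ x = c := by
  obtain ⟨c, hc⟩ := c
  obtain ⟨τ, x, rfl⟩ := c.exists_decorate_eq
  exact ⟨⟨τ, fun i => by rw [← hc.count_labels i, Branches.labels_decorate],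
      (Branches.whiteLeaves_decorate _ _).1 hc.whiteLeaves⟩,
    ⟨x, fun e => (Branches.allEdges_decorate_iff _ _ _ hc.pos e).le, hc.unitLobes⟩,
    Subtype.ext hc.collapse_eq⟩

instance (n : ℕ) : CompactSpace (NCact n) := by
  have h : Function.Surjective fun y : Σ τ : BWTree n, Cell τ => charMap y.1 y.2 := fun c => by
    obtain ⟨τ, x, h⟩ := exists_charMap_eq c
    exact ⟨⟨τ, x⟩, h⟩
  exact h.compactSpace continuous_coinduced_rng

end Compactness

end Cacti

namespace Cacti

/-! ### The classes of marked points -/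

section Corners

variable {ι : Type}

/-- The parameters at which the outside circle, which starts at `s`, visits the black vertex. -/
def Branches.corners (s : ℝ) : Branches ι ℝ → List ℝ
  | .nil => [s]
  | .cons _ v rest => s :: rest.corners (s + v.total)

mutual

/-- For each black vertex other than the root, the parameters at which the outside circle, which
starts at `s`, visits it. -/
def Branches.nodeCorners (s : ℝ) : Branches ι ℝ → List (List ℝ)
  | .nil => []
  | .cons _ v rest => v.nodeCorners s ++ rest.nodeCorners (s + v.total)

/-- See `Branches.nodeCorners`. -/
def Lobe.nodeCorners (s : ℝ) : Lobe ι ℝ → List (List ℝ)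
  | .close _ => []
  | .arc x b rest =>
      b.corners (s + x) :: (b.nodeCorners (s + x) ++ rest.nodeCorners (s + x + b.total))

end

/-- White leaves and positive arcs. -/
def Branches.Positive (b : Branches ι ℝ) : Prop := b.WhiteLeaves ∧ b.AllEdges (0 < ·)

/-- White leaves and positive arcs. -/
def Lobe.Positive (v : Lobe ι ℝ) : Prop := v.WhiteLeaves ∧ v.AllEdges (0 < ·)

theorem Branches.positive_cons (i : ι) (v : Lobe ι ℝ) (rest : Branches ι ℝ) :
    (Branches.cons i v rest).Positive ↔ v.Positive ∧ rest.Positive := by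
  simp only [Branches.Positive, Lobe.Positive, Branches.WhiteLeaves, Branches.AllEdges]
  tauto

theorem Lobe.positive_arc (x : ℝ) (b : Branches ι ℝ) (rest : Lobe ι ℝ) :
    (Lobe.arc x b rest).Positive ↔ 0 < x ∧ ¬ b.IsNil ∧ b.Positive ∧ rest.Positive := by
  simp only [Branches.Positive, Lobe.Positive, Lobe.WhiteLeaves, Lobe.AllEdges]
  tauto

theorem Lobe.positive_close (x : ℝ) : (Lobe.close x : Lobe ι ℝ).Positive ↔ 0 < x := by
  simp [Lobe.Positive, Lobe.WhiteLeaves, Lobe.AllEdges]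

mutual

theorem Branches.total_nonneg : ∀ b : Branches ι ℝ, b.Positive → 0 ≤ b.total
  | .nil, _ => le_rfl
  | .cons i v rest, h => by
      rw [Branches.positive_cons] at h
      exact add_nonneg (Lobe.total_pos v h.1).le (Branches.total_nonneg rest h.2)

theorem Lobe.total_pos : ∀ v : Lobe ι ℝ, v.Positive → 0 < v.total
  | .close x, h => (Lobe.positive_close x).1 h
  | .arc x b rest, h => by
      rw [Lobe.positive_arc] at h
      exact add_pos_of_pos_of_nonneg h.1
        (add_nonneg (Branches.total_nonneg b h.2.2.1) (Lobe.total_pos rest h.2.2.2).le)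

end

theorem Branches.start_mem_corners (b : Branches ι ℝ) (s : ℝ) : s ∈ b.corners s := by
  cases b <;> simp [Branches.corners]

theorem Branches.end_mem_corners (b : Branches ι ℝ) (s : ℝ) : s + b.total ∈ b.corners s := by
  induction b using Branches.rec (motive_2 := fun _ => True) generalizing s with
  | nil => simp [Branches.corners, Branches.total]
  | cons i v rest _ ih =>
    simpa [Branches.corners, Branches.total, add_assoc] using Or.inr (ih (s + v.total))
  | close => trivial
  | arc => trivial

theorem Branches.corners_mem_Icc (b : Branches ι ℝ) (hb : b.Positive) (s : ℝ) :
    ∀ c ∈ b.corners s, c ∈ Set.Icc s (s + b.total) := by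
  induction b using Branches.rec (motive_2 := fun _ => True) generalizing s with
  | nil => simp [Branches.corners, Branches.total]
  | cons i v rest _ ih =>
    rw [Branches.positive_cons] at hb
    have h1 := Lobe.total_pos v hb.1
    have h2 := Branches.total_nonneg rest hb.2
    intro c hc
    simp only [Branches.corners, List.mem_cons] at hc
    simp only [Branches.total, Set.mem_Icc]
    rcases hc with rfl | hc
    · constructor <;> linarith
    · have := ih hb.2 _ c hc
      constructor <;> linarith [this.1, this.2]
  | close => trivial
  | arc => trivial

mutual

theorem Branches.nodeCorners_mem_Ioo : ∀ (b : Branches ι ℝ) (s : ℝ), b.Positive →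
    ∀ C ∈ b.nodeCorners s, ∀ c ∈ C, c ∈ Set.Ioo s (s + b.total) ∧ c ∉ b.corners s
  | .nil, s, _, C, hC, c, hc => by simp [Branches.nodeCorners] at hC
  | .cons i v rest, s, h, C, hC, c, hc => by
      rw [Branches.positive_cons] at h
      have h1 := Lobe.total_pos v h.1
      have h2 := Branches.total_nonneg rest h.2
      rw [Branches.nodeCorners, List.mem_append] at hC
      simp only [Branches.total, Branches.corners, List.mem_cons, not_or]
      rcases hC with hC | hC
      · have := Lobe.nodeCorners_mem_Ioo v s h.1 C hC c hc
        exact ⟨⟨this.1, by linarith [this.2]⟩, this.1.ne', fun h' => by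
          linarith [(rest.corners_mem_Icc h.2 _ c h').1, this.2]⟩
      · have := Branches.nodeCorners_mem_Ioo rest _ h.2 C hC c hc
        exact ⟨⟨by linarith [this.1.1], by linarith [this.1.2]⟩,
          fun h' => by linarith [this.1.1], this.2⟩

theorem Lobe.nodeCorners_mem_Ioo : ∀ (v : Lobe ι ℝ) (s : ℝ), v.Positive →
    ∀ C ∈ v.nodeCorners s, ∀ c ∈ C, c ∈ Set.Ioo s (s + v.total)
  | .close x, s, _, C, hC, c, hc => by simp [Lobe.nodeCorners] at hC
  | .arc x b rest, s, h, C, hC, c, hc => by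
      rw [Lobe.positive_arc] at h
      have h1 := Branches.total_nonneg b h.2.2.1
      have h2 := Lobe.total_pos rest h.2.2.2
      rw [Lobe.nodeCorners, List.mem_cons, List.mem_append] at hC
      simp only [Lobe.total, Set.mem_Ioo]
      rcases hC with rfl | hC | hC
      · have := b.corners_mem_Icc h.2.2.1 _ c hc
        constructor <;> linarith [this.1, this.2, h.1]
      · have := (Branches.nodeCorners_mem_Ioo b _ h.2.2.1 C hC c hc).1
        constructor <;> linarith [this.1, this.2, h.1]
      · have := Lobe.nodeCorners_mem_Ioo rest _ h.2.2.2 C hC c hc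
        constructor <;> linarith [this.1, this.2, h.1]

end

mutual

theorem Branches.nodeCorners_disjoint : ∀ (b : Branches ι ℝ) (s : ℝ), b.Positive →
    ∀ C ∈ b.nodeCorners s, ∀ C' ∈ b.nodeCorners s, ∀ c ∈ C, c ∈ C' → C = C'
  | .nil, s, _, C, hC, _, _, _, _, _ => by simp [Branches.nodeCorners] at hC
  | .cons i v rest, s, h, C, hC, C', hC', c, hc, hc' => by
      rw [Branches.positive_cons] at h
      have h1 := fun C hC => Lobe.nodeCorners_mem_Ioo v s h.1 C hC c
      have h2 := fun C hC => Branches.nodeCorners_mem_Ioo rest (s + v.total) h.2 C hC c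
      rw [Branches.nodeCorners, List.mem_append] at hC hC'
      rcases hC with hC | hC <;> rcases hC' with hC' | hC'
      · exact Lobe.nodeCorners_disjoint v s h.1 C hC C' hC' c hc hc'
      · linarith [(h1 C hC hc).2, (h2 C' hC' hc').1.1]
      · linarith [(h1 C' hC' hc').2, (h2 C hC hc).1.1]
      · exact Branches.nodeCorners_disjoint rest _ h.2 C hC C' hC' c hc hc'

theorem Lobe.nodeCorners_disjoint : ∀ (v : Lobe ι ℝ) (s : ℝ), v.Positive →
    ∀ C ∈ v.nodeCorners s, ∀ C' ∈ v.nodeCorners s, ∀ c ∈ C, c ∈ C' → C = C'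
  | .close x, s, _, C, hC, _, _, _, _, _ => by simp [Lobe.nodeCorners] at hC
  | .arc x b rest, s, h, C, hC, C', hC', c, hc, hc' => by
      rw [Lobe.positive_arc] at h
      have h0 := b.corners_mem_Icc h.2.2.1 (s + x) c
      have h1 := fun C hC => Branches.nodeCorners_mem_Ioo b (s + x) h.2.2.1 C hC c
      have h2 := fun C hC => Lobe.nodeCorners_mem_Ioo rest (s + x + b.total) h.2.2.2 C hC c
      rw [Lobe.nodeCorners, List.mem_cons, List.mem_append] at hC hC'
      rcases hC with rfl | hC | hC <;> rcases hC' with rfl | hC' | hC'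
      · rfl
      · exact absurd hc (h1 C' hC' hc').2
      · linarith [(h0 hc).2, (h2 C' hC' hc').1]
      · exact absurd hc' (h1 C hC hc).2
      · exact Branches.nodeCorners_disjoint b _ h.2.2.1 C hC C' hC' c hc hc'
      · linarith [(h1 C hC hc).1.2, (h2 C' hC' hc').1]
      · linarith [(h0 hc').2, (h2 C hC hc).1]
      · linarith [(h1 C' hC' hc').1.2, (h2 C hC hc).1]
      · exact Lobe.nodeCorners_disjoint rest _ h.2.2.2 C hC C' hC' c hc hc'

end

mutual

theorem Branches.exists_corners_of_chord : ∀ (b : Branches ι ℝ) (s : ℝ), ∀ p ∈ b.chords s,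
    ∃ C ∈ b.corners s :: b.nodeCorners s, p.1 ∈ C ∧ p.2 ∈ C
  | .nil, s, p, hp => by simp [Branches.chords] at hp
  | .cons i v rest, s, p, hp => by
      simp only [Branches.chords, List.mem_cons, List.mem_append] at hp
      simp only [Branches.corners, Branches.nodeCorners, List.mem_cons, List.mem_append]
      rcases hp with rfl | hp | hp
      · exact ⟨_, Or.inl rfl, by simp, by simp [rest.start_mem_corners]⟩
      · obtain ⟨C, hC, h⟩ := Lobe.exists_corners_of_chord v s p hp
        exact ⟨C, Or.inr (Or.inl hC), h⟩
      · obtain ⟨C, hC, h⟩ := Branches.exists_corners_of_chord rest _ p hp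
        rcases List.mem_cons.1 hC with rfl | hC
        · exact ⟨_, Or.inl rfl, by simp [h.1], by simp [h.2]⟩
        · exact ⟨C, Or.inr (Or.inr hC), h⟩

theorem Lobe.exists_corners_of_chord : ∀ (v : Lobe ι ℝ) (s : ℝ), ∀ p ∈ v.chords s,
    ∃ C ∈ v.nodeCorners s, p.1 ∈ C ∧ p.2 ∈ C
  | .close x, s, p, hp => by simp [Lobe.chords] at hp
  | .arc x b rest, s, p, hp => by
      simp only [Lobe.chords, List.mem_append] at hp
      simp only [Lobe.nodeCorners, List.mem_cons, List.mem_append]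
      rcases hp with hp | hp
      · obtain ⟨C, hC, h⟩ := Branches.exists_corners_of_chord b _ p hp
        rcases List.mem_cons.1 hC with rfl | hC
        · exact ⟨_, Or.inl rfl, h⟩
        · exact ⟨C, Or.inr (Or.inl hC), h⟩
      · obtain ⟨C, hC, h⟩ := Lobe.exists_corners_of_chord rest _ p hp
        exact ⟨C, Or.inr (Or.inr hC), h⟩

end

theorem Branches.corners_linked {R : ℝ → ℝ → Prop} (htr : ∀ a b c, R a b → R b c → R a c)
    (b : Branches ι ℝ) (s : ℝ) (hs : R s s) (h : ∀ p ∈ b.chords s, R p.1 p.2)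
    (hsymm : ∀ a b, R a b → R b a) : ∀ c ∈ b.corners s, R s c := by
  induction b using Branches.rec (motive_2 := fun _ => True) generalizing s with
  | nil => simpa [Branches.corners] using hs
  | cons i v rest _ ih =>
    intro c hc
    simp only [Branches.corners, List.mem_cons] at hc
    simp only [Branches.chords, List.mem_cons, List.mem_append] at h
    have h1 : R s (s + v.total) := h _ (Or.inl rfl)
    rcases hc with rfl | hc
    · exact hs
    · exact htr _ _ _ h1 (ih _ (htr _ _ _ (hsymm _ _ h1) h1)
        (fun p hp => h p (Or.inr (Or.inr hp))) c hc)
  | close => trivial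
  | arc => trivial

theorem Branches.refl_of_not_isNil {R : ℝ → ℝ → Prop} (htr : ∀ a b c, R a b → R b c → R a c)
    (hsymm : ∀ a b, R a b → R b a) (b : Branches ι ℝ) (hb : ¬ b.IsNil) (s : ℝ)
    (h : ∀ p ∈ b.chords s, R p.1 p.2) : R s s := by
  cases b with
  | nil => exact absurd trivial hb
  | cons i v rest =>
    have h1 : R s (s + v.total) := h (s, s + v.total) (by simp [Branches.chords])
    exact htr _ _ _ h1 (hsymm _ _ h1)

mutual

theorem Branches.nodeCorners_linked {R : ℝ → ℝ → Prop} (htr : ∀ a b c, R a b → R b c → R a c)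
    (hsymm : ∀ a b, R a b → R b a) : ∀ (b : Branches ι ℝ) (s : ℝ), b.Positive →
    (∀ p ∈ b.chords s, R p.1 p.2) → ∀ C ∈ b.nodeCorners s, ∀ a ∈ C, ∀ c ∈ C, R a c
  | .nil, s, _, _, C, hC, _, _, _, _ => by simp [Branches.nodeCorners] at hC
  | .cons i v rest, s, hb, h, C, hC, a, ha, c, hc => by
      rw [Branches.positive_cons] at hb
      simp only [Branches.chords, List.mem_cons, List.mem_append] at h
      rw [Branches.nodeCorners, List.mem_append] at hC
      rcases hC with hC | hC
      · exact Lobe.nodeCorners_linked htr hsymm v s hb.1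
          (fun p hp => h p (Or.inr (Or.inl hp))) C hC a ha c hc
      · exact Branches.nodeCorners_linked htr hsymm rest _ hb.2
          (fun p hp => h p (Or.inr (Or.inr hp))) C hC a ha c hc

theorem Lobe.nodeCorners_linked {R : ℝ → ℝ → Prop} (htr : ∀ a b c, R a b → R b c → R a c)
    (hsymm : ∀ a b, R a b → R b a) : ∀ (v : Lobe ι ℝ) (s : ℝ), v.Positive →
    (∀ p ∈ v.chords s, R p.1 p.2) → ∀ C ∈ v.nodeCorners s, ∀ a ∈ C, ∀ c ∈ C, R a c
  | .close x, s, _, _, C, hC, _, _, _, _ => by simp [Lobe.nodeCorners] at hC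
  | .arc x b rest, s, hv, h, C, hC, a, ha, c, hc => by
      rw [Lobe.positive_arc] at hv
      simp only [Lobe.chords, List.mem_append] at h
      rw [Lobe.nodeCorners, List.mem_cons, List.mem_append] at hC
      have hb := fun p hp => h p (Or.inl hp)
      rcases hC with rfl | hC | hC
      · have h0 := b.refl_of_not_isNil htr hsymm hv.2.1 _ hb
        have h1 := b.corners_linked htr _ h0 hb hsymm
        exact htr _ _ _ (hsymm _ _ (h1 a ha)) (h1 c hc)
      · exact Branches.nodeCorners_linked htr hsymm b _ hv.2.2.1 hb C hC a ha c hc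
      · exact Lobe.nodeCorners_linked htr hsymm rest _ hv.2.2.2 (fun p hp => h p (Or.inr hp))
          C hC a ha c hc

end

/-- The lists of parameters at which the outside circle visits the black vertices. -/
def Branches.allCorners (t : Branches ι ℝ) : List (List ℝ) := t.corners 0 :: t.nodeCorners 0

theorem Branches.allCorners_disjoint {t : Branches ι ℝ} (ht : t.Positive) {C C' : List ℝ}
    (hC : C ∈ t.allCorners) (hC' : C' ∈ t.allCorners) {c : ℝ} (hc : c ∈ C) (hc' : c ∈ C') :
    C = C' := by
  rcases List.mem_cons.1 hC with rfl | hC <;> rcases List.mem_cons.1 hC' with rfl | hC'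
  · rfl
  · exact absurd hc (t.nodeCorners_mem_Ioo 0 ht C' hC' c hc').2
  · exact absurd hc' (t.nodeCorners_mem_Ioo 0 ht C hC c hc).2
  · exact t.nodeCorners_disjoint 0 ht C hC C' hC' c hc hc'

theorem Branches.exists_mem_allCorners_of_mem_cutChords {t : Branches ι ℝ} {p : ℝ × ℝ}
    (hp : p ∈ t.cutChords) : ∃ C ∈ t.allCorners, p.1 ∈ C ∧ p.2 ∈ C := by
  rcases List.mem_cons.1 hp with rfl | hp
  · exact ⟨_, List.mem_cons_self, t.start_mem_corners 0, by simpa using t.end_mem_corners 0⟩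
  · exact t.exists_corners_of_chord 0 p hp

theorem Branches.linked_iff {t : Branches ι ℝ} (ht : t.Positive) (a b : t.Marked) :
    Quotient.mk t.markedSetoid a = Quotient.mk t.markedSetoid b ↔
      ∃ C ∈ t.allCorners, a.1 ∈ C ∧ b.1 ∈ C := by
  constructor
  · intro h
    have h' : Relation.EqvGen (fun s s' : t.Marked => (s.1, s'.1) ∈ t.cutChords) a b :=
      Quotient.exact h
    clear h
    induction h' with
    | rel a b h => exact Branches.exists_mem_allCorners_of_mem_cutChords h
    | refl a =>
      obtain ⟨p, hp, h⟩ := a.2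
      obtain ⟨C, hC, h1, h2⟩ := Branches.exists_mem_allCorners_of_mem_cutChords hp
      rcases h with h | h
      · exact ⟨C, hC, h ▸ h1, h ▸ h1⟩
      · exact ⟨C, hC, h ▸ h2, h ▸ h2⟩
    | symm a b _ ih =>
      obtain ⟨C, hC, h1, h2⟩ := ih
      exact ⟨C, hC, h2, h1⟩
    | trans a b c _ _ ih ih' =>
      obtain ⟨C, hC, h1, h2⟩ := ih
      obtain ⟨C', hC', h1', h2'⟩ := ih'
      obtain rfl := Branches.allCorners_disjoint ht hC hC' h2 h1'
      exact ⟨C, hC, h1, h2'⟩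
  · rintro ⟨C, hC, ha, hb⟩
    let R : ℝ → ℝ → Prop := fun x y => ∃ (hx : ∃ a ∈ t.cutChords, x = a.1 ∨ x = a.2)
      (hy : ∃ a ∈ t.cutChords, y = a.1 ∨ y = a.2),
      Quotient.mk t.markedSetoid ⟨x, hx⟩ = Quotient.mk t.markedSetoid ⟨y, hy⟩
    have htr : ∀ a b c, R a b → R b c → R a c := fun a b c ⟨h1, _, h⟩ ⟨_, h2, h'⟩ =>
      ⟨h1, h2, h.trans h'⟩
    have hsymm : ∀ a b, R a b → R b a := fun a b ⟨h1, h2, h⟩ => ⟨h2, h1, h.symm⟩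
    have hch : ∀ p ∈ t.cutChords, R p.1 p.2 := fun p hp => by
      have h1 : ∃ a ∈ t.cutChords, p.1 = a.1 ∨ p.1 = a.2 := ⟨p, hp, Or.inl rfl⟩
      have h2 : ∃ a ∈ t.cutChords, p.2 = a.1 ∨ p.2 = a.2 := ⟨p, hp, Or.inr rfl⟩
      refine ⟨h1, h2, Quotient.sound (s := t.markedSetoid) ?_⟩
      exact Relation.EqvGen.rel (r := fun s s' : t.Marked => (s.1, s'.1) ∈ t.cutChords)
        ⟨p.1, h1⟩ ⟨p.2, h2⟩ hp
    have hch' : ∀ p ∈ t.chords 0, R p.1 p.2 := fun p hp => hch p (List.mem_cons_of_mem _ hp)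
    have hR : R a.1 b.1 := by
      rcases List.mem_cons.1 hC with rfl | hC
      · have h0 := hch _ List.mem_cons_self
        have h1 := t.corners_linked htr 0 (htr _ _ _ h0 (hsymm _ _ h0)) hch' hsymm
        exact htr _ _ _ (hsymm _ _ (h1 _ ha)) (h1 _ hb)
      · exact t.nodeCorners_linked htr hsymm 0 ht hch' C hC _ ha _ hb
    obtain ⟨_, _, h⟩ := hR
    exact h

theorem Branches.marked_of_mem_allCorners {t : Branches ι ℝ} (ht : t.Positive) {C : List ℝ}
    (hC : C ∈ t.allCorners) {c : ℝ} (hc : c ∈ C) : ∃ a ∈ t.cutChords, c = a.1 ∨ c = a.2 := by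
  let R : ℝ → ℝ → Prop := fun x y => (∃ a ∈ t.cutChords, x = a.1 ∨ x = a.2) ∧
    ∃ a ∈ t.cutChords, y = a.1 ∨ y = a.2
  have htr : ∀ a b c, R a b → R b c → R a c := fun a b c h h' => ⟨h.1, h'.2⟩
  have hsymm : ∀ a b, R a b → R b a := fun a b h => ⟨h.2, h.1⟩
  have hch : ∀ p ∈ t.cutChords, R p.1 p.2 := fun p hp =>
    ⟨⟨p, hp, Or.inl rfl⟩, ⟨p, hp, Or.inr rfl⟩⟩
  have hch' : ∀ p ∈ t.chords 0, R p.1 p.2 := fun p hp => hch p (List.mem_cons_of_mem _ hp)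
  rcases List.mem_cons.1 hC with rfl | hC
  · have h0 := hch _ List.mem_cons_self
    exact (t.corners_linked htr 0 (htr _ _ _ h0 (hsymm _ _ h0)) hch' hsymm c hc).2
  · exact (t.nodeCorners_linked htr hsymm 0 ht hch' C hC c hc c hc).1

end Corners

/-! ### The completed chord diagram as a space of measures -/

section ChordMeasures

variable {ι : Type}

/-- The probability measures supported in the finite set `C`. -/
def hull (C : List ℝ) : Set (ℝ →₀ ℝ) :=
  {μ | (∀ y, μ y ≠ 0 → y ∈ C) ∧ (∀ y, 0 ≤ μ y) ∧ pairing (fun _ => 1) μ = 1}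

/-- The point masses on the outside circle, and the probability measures supported in the set of
parameters at which the outside circle visits a black vertex. -/
def Branches.chordMeasures (t : Branches ι ℝ) : Set (ℝ →₀ ℝ) :=
  {μ | (∃ s ∈ Set.Icc 0 t.total, μ = Finsupp.single s 1) ∨ ∃ C ∈ t.allCorners, μ ∈ hull C}

/-- The measure given by a point of a simplex. -/
noncomputable def Branches.simplexMeasure (t : Branches ι ℝ) (q : Quotient t.markedSetoid)
    (w : stdSimplex ℝ (t.ChordClass q)) : ℝ →₀ ℝ := ∑ m, Finsupp.single m.1.1 (w m)

theorem Branches.simplexMeasure_apply (t : Branches ι ℝ) (q : Quotient t.markedSetoid)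
    (w : stdSimplex ℝ (t.ChordClass q)) (m : t.ChordClass q) :
    t.simplexMeasure q w m.1.1 = w m := by
  classical
  rw [Branches.simplexMeasure, Finsupp.finsetSum_apply, Finset.sum_eq_single_of_mem m
    (Finset.mem_univ m), Finsupp.single_eq_same]
  intro m' _ hne
  exact Finsupp.single_eq_of_ne fun h => hne (Subtype.ext (Subtype.ext h.symm))

theorem Branches.exists_of_simplexMeasure_ne_zero (t : Branches ι ℝ) (q : Quotient t.markedSetoid)
    (w : stdSimplex ℝ (t.ChordClass q)) {y : ℝ} (h : t.simplexMeasure q w y ≠ 0) :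
    ∃ m : t.ChordClass q, m.1.1 = y := by
  by_contra! hne
  refine h ?_
  rw [Branches.simplexMeasure, Finsupp.finsetSum_apply]
  exact Finset.sum_eq_zero fun m _ => Finsupp.single_eq_of_ne (hne m).symm

theorem Branches.simplexMeasure_nonneg (t : Branches ι ℝ) (q : Quotient t.markedSetoid)
    (w : stdSimplex ℝ (t.ChordClass q)) (y : ℝ) : 0 ≤ t.simplexMeasure q w y := by
  by_cases h : t.simplexMeasure q w y = 0
  · exact h.ge
  · obtain ⟨m, rfl⟩ := t.exists_of_simplexMeasure_ne_zero q w h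
    rw [t.simplexMeasure_apply]
    exact w.2.1 m

theorem Branches.pairing_simplexMeasure (t : Branches ι ℝ) (q : Quotient t.markedSetoid)
    (w : stdSimplex ℝ (t.ChordClass q)) (h : ℝ → ℝ) :
    pairing h (t.simplexMeasure q w) = ∑ m, w m * h m.1.1 := by
  simp [Branches.simplexMeasure, map_sum]

/-- The measure given by a point of the pieces of the completed chord diagram. -/
noncomputable def Branches.pieceMeasure (t : Branches ι ℝ) : t.Pieces → (ℝ →₀ ℝ) :=
  Sum.elim (fun s => Finsupp.single s.1 1) fun w => t.simplexMeasure w.1 w.2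

theorem Branches.simplexMeasure_vertex (t : Branches ι ℝ) (m : t.Marked) :
    t.simplexMeasure _ (t.vertex m) = Finsupp.single m.1 1 := by
  classical
  rw [Branches.simplexMeasure, Finset.sum_eq_single_of_mem ⟨m, rfl⟩ (Finset.mem_univ _)]
  · congr 1
    exact Pi.single_eq_same _ _
  · intro m' _ hne
    have : t.vertex m m' = 0 := Pi.single_eq_of_ne hne _
    rw [this, Finsupp.single_zero]

theorem Branches.simplexMeasure_injective (t : Branches ι ℝ) {q q' : Quotient t.markedSetoid}
    {w : stdSimplex ℝ (t.ChordClass q)} {w' : stdSimplex ℝ (t.ChordClass q')}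
    (h : t.simplexMeasure q w = t.simplexMeasure q' w') :
    (⟨q, w⟩ : Σ q : Quotient t.markedSetoid, stdSimplex ℝ (t.ChordClass q)) = ⟨q', w'⟩ := by
  obtain ⟨m, hm⟩ : ∃ m, w m ≠ 0 := by
    by_contra! h0
    have : ∑ m, w m = 1 := w.2.2
    rw [Finset.sum_eq_zero fun m _ => h0 m] at this
    exact zero_ne_one this
  rw [← t.simplexMeasure_apply q w m, h] at hm
  obtain ⟨m', hm'⟩ := t.exists_of_simplexMeasure_ne_zero q' w' hm
  obtain rfl : q = q' := by rw [← m.2, ← m'.2, Subtype.ext hm']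
  congr 1
  refine Subtype.ext (funext fun m => ?_)
  change w m = w' m
  rw [← t.simplexMeasure_apply q w m, h, t.simplexMeasure_apply]

theorem Branches.glue_of_single_eq (t : Branches ι ℝ) (s : Set.Icc (0 : ℝ) t.total)
    {q : Quotient t.markedSetoid} {w : stdSimplex ℝ (t.ChordClass q)}
    (h : Finsupp.single s.1 1 = t.simplexMeasure q w) : t.Glue (Sum.inl s) (Sum.inr ⟨q, w⟩) := by
  obtain ⟨⟨m, rfl⟩, hm⟩ := t.exists_of_simplexMeasure_ne_zero q w (y := s.1) (by
    rw [← h, Finsupp.single_eq_same]; exact one_ne_zero)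
  simp only at hm
  have hw : w = t.vertex m := eq_of_heq (Sigma.mk.inj (t.simplexMeasure_injective
    (h.symm.trans ((hm ▸ t.simplexMeasure_vertex m).symm)))).2
  rw [hw]
  exact Branches.Glue.vertex s m hm.symm

/-- The measure given by a point of the completed chord diagram. -/
noncomputable def Branches.diagramMeasure (t : Branches ι ℝ) :
    t.CompletedChordDiagram → (ℝ →₀ ℝ) :=
  Quot.lift t.pieceMeasure (by
    rintro _ _ ⟨s, m, h⟩
    simp [Branches.pieceMeasure, t.simplexMeasure_vertex, h])

theorem Branches.diagramMeasure_injective (t : Branches ι ℝ) :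
    Function.Injective t.diagramMeasure := by
  rintro ⟨s | ⟨q, w⟩⟩ ⟨s' | ⟨q', w'⟩⟩ h
  · have : s = s' := Subtype.ext (Finsupp.single_left_injective one_ne_zero h)
    rw [this]
  · exact Quot.sound (t.glue_of_single_eq s h)
  · exact (Quot.sound (t.glue_of_single_eq s' (Eq.symm h))).symm
  · rw [t.simplexMeasure_injective h]

theorem Branches.continuous_diagramMeasure (t : Branches ι ℝ) : Continuous t.diagramMeasure := by
  refine continuous_quot_lift _ (Continuous.sumElim (continuous_single.comp continuous_subtype_val)
    (continuous_sigma fun q => continuous_measure_iff.2 fun h => ?_))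
  simp only [t.pairing_simplexMeasure]
  refine continuous_finsetSum _ fun m _ => Continuous.mul ?_ continuous_const
  exact (continuous_apply m).comp continuous_subtype_val

theorem Branches.range_diagramMeasure {t : Branches ι ℝ} (ht : t.Positive) :
    Set.range t.diagramMeasure = t.chordMeasures := by
  ext μ
  constructor
  · rintro ⟨⟨s | ⟨q, w⟩⟩, rfl⟩
    · exact Or.inl ⟨s.1, s.2, rfl⟩
    · obtain ⟨m, rfl⟩ := Quotient.exists_rep q
      obtain ⟨C, hC, hm, -⟩ := (Branches.linked_iff ht m m).1 rfl
      refine Or.inr ⟨C, hC, fun y hy => ?_, t.simplexMeasure_nonneg _ w, ?_⟩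
      · obtain ⟨m', rfl⟩ := t.exists_of_simplexMeasure_ne_zero _ w hy
        obtain ⟨C', hC', h1, h2⟩ := (Branches.linked_iff ht _ _).1 m'.2
        rwa [Branches.allCorners_disjoint ht hC hC' hm h2]
      · refine (t.pairing_simplexMeasure _ w _).trans ?_
        simp
  · rintro (⟨s, hs, rfl⟩ | ⟨C, hC, h1, h2, h3⟩)
    · exact ⟨Quot.mk _ (Sum.inl ⟨s, hs⟩), rfl⟩
    · obtain ⟨c, hc⟩ : ∃ c, c ∈ C := by
        by_contra! h0
        have : μ = 0 := Finsupp.ext fun y => by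
          by_contra hy
          exact h0 y (h1 y hy)
        rw [this, map_zero] at h3
        exact zero_ne_one h3
      let m₀ : t.Marked := ⟨c, Branches.marked_of_mem_allCorners ht hC hc⟩
      let q := Quotient.mk t.markedSetoid m₀
      have key : ∀ y, μ y ≠ 0 → ∃ m : t.ChordClass q, m.1.1 = y := fun y hy =>
        ⟨⟨⟨y, Branches.marked_of_mem_allCorners ht hC (h1 y hy)⟩,
          (Branches.linked_iff ht _ _).2 ⟨C, hC, h1 y hy, hc⟩⟩, rfl⟩
      have hμ : μ = ∑ m : t.ChordClass q, Finsupp.single m.1.1 (μ m.1.1) := by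
        classical
        ext y
        rw [Finsupp.finsetSum_apply]
        by_cases hy : μ y = 0
        · rw [hy, Finset.sum_eq_zero]
          intro m _
          rw [Finsupp.single_apply]
          split_ifs with h
          · rw [h, hy]
          · rfl
        · obtain ⟨m, rfl⟩ := key y hy
          rw [Finset.sum_eq_single_of_mem m (Finset.mem_univ m), Finsupp.single_eq_same]
          intro m' _ hne
          exact Finsupp.single_eq_of_ne fun h => hne (Subtype.ext (Subtype.ext h.symm))
      let w : stdSimplex ℝ (t.ChordClass q) := ⟨fun m => μ m.1.1, fun m => h2 _, by
        rw [hμ, map_sum] at h3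
        simpa using h3⟩
      exact ⟨Quot.mk _ (Sum.inr ⟨q, w⟩), hμ.symm⟩

instance (t : Branches ι ℝ) : CompactSpace t.CompletedChordDiagram :=
  inferInstanceAs (CompactSpace (Quot t.Glue))

theorem Branches.nonempty_diagram_homeomorph {t : Branches ι ℝ} (ht : t.Positive) :
    Nonempty (t.CompletedChordDiagram ≃ₜ t.chordMeasures) :=
  ⟨((t.continuous_diagramMeasure.isClosedEmbedding
    t.diagramMeasure_injective).isEmbedding.toHomeomorph).trans
      (Homeomorph.setCongr (Branches.range_diagramMeasure ht))⟩

end ChordMeasures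

end Cacti

namespace Cacti

/-! ### The measure of the last lobe -/

section Scale

variable {ι : Type} (r : ι → ℝ)

theorem Branches.scale_append (a b : Branches ι ℝ) :
    (a.append b).scale r = (a.scale r).append (b.scale r) := by
  induction a using Branches.rec (motive_2 := fun _ => True) with
  | nil => simp [Branches.append, Branches.scale]
  | cons i v rest _ ih => simp [Branches.append, Branches.scale, ih]
  | close => trivial
  | arc => trivial

theorem Branches.isNil_scale (b : Branches ι ℝ) : (b.scale r).IsNil ↔ b.IsNil := by
  cases b <;> simp [Branches.scale, Branches.IsNil]

theorem Branches.mem_corners_append_left {a : Branches ι ℝ} (b : Branches ι ℝ) {s c : ℝ}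
    (hc : c ∈ a.corners s) : c ∈ (a.append b).corners s := by
  induction a using Branches.rec (motive_2 := fun _ => True) generalizing s with
  | nil =>
    simp only [Branches.corners, List.mem_singleton] at hc
    exact hc ▸ b.start_mem_corners _
  | cons i v rest _ ih =>
    simp only [Branches.append, Branches.corners, List.mem_cons] at hc ⊢
    exact hc.imp id fun h => ih h
  | close => trivial
  | arc => trivial

theorem Branches.mem_corners_append_right (a : Branches ι ℝ) {b : Branches ι ℝ} {s c : ℝ}
    (hc : c ∈ b.corners (s + a.total)) : c ∈ (a.append b).corners s := by
  induction a using Branches.rec (motive_2 := fun _ => True) generalizing s with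
  | nil => simpa [Branches.append, Branches.total] using hc
  | cons i v rest _ ih =>
    simp only [Branches.append, Branches.corners, List.mem_cons]
    refine Or.inr (ih ?_)
    rwa [Branches.total, ← add_assoc] at hc
  | close => trivial
  | arc => trivial

mutual

theorem Branches.positive_scale {r : ι → ℝ} (hr : ∀ i, 0 < r i) : ∀ b : Branches ι ℝ, b.Good →
    (b.scale r).Positive
  | .nil, _ => ⟨trivial, trivial⟩
  | .cons i v rest, h => by
      rw [Branches.good_cons] at h
      rw [Branches.scale, Branches.positive_cons]
      exact ⟨Lobe.positive_scale hr (hr i) v h.1, Branches.positive_scale hr rest h.2.2⟩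

theorem Lobe.positive_scale {r : ι → ℝ} (hr : ∀ i, 0 < r i) {a : ℝ} (ha : 0 < a) :
    ∀ v : Lobe ι ℝ, v.Good → (v.scale r a).Positive
  | .close x, h => by
      rw [Lobe.good_close] at h
      rw [Lobe.scale, Lobe.positive_close]
      exact mul_pos ha h
  | .arc x b rest, h => by
      rw [Lobe.good_arc] at h
      rw [Lobe.scale, Lobe.positive_arc, Branches.isNil_scale]
      exact ⟨mul_pos ha h.1, h.2.1, Branches.positive_scale hr b h.2.2.1,
        Lobe.positive_scale hr ha rest h.2.2.2⟩

end

mutual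

theorem Branches.baseLength_word : ∀ b : Branches ι ℝ,
    baseLength r (b.word some) = (b.scale r).total
  | .nil => rfl
  | .cons i v rest => by
      rw [Branches.word, baseLength_append, Branches.scale, Branches.total,
        Lobe.baseLength_word i v, Branches.baseLength_word rest]

theorem Lobe.baseLength_word (j : ι) : ∀ v : Lobe ι ℝ,
    baseLength r (v.word some (some j)) = (v.scale r (r j)).total
  | .close x => by simp [Lobe.word, Lobe.scale, Lobe.total, baseLength]
  | .arc x b rest => by
      rw [Lobe.word, baseLength, baseLength_append, Lobe.scale, Lobe.total,
        Lobe.baseLength_word j rest, Branches.baseLength_word b]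

end

end Scale

section Classify

variable {n : ℕ} (r : Fin n → ℝ)

theorem finSuccEquivLast_eq_none {i : Fin (n + 1)} :
    finSuccEquivLast i = none ↔ i = Fin.last n := by
  rw [← Equiv.eq_symm_apply]; simp

theorem finSuccEquivLast_of_ne {i : Fin (n + 1)} (hi : i ≠ Fin.last n) :
    finSuccEquivLast i = some (i.castPred hi) := (Equiv.eq_symm_apply _).1 (by simp)

theorem Branches.mu_word_eq_zero (b : Branches (Fin (n + 1)) ℝ) (hb : Fin.last n ∉ b.labels)
    (s : ℝ) : mu r (b.word finSuccEquivLast) s = 0 :=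
  mu_eq_zero _ _ (fun p hp h => by
    obtain ⟨i, hi, hp⟩ := Branches.label_of_mem_word _ b p hp
    exact hb (finSuccEquivLast_eq_none.1 (hp.symm.trans h) ▸ hi)) _

theorem Lobe.mu_word_eq_zero (j : Fin n) (v : Lobe (Fin (n + 1)) ℝ) (hv : Fin.last n ∉ v.labels)
    (s : ℝ) : mu r (v.word finSuccEquivLast (some j)) s = 0 :=
  mu_eq_zero _ _ (fun p hp h => by
    rcases Lobe.label_of_mem_word _ _ v p hp with hp | ⟨i, hi, hp⟩
    · exact Option.some_ne_none _ (hp.symm.trans h)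
    · exact hv (finSuccEquivLast_eq_none.1 (hp.symm.trans h) ▸ hi)) _

theorem Branches.baseLength_word_last (b : Branches (Fin (n + 1)) ℝ) (hb : b.Good) :
    baseLength r (b.word finSuccEquivLast) = (b.forget.scale r).total := by
  rw [← (b.sameBase_forget hb).1, Branches.baseLength_word]

theorem Lobe.baseLength_word_last (j : Fin n) (v : Lobe (Fin (n + 1)) ℝ) (hv : v.Good) :
    baseLength r (v.word finSuccEquivLast (some j)) = (v.forget.scale r (r j)).total := by
  rw [← (v.sameBase_forget _ hv).1, Lobe.baseLength_word]

theorem Branches.not_isNil_forget {b : Branches (Fin (n + 1)) ℝ} (hb : ¬ b.IsNil)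
    (hl : Fin.last n ∉ b.labels) : ¬ b.forget.IsNil := by
  cases b with
  | nil => exact absurd trivial hb
  | cons i v rest =>
    have hi : i ≠ Fin.last n := by rintro rfl; exact hl (by simp [Branches.labels])
    simp [Branches.forget, hi, Branches.IsNil]

theorem Lobe.support_mu_word_none (v : Lobe (Fin (n + 1)) ℝ) (hv : v.Good)
    (hl : Fin.last n ∉ v.labels) (s : ℝ) {z : ℝ}
    (hz : mu r (v.word finSuccEquivLast none) s z ≠ 0) :
    z ∈ (v.forget.branches.scale r).corners s := by
  induction v using Lobe.rec (motive_1 := fun _ => True) generalizing s with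
  | nil => trivial
  | cons => trivial
  | close x =>
    simp only [Lobe.word, mu, add_zero] at hz
    by_contra hne
    refine hz (Finsupp.single_eq_of_ne fun h => hne ?_)
    exact h ▸ Branches.start_mem_corners _ _
  | arc x b rest _ ih =>
    rw [Lobe.good_arc] at hv
    simp only [Lobe.labels, List.mem_append, not_or] at hl
    have hb := Branches.not_isNil_forget hv.2.1 hl.1
    simp only [Lobe.forget, hb, if_false, Lobe.branches, Branches.scale_append]
    rw [Lobe.word, mu, mu_append, Branches.mu_word_eq_zero _ _ hl.1, zero_add,
      Branches.baseLength_word_last _ _ hv.2.2.1, Finsupp.add_apply] at hz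
    by_cases h : mu r (rest.word finSuccEquivLast none) (s + (b.forget.scale r).total) z = 0
    · rw [h, add_zero] at hz
      refine Branches.mem_corners_append_left _ ?_
      by_contra hne
      refine hz (Finsupp.single_eq_of_ne fun h => hne ?_)
      exact h ▸ Branches.start_mem_corners _ _
    · exact Branches.mem_corners_append_right _ (ih hv.2.2.2 hl.2 _ h)

mutual

theorem Branches.support_mu_word {r : Fin n → ℝ} (hr : ∀ i, 0 < r i) :
    ∀ (b : Branches (Fin (n + 1)) ℝ) (s : ℝ),
    b.Good → b.labels.count (Fin.last n) = 1 →
    (∃ y ∈ Set.Icc s (s + (b.forget.scale r).total),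
      ∀ z, mu r (b.word finSuccEquivLast) s z ≠ 0 → z = y) ∨
    ∃ C ∈ (b.forget.scale r).corners s :: (b.forget.scale r).nodeCorners s,
      ∀ z, mu r (b.word finSuccEquivLast) s z ≠ 0 → z ∈ C
  | .nil, s, _, h => by simp [Branches.labels] at h
  | .cons i v rest, s, h, hc => by
      have htot := Branches.total_nonneg _ (Branches.positive_scale hr _
        (Branches.forget_spec _ ((Branches.good_cons _ _ _).1 h).2.2).1)
      have htot' := fun j => Lobe.total_pos _ (Lobe.positive_scale hr (hr j) _
        (Lobe.forget_spec _ ((Branches.good_cons _ _ _).1 h).1).1)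
      rw [Branches.good_cons] at h
      simp only [Branches.labels, List.count_cons, List.count_append] at hc
      by_cases hi : i = Fin.last n
      · subst hi
        simp only [beq_self_eq_true, if_true] at hc
        have hv : Fin.last n ∉ v.labels := List.count_eq_zero.1 (by omega)
        have hrest : Fin.last n ∉ rest.labels := List.count_eq_zero.1 (by omega)
        refine Or.inr ⟨_, List.mem_cons_self, fun z hz => ?_⟩
        rw [Branches.word, mu_append, Branches.mu_word_eq_zero _ _ hrest, add_zero,
          finSuccEquivLast_last] at hz
        simp only [Branches.forget, dif_pos, Branches.scale_append]
        exact Branches.mem_corners_append_left _ (Lobe.support_mu_word_none r v h.1 hv s hz)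
      · have hi' : (i == Fin.last n) = false := by simpa using hi
        simp only [hi', Bool.false_eq_true, if_false, add_zero] at hc
        simp only [Branches.forget, hi, dif_neg, not_false_eq_true, Branches.scale,
          Branches.word, mu_append, finSuccEquivLast_of_ne hi, Lobe.baseLength_word_last _ _ _ h.1,
          Branches.total, Branches.corners, Branches.nodeCorners, List.mem_cons, List.mem_append]
        have := htot' (i.castPred hi)
        rcases Nat.eq_zero_or_pos (v.labels.count (Fin.last n)) with hv | hv
        · have hv' : Fin.last n ∉ v.labels := List.count_eq_zero.1 hv
          rw [Lobe.mu_word_eq_zero _ _ _ hv', zero_add]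
          rcases Branches.support_mu_word hr rest _ h.2.2 (by omega) with ⟨y, hy, hz⟩ | ⟨C, hC, hz⟩
          · exact Or.inl ⟨y, ⟨by linarith [hy.1], by linarith [hy.2]⟩, hz⟩
          · rcases List.mem_cons.1 hC with rfl | hC
            · exact Or.inr ⟨_, Or.inl rfl, fun z hz' => List.mem_cons_of_mem _ (hz z hz')⟩
            · exact Or.inr ⟨C, Or.inr (Or.inr hC), hz⟩
        · have hr' : Fin.last n ∉ rest.labels := List.count_eq_zero.1 (by omega)
          rw [Branches.mu_word_eq_zero _ _ hr', add_zero]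
          rcases Lobe.support_mu_word hr (i.castPred hi) v s h.1 (by omega) with
            ⟨y, hy, hz⟩ | ⟨C, hC, hz⟩
          · exact Or.inl ⟨y, ⟨by linarith [hy.1], by linarith [hy.2]⟩, hz⟩
          · exact Or.inr ⟨C, Or.inr (Or.inl hC), hz⟩

theorem Lobe.support_mu_word {r : Fin n → ℝ} (hr : ∀ i, 0 < r i) (j : Fin n) :
    ∀ (v : Lobe (Fin (n + 1)) ℝ) (s : ℝ),
    v.Good → v.labels.count (Fin.last n) = 1 →
    (∃ y ∈ Set.Icc s (s + (v.forget.scale r (r j)).total),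
      ∀ z, mu r (v.word finSuccEquivLast (some j)) s z ≠ 0 → z = y) ∨
    ∃ C ∈ (v.forget.scale r (r j)).nodeCorners s,
      ∀ z, mu r (v.word finSuccEquivLast (some j)) s z ≠ 0 → z ∈ C
  | .close x, s, _, h => by simp [Lobe.labels] at h
  | .arc x b rest, s, h, hc => by
      have hlen := Lobe.baseLength_word_last r j _ h
      rw [Lobe.good_arc] at h
      have htot := Branches.total_nonneg _ (Branches.positive_scale hr _
        (Branches.forget_spec _ h.2.2.1).1)
      have htot' := Lobe.total_pos _ (Lobe.positive_scale hr (hr j) _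
        (Lobe.forget_spec _ h.2.2.2).1)
      have hx := mul_pos (hr j) h.1
      simp only [Lobe.labels, List.count_append] at hc
      rw [Lobe.word, baseLength, baseLength_append, Branches.baseLength_word_last _ _ h.2.2.1,
        Lobe.baseLength_word_last _ _ _ h.2.2.2] at hlen
      rw [← hlen, Lobe.word, mu, mu_append, Branches.baseLength_word_last _ _ h.2.2.1]
      rcases Nat.eq_zero_or_pos (b.labels.count (Fin.last n)) with hb | hb
      · have hb' : Fin.last n ∉ b.labels := List.count_eq_zero.1 hb
        have hbn := Branches.not_isNil_forget h.2.1 hb'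
        simp only [Lobe.forget, hbn, if_false, Lobe.scale, Lobe.nodeCorners, List.mem_cons,
          List.mem_append]
        rw [Branches.mu_word_eq_zero _ _ hb', zero_add]
        rcases Lobe.support_mu_word hr j rest (s + r j * x + (b.forget.scale r).total)
          h.2.2.2 (by omega) with ⟨y, hy, hz⟩ | ⟨C, hC, hz⟩
        · exact Or.inl ⟨y, ⟨by linarith [hy.1], by linarith [hy.2]⟩, hz⟩
        · exact Or.inr ⟨C, Or.inr (Or.inr hC), hz⟩
      · have hr' : Fin.last n ∉ rest.labels := List.count_eq_zero.1 (by omega)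
        rw [Lobe.mu_word_eq_zero _ _ _ hr', add_zero]
        have IH := Branches.support_mu_word hr b (s + r j * x) h.2.2.1 (by omega)
        by_cases hbn : b.forget.IsNil
        · refine Or.inl ⟨s + r j * x, ⟨by linarith, by linarith⟩, fun z hz' => ?_⟩
          have hnil : b.forget = .nil := by
            cases hbf : b.forget with
            | nil => rfl
            | cons => rw [hbf] at hbn; exact hbn.elim
          rw [hnil] at IH
          simp only [Branches.scale, Branches.total, add_zero, Set.Icc_self, Set.mem_singleton_iff,
            Branches.corners, Branches.nodeCorners, List.mem_cons, List.not_mem_nil, or_false] at IH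
          rcases IH with ⟨y, rfl, hz⟩ | ⟨C, rfl, hz⟩
          · exact hz z hz'
          · simpa using hz z hz'
        · simp only [Lobe.forget, hbn, if_false, Lobe.scale, Lobe.nodeCorners, List.mem_cons,
            List.mem_append]
          rcases IH with ⟨y, hy, hz⟩ | ⟨C, hC, hz⟩
          · exact Or.inl ⟨y, ⟨by linarith [hy.1], by linarith [hy.2]⟩, hz⟩
          · rcases List.mem_cons.1 hC with rfl | hC
            · exact Or.inr ⟨_, Or.inl rfl, hz⟩
            · exact Or.inr ⟨C, Or.inr (Or.inl hC), hz⟩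

end

mutual

theorem Branches.mass_mu_word : ∀ (b : Branches (Fin (n + 1)) ℝ) (s : ℝ), b.UnitLobes →
    pairing (fun _ => 1) (mu r (b.word finSuccEquivLast) s) = b.labels.count (Fin.last n)
  | .nil, s, _ => by simp [Branches.word, mu, Branches.labels]
  | .cons i v rest, s, h => by
      rw [Branches.word, mu_append, map_add, Branches.mass_mu_word rest _ h.2.2,
        Lobe.mass_mu_word _ v _ h.2.1, h.1]
      by_cases hi : i = Fin.last n
      · simp [Branches.labels, hi]; ring
      · simp [Branches.labels, hi, finSuccEquivLast_eq_none]

theorem Lobe.mass_mu_word (k : Option (Fin n)) : ∀ (v : Lobe (Fin (n + 1)) ℝ) (s : ℝ),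
    v.UnitLobesAbove → pairing (fun _ => 1) (mu r (v.word finSuccEquivLast k) s) =
      (if k = none then v.perim else 0) + v.labels.count (Fin.last n)
  | .close x, s, _ => by
      rcases k with _ | k <;> simp [Lobe.word, mu, Lobe.labels, Lobe.perim]
  | .arc x b rest, s, h => by
      rcases k with _ | k <;>
        simp [Lobe.word, mu, Lobe.labels, Lobe.perim, mu_append,
          Branches.mass_mu_word b _ h.1, Lobe.mass_mu_word _ rest _ h.2] <;>
        ring

end

theorem mu_word_mem_chordMeasures {r : Fin n → ℝ} (hr : ∀ i, 0 < r i) (c : NCact (n + 1)) :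
    mu r (c.1.word finSuccEquivLast) 0 ∈ ((forgetLobe' c).1.scale r).chordMeasures := by
  have hm := Branches.mass_mu_word r c.1 0 c.2.unitLobes
  rw [c.2.count_labels, Nat.cast_one] at hm
  rcases Branches.support_mu_word hr c.1 0 c.2.good (c.2.count_labels _) with
    ⟨y, hy, hz⟩ | ⟨C, hC, hz⟩
  · rw [zero_add] at hy
    refine Or.inl ⟨y, hy, ?_⟩
    have : mu r (c.1.word finSuccEquivLast) 0 =
        Finsupp.single y (mu r (c.1.word finSuccEquivLast) 0 y) := by
      ext z
      by_cases h : z = y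
      · rw [h, Finsupp.single_eq_same]
      · rw [Finsupp.single_eq_of_ne h]
        by_contra h0
        exact h (hz z h0)
    rw [this] at hm ⊢
    rw [pairing_single, mul_one] at hm
    rw [hm]
  · exact Or.inr ⟨C, hC, hz, mu_nonneg _ _ (Branches.word_pos _ _ c.2.pos) _, hm⟩

end Classify

end Cacti

namespace Cacti

/-! ### Inserting a lobe -/

section Lift

variable {n : ℕ}

mutual

/-- The same tree, with room for one more label. -/
def Branches.lift : Branches (Fin n) ℝ → Branches (Fin (n + 1)) ℝ
  | .nil => .nil
  | .cons i v rest => .cons i.castSucc v.lift rest.lift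

/-- See `Branches.lift`. -/
def Lobe.lift : Lobe (Fin n) ℝ → Lobe (Fin (n + 1)) ℝ
  | .close x => .close x
  | .arc x b rest => .arc x b.lift rest.lift

end

theorem Branches.isNil_lift (b : Branches (Fin n) ℝ) : b.lift.IsNil ↔ b.IsNil := by
  cases b <;> simp [Branches.lift, Branches.IsNil]

theorem Lobe.perim_lift (v : Lobe (Fin n) ℝ) : v.lift.perim = v.perim := by
  induction v using Lobe.rec (motive_1 := fun _ => True) with
  | nil => trivial
  | cons => trivial
  | close x => rfl
  | arc x b rest _ ih => simp [Lobe.lift, Lobe.perim, ih]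

mutual

theorem Branches.good_lift : ∀ b : Branches (Fin n) ℝ, b.Good → b.lift.Good
  | .nil, _ => Branches.good_nil
  | .cons i v rest, h => by
      rw [Branches.good_cons] at h
      rw [Branches.lift, Branches.good_cons, Lobe.perim_lift]
      exact ⟨Lobe.good_lift v h.1, h.2.1, Branches.good_lift rest h.2.2⟩

theorem Lobe.good_lift : ∀ v : Lobe (Fin n) ℝ, v.Good → v.lift.Good
  | .close x, h => (Lobe.good_close x).2 ((Lobe.good_close x).1 h)
  | .arc x b rest, h => by
      rw [Lobe.good_arc] at h
      rw [Lobe.lift, Lobe.good_arc, Branches.isNil_lift]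
      exact ⟨h.1, h.2.1, Branches.good_lift b h.2.2.1, Lobe.good_lift rest h.2.2.2⟩

end

mutual

theorem Branches.labels_lift : ∀ b : Branches (Fin n) ℝ, b.lift.labels = b.labels.map Fin.castSucc
  | .nil => rfl
  | .cons i v rest => by
      simp [Branches.lift, Branches.labels, Lobe.labels_lift v, Branches.labels_lift rest]

theorem Lobe.labels_lift : ∀ v : Lobe (Fin n) ℝ, v.lift.labels = v.labels.map Fin.castSucc
  | .close x => rfl
  | .arc x b rest => by
      simp [Lobe.lift, Lobe.labels, Lobe.labels_lift rest, Branches.labels_lift b]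

end

theorem Branches.count_lift (b : Branches (Fin n) ℝ) (i : Fin n) :
    b.lift.labels.count i.castSucc = b.labels.count i := by
  rw [Branches.labels_lift, List.count_map_of_injective _ _ (Fin.castSucc_injective n)]

theorem Lobe.count_lift (v : Lobe (Fin n) ℝ) (i : Fin n) :
    v.lift.labels.count i.castSucc = v.labels.count i := by
  rw [Lobe.labels_lift, List.count_map_of_injective _ _ (Fin.castSucc_injective n)]

theorem last_notMem_map_castSucc (l : List (Fin n)) : Fin.last n ∉ l.map Fin.castSucc := by
  simp [List.mem_map, Fin.castSucc_ne_last]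

theorem Branches.count_last_lift (b : Branches (Fin n) ℝ) :
    b.lift.labels.count (Fin.last n) = 0 := by
  rw [Branches.labels_lift]; exact List.count_eq_zero.2 (last_notMem_map_castSucc _)

theorem Lobe.count_last_lift (v : Lobe (Fin n) ℝ) : v.lift.labels.count (Fin.last n) = 0 := by
  rw [Lobe.labels_lift]; exact List.count_eq_zero.2 (last_notMem_map_castSucc _)

mutual

theorem Branches.word_lift : ∀ b : Branches (Fin n) ℝ,
    b.lift.word finSuccEquivLast = b.word some
  | .nil => rfl
  | .cons i v rest => by
      simp [Branches.lift, Branches.word, Lobe.word_lift _ v, Branches.word_lift rest]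

theorem Lobe.word_lift (k : Option (Fin n)) : ∀ v : Lobe (Fin n) ℝ,
    v.lift.word finSuccEquivLast k = v.word some k
  | .close x => rfl
  | .arc x b rest => by
      simp [Lobe.lift, Lobe.word, Lobe.word_lift _ rest, Branches.word_lift b]

end

/-- White leaves, nonnegative arcs and lobes of length one. -/
def Branches.WeaklyGood {ι : Type} (t : Branches ι ℝ) : Prop :=
  t.WhiteLeaves ∧ t.AllEdges (0 ≤ ·) ∧ t.UnitLobes

/-- White leaves, nonnegative arcs and lobes of length one. -/
def Lobe.WeaklyGood {ι : Type} (v : Lobe ι ℝ) : Prop :=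
  v.WhiteLeaves ∧ v.AllEdges (0 ≤ ·) ∧ v.UnitLobesAbove

theorem Branches.weaklyGood_cons {ι : Type} (i : ι) (v : Lobe ι ℝ) (rest : Branches ι ℝ) :
    (Branches.cons i v rest).WeaklyGood ↔ v.WeaklyGood ∧ v.perim = 1 ∧ rest.WeaklyGood := by
  simp only [Branches.WeaklyGood, Lobe.WeaklyGood, Branches.WhiteLeaves, Branches.AllEdges,
    Branches.UnitLobes]
  tauto

theorem Lobe.weaklyGood_arc {ι : Type} (x : ℝ) (b : Branches ι ℝ) (rest : Lobe ι ℝ) :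
    (Lobe.arc x b rest).WeaklyGood ↔ 0 ≤ x ∧ ¬ b.IsNil ∧ b.WeaklyGood ∧ rest.WeaklyGood := by
  simp only [Branches.WeaklyGood, Lobe.WeaklyGood, Lobe.WhiteLeaves, Lobe.AllEdges,
    Lobe.UnitLobesAbove]
  tauto

theorem Lobe.weaklyGood_close {ι : Type} (x : ℝ) :
    (Lobe.close x : Lobe ι ℝ).WeaklyGood ↔ 0 ≤ x := by
  simp [Lobe.WeaklyGood, Lobe.WhiteLeaves, Lobe.AllEdges, Lobe.UnitLobesAbove]

theorem Branches.weaklyGood_nil {ι : Type} : (Branches.nil : Branches ι ℝ).WeaklyGood :=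
  ⟨trivial, trivial, trivial⟩

mutual

theorem Branches.Good.weaklyGood {ι : Type} : ∀ {b : Branches ι ℝ}, b.Good → b.WeaklyGood
  | .nil, _ => Branches.weaklyGood_nil
  | .cons i v rest, h => by
      rw [Branches.good_cons] at h
      rw [Branches.weaklyGood_cons]
      exact ⟨Lobe.Good.weaklyGood h.1, h.2.1, Branches.Good.weaklyGood h.2.2⟩

theorem Lobe.Good.weaklyGood {ι : Type} : ∀ {v : Lobe ι ℝ}, v.Good → v.WeaklyGood
  | .close x, h => (Lobe.weaklyGood_close x).2 ((Lobe.good_close x).1 h).le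
  | .arc x b rest, h => by
      rw [Lobe.good_arc] at h
      rw [Lobe.weaklyGood_arc]
      exact ⟨h.1.le, h.2.1, Branches.Good.weaklyGood h.2.2.1, Lobe.Good.weaklyGood h.2.2.2⟩

end

end Lift

section Insert

variable {n : ℕ} {r : Fin n → ℝ}

/-- The tree `T` arises from `b` by inserting the last lobe, whose measure is `μ`; arcs of length
zero are allowed. -/
structure Branches.Extends (r : Fin n → ℝ) (b : Branches (Fin n) ℝ) (s : ℝ) (μ : ℝ →₀ ℝ)
    (T : Branches (Fin (n + 1)) ℝ) : Prop where
  not_isNil : ¬ T.IsNil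
  weaklyGood : T.WeaklyGood
  count : ∀ i : Fin n, T.labels.count i.castSucc = b.labels.count i
  count_last : T.labels.count (Fin.last n) = 1
  sameBase : SameBase (T.word finSuccEquivLast) (b.word some)
  mu_eq : mu r (T.word finSuccEquivLast) s = μ

/-- See `Branches.Extends`; the lobe under consideration has the label `j`. -/
structure Lobe.Extends (r : Fin n → ℝ) (j : Fin n) (v : Lobe (Fin n) ℝ) (s : ℝ) (μ : ℝ →₀ ℝ)
    (T : Lobe (Fin (n + 1)) ℝ) : Prop where
  weaklyGood : T.WeaklyGood
  perim : T.perim = v.perim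
  count : ∀ i : Fin n, T.labels.count i.castSucc = v.labels.count i
  count_last : T.labels.count (Fin.last n) = 1
  sameBase : SameBase (T.word finSuccEquivLast (some j)) (v.word some (some j))
  mu_eq : mu r (T.word finSuccEquivLast (some j)) s = μ

/-- A lobe without arcs to other lobes, as a sequence of branches. -/
def leaf (n : ℕ) : Branches (Fin (n + 1)) ℝ := .cons (Fin.last n) (.close 1) .nil

/-- The lobe on which all branches of `b` sit, where the arcs have the lengths prescribed
by `μ`. -/
def Branches.toLobe (r : Fin n → ℝ) (μ : ℝ →₀ ℝ) (s : ℝ) :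
    Branches (Fin n) ℝ → Lobe (Fin (n + 1)) ℝ
  | .nil => .close (μ s)
  | .cons i v rest => .arc (μ s) (.cons i.castSucc v.lift .nil)
      (rest.toLobe r μ (s + (v.scale r (r i)).total))

theorem mu_word_some {ι : Type} [DecidableEq ι] (r : ι → ℝ) (b : Branches ι ℝ) (s : ℝ) :
    mu r (b.word some) s = 0 :=
  mu_eq_zero _ _ (fun p hp => by
    obtain ⟨j, -, hj⟩ := Branches.label_of_mem_word _ b p hp
    simp [hj]) _

theorem mu_lobe_word_some {ι : Type} [DecidableEq ι] (r : ι → ℝ) (j : ι) (v : Lobe ι ℝ) (s : ℝ) :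
    mu r (v.word some (some j)) s = 0 :=
  mu_eq_zero _ _ (fun p hp => by
    rcases Lobe.label_of_mem_word _ _ v p hp with h | ⟨j, -, h⟩ <;> simp [h]) _

theorem Branches.toLobe_spec (μ : ℝ →₀ ℝ) (hμ : ∀ y, 0 ≤ μ y) (b : Branches (Fin n) ℝ)
    (hb : b.Good) (s : ℝ) :
    (b.toLobe r μ s).WeaklyGood ∧ (b.toLobe r μ s).perim = (((b.scale r).corners s).map μ).sum ∧
      (∀ i : Fin n, (b.toLobe r μ s).labels.count i.castSucc = b.labels.count i) ∧
      (b.toLobe r μ s).labels.count (Fin.last n) = 0 ∧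
      SameBase ((b.toLobe r μ s).word finSuccEquivLast none) (b.word some) ∧
      mu r ((b.toLobe r μ s).word finSuccEquivLast none) s =
        (((b.scale r).corners s).map fun c => Finsupp.single c (μ c)).sum := by
  induction b using Branches.rec (motive_2 := fun _ => True) generalizing s with
  | nil =>
    simp only [Branches.toLobe, Lobe.weaklyGood_close, Branches.scale, Branches.corners, Lobe.perim,
      Lobe.labels, Branches.labels, Lobe.word, Branches.word, mu]
    exact ⟨hμ s, by simp, by simp, by simp, (SameBase.refl _).cons_none _, by simp⟩
  | cons i v rest _ ih =>
    rw [Branches.good_cons] at hb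
    obtain ⟨h1, h2, h3, h4, h5, h6⟩ := ih hb.2.2 (s + (v.scale r (r i)).total)
    refine ⟨?_, ?_, fun k => ?_, ?_, ?_, ?_⟩
    · rw [Branches.toLobe, Lobe.weaklyGood_arc, Branches.weaklyGood_cons, Lobe.perim_lift]
      exact ⟨hμ s, id, ⟨(Lobe.good_lift v hb.1).weaklyGood, hb.2.1, Branches.weaklyGood_nil⟩, h1⟩
    · simp [Branches.toLobe, Lobe.perim, h2, Branches.scale, Branches.corners]
    · have : Fin.castSucc i = Fin.castSucc k ↔ i = k := (Fin.castSucc_injective n).eq_iff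
      simp only [Branches.toLobe, Lobe.labels, Branches.labels, List.count_append, h3,
        List.count_cons, Lobe.count_lift, List.append_nil, beq_iff_eq, this]
      ring
    · simp [Branches.toLobe, Lobe.labels, Branches.labels, List.count_append, h4,
        Lobe.count_last_lift, Fin.castSucc_ne_last]
    · simp only [Branches.toLobe, Lobe.word, Branches.word, finSuccEquivLast_castSucc,
        Lobe.word_lift, List.append_nil]
      exact ((SameBase.refl _).append h5).cons_none _
    · simp only [Branches.toLobe, Lobe.word, Branches.word, finSuccEquivLast_castSucc,
        Lobe.word_lift, List.append_nil, mu, mu_append, mu_lobe_word_some, zero_add,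
        Lobe.baseLength_word, h6, Branches.scale, Branches.corners, List.map_cons, List.sum_cons]
  | close => trivial
  | arc => trivial

theorem Branches.nodup_corners {ι : Type} (b : Branches ι ℝ) (hb : b.Positive) (s : ℝ) :
    (b.corners s).Nodup := by
  induction b using Branches.rec (motive_2 := fun _ => True) generalizing s with
  | nil => simp [Branches.corners]
  | cons i v rest _ ih =>
    rw [Branches.positive_cons] at hb
    rw [Branches.corners, List.nodup_cons]
    exact ⟨fun h => by linarith [(rest.corners_mem_Icc hb.2 _ s h).1, Lobe.total_pos v hb.1],
      ih hb.2 _⟩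
  | close => trivial
  | arc => trivial

theorem sum_single_eq {l : List ℝ} (hl : l.Nodup) {μ : ℝ →₀ ℝ} (h : ∀ y, μ y ≠ 0 → y ∈ l) :
    (l.map fun c => Finsupp.single c (μ c)).sum = μ := by
  classical
  rw [← List.sum_toFinset _ hl]
  ext y
  rw [Finsupp.finsetSum_apply]
  by_cases hy : μ y = 0
  · rw [hy, Finset.sum_eq_zero]
    intro m _
    rw [Finsupp.single_apply]
    split_ifs with h
    · rw [h, hy]
    · rfl
  · rw [Finset.sum_eq_single_of_mem y (List.mem_toFinset.2 (h y hy)), Finsupp.single_eq_same]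
    exact fun m _ hne => Finsupp.single_eq_of_ne hne.symm

theorem Branches.exists_extends_corners (hr : ∀ i, 0 < r i) (b : Branches (Fin n) ℝ) (hb : b.Good)
    (s : ℝ) {μ : ℝ →₀ ℝ} (hμ : μ ∈ hull ((b.scale r).corners s)) : ∃ T, b.Extends r s μ T := by
  obtain ⟨hs, h0, hm⟩ := hμ
  obtain ⟨h1, h2, h3, h4, h5, h6⟩ := Branches.toLobe_spec (r := r) μ h0 b hb s
  have hsum := sum_single_eq ((b.scale r).nodup_corners (Branches.positive_scale hr b hb) s) hs
  have hp : (b.toLobe r μ s).perim = 1 := by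
    rw [h2, ← hm]
    conv_rhs => rw [← hsum]
    rw [map_list_sum, List.map_map]
    congr 2
    ext c
    simp
  refine ⟨.cons (Fin.last n) (b.toLobe r μ s) .nil, id, ?_, fun i => ?_, ?_, ?_, ?_⟩
  · rw [Branches.weaklyGood_cons]
    exact ⟨h1, hp, Branches.weaklyGood_nil⟩
  · simp [Branches.labels, h3, (Fin.castSucc_ne_last i).symm]
  · simp [Branches.labels, h4]
  · simpa [Branches.word] using h5
  · simpa [Branches.word, hsum] using h6

mutual

theorem Branches.exists_extends (hr : ∀ i, 0 < r i) : ∀ (b : Branches (Fin n) ℝ) (s : ℝ),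
    b.Good → ∀ μ : ℝ →₀ ℝ,
    ((∃ y ∈ Set.Icc s (s + (b.scale r).total), μ = Finsupp.single y 1) ∨
      ∃ C ∈ (b.scale r).corners s :: (b.scale r).nodeCorners s, μ ∈ hull C) →
    ∃ T, b.Extends r s μ T
  | .nil, s, h, μ, hμ => by
      refine Branches.exists_extends_corners hr _ h s ?_
      simp only [Branches.scale, Branches.total, add_zero, Set.Icc_self, Set.mem_singleton_iff,
        Branches.corners, Branches.nodeCorners, List.mem_cons, List.not_mem_nil, or_false] at hμ ⊢
      rcases hμ with ⟨y, rfl, rfl⟩ | ⟨C, rfl, h⟩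
      · refine ⟨fun z hz => ?_, fun z => ?_, by simp⟩
        · by_contra hne
          exact hz (Finsupp.single_eq_of_ne (by simpa using hne))
        · rw [Finsupp.single_apply]
          split_ifs <;> norm_num
      · exact h
  | .cons i v rest, s, h, μ, hμ => by
      rw [Branches.good_cons] at h
      have key : (∃ T, v.Extends r i s μ T) ∨
          (∃ T, rest.Extends r (s + (v.scale r (r i)).total) μ T) ∨
          μ ∈ hull (((Branches.cons i v rest).scale r).corners s) := by
        simp only [Branches.scale, Branches.total, Branches.nodeCorners, List.mem_cons,
          List.mem_append] at hμ ⊢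
        rcases hμ with ⟨y, hy, hy'⟩ | ⟨C, rfl | hC | hC, hμ⟩
        · rcases le_total y (s + (v.scale r (r i)).total) with hle | hle
          · exact Or.inl (Lobe.exists_extends hr i v s h.1 μ (Or.inl ⟨y, ⟨hy.1, hle⟩, hy'⟩))
          · exact Or.inr (Or.inl (Branches.exists_extends hr rest _ h.2.2 μ
              (Or.inl ⟨y, ⟨hle, by linarith [hy.2]⟩, hy'⟩)))
        · exact Or.inr (Or.inr hμ)
        · exact Or.inl (Lobe.exists_extends hr i v s h.1 μ (Or.inr ⟨C, hC, hμ⟩))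
        · exact Or.inr (Or.inl (Branches.exists_extends hr rest _ h.2.2 μ
            (Or.inr ⟨C, List.mem_cons_of_mem _ hC, hμ⟩)))
      have hcs : ∀ k, Fin.castSucc i = Fin.castSucc k ↔ i = k :=
        fun k => (Fin.castSucc_injective n).eq_iff
      rcases key with ⟨T, hT⟩ | ⟨T, hT⟩ | hμ
      · refine ⟨.cons i.castSucc T rest.lift, id, ?_, fun k => ?_, ?_, ?_, ?_⟩
        · rw [Branches.weaklyGood_cons]
          exact ⟨hT.weaklyGood, hT.perim.trans h.2.1, (Branches.good_lift _ h.2.2).weaklyGood⟩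
        · simp [Branches.labels, List.count_cons, hT.count, Branches.count_lift, hcs]
        · simp [Branches.labels, hT.count_last, Branches.count_last_lift,
            Fin.castSucc_ne_last]
        · rw [Branches.word, finSuccEquivLast_castSucc, Branches.word_lift]
          exact hT.sameBase.append (SameBase.refl _)
        · rw [Branches.word, finSuccEquivLast_castSucc, Branches.word_lift, mu_append, hT.mu_eq,
            mu_word_some, add_zero]
      · refine ⟨.cons i.castSucc v.lift T, id, ?_, fun k => ?_, ?_, ?_, ?_⟩
        · rw [Branches.weaklyGood_cons, Lobe.perim_lift]
          exact ⟨(Lobe.good_lift _ h.1).weaklyGood, h.2.1, hT.weaklyGood⟩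
        · simp [Branches.labels, List.count_cons, hT.count, Lobe.count_lift, hcs]
        · simp [Branches.labels, hT.count_last, Lobe.count_last_lift,
            Fin.castSucc_ne_last]
        · rw [Branches.word, finSuccEquivLast_castSucc, Lobe.word_lift]
          exact (SameBase.refl _).append hT.sameBase
        · rw [Branches.word, finSuccEquivLast_castSucc, Lobe.word_lift, mu_append,
            Lobe.baseLength_word, hT.mu_eq, mu_lobe_word_some, zero_add]
      · exact Branches.exists_extends_corners hr _ ((Branches.good_cons _ _ _).2 h) s hμ

theorem Lobe.exists_extends (hr : ∀ i, 0 < r i) (j : Fin n) : ∀ (v : Lobe (Fin n) ℝ) (s : ℝ),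
    v.Good → ∀ μ : ℝ →₀ ℝ,
    ((∃ y ∈ Set.Icc s (s + (v.scale r (r j)).total), μ = Finsupp.single y 1) ∨
      ∃ C ∈ (v.scale r (r j)).nodeCorners s, μ ∈ hull C) →
    ∃ T, v.Extends r j s μ T
  | .close x, s, h, μ, hμ => by
      simp only [Lobe.scale, Lobe.total, Lobe.nodeCorners, List.not_mem_nil, false_and,
        exists_const, or_false] at hμ
      obtain ⟨y, hy, rfl⟩ := hμ
      have hj := hr j
      have h1 : 0 ≤ (y - s) / r j := div_nonneg (by linarith [hy.1]) hj.le
      have h2 : (y - s) / r j ≤ x := by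
        rw [div_le_iff₀ hj]
        linarith [hy.2]
      have h3 : s + r j * ((y - s) / r j) = y := by field_simp; ring
      refine ⟨.arc ((y - s) / r j) (leaf n) (.close (x - (y - s) / r j)), ?_, ?_, fun i => ?_, ?_,
        ?_, ?_⟩
      · simp only [leaf, Lobe.weaklyGood_arc, Branches.weaklyGood_cons, Lobe.weaklyGood_close,
          Branches.weaklyGood_nil, Branches.IsNil, Lobe.perim]
        exact ⟨h1, id, ⟨zero_le_one, trivial, trivial⟩, by linarith⟩
      · simp [Lobe.perim]
      · simp [leaf, Lobe.labels, Branches.labels, (Fin.castSucc_ne_last i).symm]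
      · simp [leaf, Lobe.labels, Branches.labels]
      · simp only [leaf, Lobe.word, Branches.word, finSuccEquivLast_last, List.append_nil,
          List.cons_append, List.nil_append]
        refine (((SameBase.refl _).cons_none _).cons _).trans ?_
        refine (sameBase_merge h1 (by linarith) _ []).symm.trans ?_
        rw [add_sub_cancel]
        exact SameBase.refl _
      · simp [leaf, Lobe.word, Branches.word, mu, h3]
  | .arc x b rest, s, h, μ, hμ => by
      rw [Lobe.good_arc] at h
      have key : (∃ y ∈ Set.Icc s (s + r j * x), μ = Finsupp.single y 1) ∨
          (∃ T, b.Extends r (s + r j * x) μ T) ∨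
          ∃ T, rest.Extends r j (s + r j * x + (b.scale r).total) μ T := by
        simp only [Lobe.scale, Lobe.total, Lobe.nodeCorners, List.mem_cons,
          List.mem_append] at hμ
        rcases hμ with ⟨y, hy, hy'⟩ | ⟨C, hC | hC | hC, hμ⟩
        · rcases le_total y (s + r j * x) with hle | hle
          · exact Or.inl ⟨y, ⟨hy.1, hle⟩, hy'⟩
          · rcases le_total y (s + r j * x + (b.scale r).total) with hle' | hle'
            · exact Or.inr (Or.inl (Branches.exists_extends hr b _ h.2.2.1 μ
                (Or.inl ⟨y, ⟨hle, hle'⟩, hy'⟩)))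
            · exact Or.inr (Or.inr (Lobe.exists_extends hr j rest _ h.2.2.2 μ
                (Or.inl ⟨y, ⟨hle', by linarith [hy.2]⟩, hy'⟩)))
        · exact Or.inr (Or.inl (Branches.exists_extends hr b _ h.2.2.1 μ
            (Or.inr ⟨C, hC ▸ List.mem_cons_self, hμ⟩)))
        · exact Or.inr (Or.inl (Branches.exists_extends hr b _ h.2.2.1 μ
            (Or.inr ⟨C, List.mem_cons_of_mem _ hC, hμ⟩)))
        · exact Or.inr (Or.inr (Lobe.exists_extends hr j rest _ h.2.2.2 μ
            (Or.inr ⟨C, hC, hμ⟩)))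
      rcases key with ⟨y, hy, rfl⟩ | ⟨T, hT⟩ | ⟨T, hT⟩
      · have hj := hr j
        have h1 : 0 ≤ (y - s) / r j := div_nonneg (by linarith [hy.1]) hj.le
        have h2 : (y - s) / r j ≤ x := by
          rw [div_le_iff₀ hj]
          linarith [hy.2]
        have h3 : s + r j * ((y - s) / r j) = y := by field_simp; ring
        refine ⟨.arc ((y - s) / r j) (leaf n) (.arc (x - (y - s) / r j) b.lift rest.lift),
          ?_, ?_, fun i => ?_, ?_, ?_, ?_⟩
        · simp only [leaf, Lobe.weaklyGood_arc, Branches.weaklyGood_cons, Lobe.weaklyGood_close,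
            Branches.weaklyGood_nil, Branches.isNil_lift, Lobe.perim]
          exact ⟨h1, id, ⟨zero_le_one, trivial, trivial⟩, by linarith, h.2.1,
            (Branches.good_lift _ h.2.2.1).weaklyGood, (Lobe.good_lift _ h.2.2.2).weaklyGood⟩
        · simp only [Lobe.perim, Lobe.perim_lift]
          ring
        · simp [leaf, Lobe.labels, Branches.labels, (Fin.castSucc_ne_last i).symm,
            Branches.count_lift, Lobe.count_lift]
        · simp [leaf, Lobe.labels, Branches.labels, Branches.count_last_lift,
            Lobe.count_last_lift]
        · simp only [leaf, Lobe.word, Branches.word, finSuccEquivLast_last, List.append_nil,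
            List.cons_append, List.nil_append, Branches.word_lift, Lobe.word_lift]
          refine (((SameBase.refl _).cons_none _).cons _).trans ?_
          refine (sameBase_merge h1 (by linarith) _ _).symm.trans ?_
          rw [add_sub_cancel]
          exact SameBase.refl _
        · simp [leaf, Lobe.word, Branches.word, mu, h3, Branches.word_lift, Lobe.word_lift,
            mu_append, mu_word_some, mu_lobe_word_some]
      · refine ⟨.arc x T rest.lift, ?_, ?_, fun i => ?_, ?_, ?_, ?_⟩
        · rw [Lobe.weaklyGood_arc]
          exact ⟨h.1.le, hT.not_isNil, hT.weaklyGood, (Lobe.good_lift _ h.2.2.2).weaklyGood⟩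
        · simp [Lobe.perim, Lobe.perim_lift]
        · simp [Lobe.labels, hT.count, Lobe.count_lift]
        · simp [Lobe.labels, hT.count_last, Lobe.count_last_lift]
        · rw [Lobe.word, Lobe.word_lift]
          exact (hT.sameBase.append (SameBase.refl _)).cons _
        · rw [Lobe.word, Lobe.word_lift, mu, mu_append, hT.mu_eq, mu_lobe_word_some, add_zero]
      · refine ⟨.arc x b.lift T, ?_, ?_, fun i => ?_, ?_, ?_, ?_⟩
        · rw [Lobe.weaklyGood_arc, Branches.isNil_lift]
          exact ⟨h.1.le, h.2.1, (Branches.good_lift _ h.2.2.1).weaklyGood, hT.weaklyGood⟩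
        · simp [Lobe.perim, hT.perim]
        · simp [Lobe.labels, hT.count, Branches.count_lift]
        · simp [Lobe.labels, hT.count_last, Branches.count_last_lift]
        · rw [Lobe.word, Branches.word_lift]
          exact ((SameBase.refl _).append hT.sameBase).cons _
        · rw [Lobe.word, Branches.word_lift, mu, mu_append, Branches.baseLength_word, hT.mu_eq,
            mu_word_some, zero_add]

end

end Insert

/-! ### The fibres -/

section Fibres

variable {n : ℕ}

theorem exists_mem_fibre {r : Fin n → ℝ} (hr : ∀ i, 0 < r i) (c : NCact n) {μ : ℝ →₀ ℝ}
    (hμ : μ ∈ (c.1.scale r).chordMeasures) :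
    ∃ c' : NCact (n + 1), forgetLobe' c' = c ∧ mu r (c'.1.word finSuccEquivLast) 0 = μ := by
  obtain ⟨T, hT⟩ := Branches.exists_extends hr c.1 0 c.2.good μ (by rwa [zero_add])
  obtain ⟨h1, h2, h3⟩ := hT.weaklyGood
  obtain ⟨g, -, hc⟩ := Branches.collapse_spec T h1 h2 h3
  have hcact : IsCactus T.collapse := ⟨fun i => by
    rw [hc]
    induction i using Fin.lastCases with
    | last => exact hT.count_last
    | cast i => rw [hT.count, c.2.count_labels], g.1, g.2.1, g.2.2⟩
  refine ⟨⟨T.collapse, hcact⟩, (forgetLobe'_eq_iff (⟨T.collapse, hcact⟩ : NCact (n + 1)) c).2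
    fun i u => ?_, ?_⟩
  · change phi i (T.collapse.word finSuccEquivLast) u = _
    rw [Branches.word_collapse, (sameBase_dropZeros _).2, hT.sameBase.2]
  · change mu r (T.collapse.word finSuccEquivLast) 0 = _
    rw [Branches.word_collapse, mu_dropZeros, hT.mu_eq]

instance compactSpace_fibre (c : NCact n) : CompactSpace (Fibre forgetLobe' c) := by
  refine isCompact_iff_compactSpace.1 (IsClosed.isCompact (s := {c' | forgetLobe' c' = c}) ?_)
  have : {c' | forgetLobe' c' = c} = ⋂ (i : Fin n) (u : ℝ), {c' : NCact (n + 1) |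
      phi i (c'.1.word finSuccEquivLast) u = phi i (c.1.word some) u} := by
    ext c'
    simp only [Set.mem_iInter]
    exact forgetLobe'_eq_iff c' c
  rw [this]
  exact isClosed_iInter fun i => isClosed_iInter fun u =>
    isClosed_eq (NCact.continuous_phi_word _ _ _) continuous_const

theorem nonempty_fibre_homeomorph {r : Fin n → ℝ} (hr : ∀ i, 0 < r i) (c : NCact n) :
    Nonempty (Fibre forgetLobe' c ≃ₜ (c.1.scale r).chordMeasures) := by
  let F : Fibre forgetLobe' c → (ℝ →₀ ℝ) := fun c' => mu r (c'.1.1.word finSuccEquivLast) 0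
  have hF : Continuous F := (NCact.continuous_mu_word r _).comp continuous_subtype_val
  have hI : Function.Injective F := by
    rintro ⟨c₁, h₁⟩ ⟨c₂, h₂⟩ h
    refine Subtype.ext (Subtype.ext (IsCactus.ext c₁.2 c₂.2 finSuccEquivLast.injective hr h ?_))
    intro i u
    rw [(forgetLobe'_eq_iff _ _).1 h₁, (forgetLobe'_eq_iff _ _).1 h₂]
  have hR : Set.range F = (c.1.scale r).chordMeasures := by
    ext μ
    constructor
    · rintro ⟨⟨c', rfl⟩, rfl⟩
      exact mu_word_mem_chordMeasures hr c'
    · intro hμ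
      obtain ⟨c', h, h'⟩ := exists_mem_fibre hr c hμ
      exact ⟨⟨c', h⟩, h'⟩
  exact ⟨(hF.isClosedEmbedding hI).isEmbedding.toHomeomorph.trans (Homeomorph.setCongr hR)⟩

/-- The fibres of `p` are the fibres of `p'` times the possible lengths of the last lobe. -/
def fibreHomeomorph (c : Cact n) : Fibre forgetLobe c ≃ₜ Fibre forgetLobe' c.1 × Set.Ioi (0 : ℝ) where
  toFun x := (⟨x.1.1, congrArg Prod.fst x.2⟩, x.1.2 (Fin.last n))
  invFun y := ⟨(y.1.1, Fin.snoc (α := fun _ => Set.Ioi (0 : ℝ)) c.2 y.2),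
    Prod.ext y.1.2 (by funext i; simp [forgetLobe])⟩
  left_inv := by
    rintro ⟨⟨c', ρ⟩, rfl⟩
    refine Subtype.ext (Prod.ext rfl ?_)
    exact Fin.snoc_init_self ρ
  right_inv := by
    rintro ⟨⟨c', h⟩, ρ⟩
    simp
  continuous_toFun := by fun_prop
  continuous_invFun := by
    refine Continuous.subtype_mk (Continuous.prodMk (by fun_prop) ?_) _
    exact Continuous.finSnoc continuous_const continuous_snd

theorem Branches.scale_one {ι : Type} (t : Branches ι ℝ) : t.scale (fun _ => 1) = t := by
  refine Branches.rec (motive_1 := fun b => b.scale (fun _ => 1) = b)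
    (motive_2 := fun v => v.scale (fun _ => 1) 1 = v) rfl ?_ ?_ ?_ t
  · intro i v rest h h'
    rw [Branches.scale, h, h']
  · intro x
    rw [Lobe.scale, one_mul]
  · intro x b rest h h'
    rw [Lobe.scale, h, h', one_mul]

theorem metricTree_positive (c : Cact n) : (metricTree c).Positive :=
  Branches.positive_scale (fun i => (c.2 i).2) _ c.1.2.good

theorem metricTree_toCact (c : NCact n) : metricTree c.toCact = c.1 := Branches.scale_one _

theorem nonempty_fibre_homeomorph_diagram (c : Cact n) :
    Nonempty (Fibre forgetLobe' c.1 ≃ₜ (metricTree c).CompletedChordDiagram) := by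
  obtain ⟨e⟩ := nonempty_fibre_homeomorph (fun i => (c.2 i).2) c.1
  obtain ⟨e'⟩ := Branches.nonempty_diagram_homeomorph (metricTree_positive c)
  exact ⟨e.trans e'.symm⟩

end Fibres

end Cacti

namespace Cacti

open scoped unitInterval

/-! ### The chord measures form a bouquet up to homotopy -/

/-- A point, regarded as a measure. -/
noncomputable abbrev dirac (y : ℝ) : ℝ →₀ ℝ := Finsupp.single y 1

theorem eq_of_dirac_ne_zero {y z : ℝ} (h : dirac y z ≠ 0) : z = y := by
  by_contra hne
  exact h (Finsupp.single_eq_of_ne hne)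

theorem dirac_self_ne_zero (y : ℝ) : dirac y y ≠ 0 := by simp

theorem dirac_mem_hull {C : List ℝ} {c : ℝ} (hc : c ∈ C) : dirac c ∈ hull C := by
  refine ⟨fun y hy => eq_of_dirac_ne_zero hy ▸ hc, fun y => ?_, by simp⟩
  rw [Finsupp.single_apply]
  split_ifs <;> norm_num

theorem exists_ne_zero_of_mem_hull {C : List ℝ} {μ : ℝ →₀ ℝ} (h : μ ∈ hull C) :
    ∃ y ∈ C, μ y ≠ 0 := by
  have : μ ≠ 0 := by
    rintro rfl
    simpa using h.2.2
  obtain ⟨y, hy⟩ := Finsupp.ne_iff.1 this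
  exact ⟨y, h.1 y hy, hy⟩

theorem isCompact_hull (C : List ℝ) : IsCompact (hull C) := by
  classical
  let F : (C.toFinset → ℝ) → (ℝ →₀ ℝ) := fun w => ∑ c : C.toFinset, Finsupp.single (c : ℝ) (w c)
  have hF : Continuous F := by
    refine continuous_measure_iff.2 fun h => ?_
    simp only [F, map_sum, pairing_single]
    exact continuous_finsetSum _ fun c _ => (continuous_apply c).mul continuous_const
  have hFa : ∀ w (c : C.toFinset), F w c = w c := by
    intro w c
    simp only [F, Finsupp.finsetSum_apply, Finsupp.single_apply]
    rw [Finset.sum_eq_single c]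
    · simp
    · intro d _ hd
      rw [if_neg fun h => hd (Subtype.ext h)]
    · simp
  have hFp : ∀ w, pairing (fun _ => 1) (F w) = ∑ c : C.toFinset, w c := by
    intro w
    simp [F, map_sum]
  have hF0 : ∀ w y, F w y ≠ 0 → y ∈ C := by
    intro w y hy
    simp only [F, Finsupp.finsetSum_apply] at hy
    obtain ⟨c, -, hc⟩ := Finset.exists_ne_zero_of_sum_ne_zero hy
    have : y = c := by
      by_contra hne
      exact hc (Finsupp.single_eq_of_ne hne)
    rw [this]
    exact List.mem_toFinset.1 c.2
  have : hull C = F '' stdSimplex ℝ C.toFinset := by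
    ext μ
    constructor
    · rintro ⟨h1, h2, h3⟩
      have hμ : F (fun c => μ c) = μ := by
        ext y
        by_cases hy : y ∈ C
        · exact hFa (fun c => μ c) ⟨y, List.mem_toFinset.2 hy⟩
        · rw [not_imp_comm.1 (h1 y) hy, not_imp_comm.1 (hF0 _ y) hy]
      exact ⟨fun c => μ c, ⟨fun c => h2 c, by rw [← hFp, hμ, h3]⟩, hμ⟩
    · rintro ⟨w, hw, rfl⟩
      refine ⟨hF0 w, fun y => ?_, by rw [hFp]; exact hw.2⟩
      by_cases hy : y ∈ C
      · exact (hFa w ⟨y, List.mem_toFinset.2 hy⟩).symm ▸ hw.1 _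
      · rw [not_imp_comm.1 (hF0 w y) hy]
  rw [this]
  exact (isCompact_stdSimplex ℝ C.toFinset).image hF

theorem strongContractible_hull {C : List ℝ} {c : ℝ} (hc : c ∈ C) :
    StrongContractible (hull C) (dirac c) := by
  have hd := dirac_mem_hull hc
  have mem : ∀ (t : I) (μ : hull C),
      (1 - (t : ℝ)) • (μ : ℝ →₀ ℝ) + (t : ℝ) • dirac c ∈ hull C := by
    rintro t ⟨μ, h1, h2, h3⟩
    refine ⟨fun y hy => ?_, fun y => ?_, ?_⟩
    · by_contra hyC
      refine hy ?_
      rw [Finsupp.add_apply, Finsupp.smul_apply, Finsupp.smul_apply, not_imp_comm.1 (h1 y) hyC,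
        not_imp_comm.1 (hd.1 y) hyC]
      simp
    · exact add_nonneg (mul_nonneg (by linarith [t.2.2]) (h2 y)) (mul_nonneg t.2.1 (hd.2.1 y))
    · rw [map_add, map_smul, map_smul, h3, hd.2.2]
      simp
  refine ⟨hd, ⟨fun z => ⟨_, mem z.1 z.2⟩, ?_⟩, fun x => ?_, fun x => ?_, fun t => ?_⟩
  · refine Continuous.subtype_mk (continuous_measure_iff.2 fun h => ?_) _
    have := continuous_pairing h
    simp only [map_add, map_smul, smul_eq_mul]
    fun_prop
  · ext1; simp
  · ext1; simp
  · ext1; simp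

/-- The points of an interval. -/
def diracs (s e : ℝ) : Set (ℝ →₀ ℝ) := {μ | ∃ y ∈ Set.Icc s e, μ = dirac y}

theorem isCompact_diracs (s e : ℝ) : IsCompact (diracs s e) := by
  have : diracs s e = dirac '' Set.Icc s e := by
    ext μ
    simp only [diracs, Set.mem_image, eq_comm]
    rfl
  rw [this]
  exact isCompact_Icc.image continuous_single

theorem strongContractible_diracs {s e : ℝ} (h : s ≤ e) :
    StrongContractible (diracs s e) (dirac s) := by
  have mem : ∀ (t : I) (μ : diracs s e),
      dirac (s + (1 - t) * (pairing (ContinuousMap.id ℝ) μ - s)) ∈ diracs s e := by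
    rintro t ⟨_, y, hy, rfl⟩
    refine ⟨_, ⟨?_, ?_⟩, rfl⟩ <;>
    simp only [pairing_single, ContinuousMap.id_apply, one_mul]
    · nlinarith [t.2.2, hy.1]
    · nlinarith [t.2.1, hy.1, hy.2]
  refine ⟨⟨s, ⟨le_rfl, h⟩, rfl⟩, ⟨fun z => ⟨_, mem z.1 z.2⟩, ?_⟩, ?_, fun x => ?_, fun t => ?_⟩
  · have := continuous_pairing (ContinuousMap.id ℝ)
    refine Continuous.subtype_mk (continuous_single.comp ?_) _
    fun_prop
  · rintro ⟨_, y, hy, rfl⟩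
    ext1; simp
  · ext1; simp
  · ext1; simp

section Trace

variable {ι : Type}

/-- The measures that belong to the branches, with the outside circle starting at `s`. -/
def Branches.trace (s : ℝ) (b : Branches ι ℝ) : Set (ℝ →₀ ℝ) :=
  diracs s (s + b.total) ∪ {μ | ∃ C ∈ b.nodeCorners s, μ ∈ hull C}

/-- See `Branches.trace`. -/
def Lobe.trace (s : ℝ) (v : Lobe ι ℝ) : Set (ℝ →₀ ℝ) :=
  diracs s (s + v.total) ∪ {μ | ∃ C ∈ v.nodeCorners s, μ ∈ hull C}

theorem Branches.mem_Icc_of_mem_trace {b : Branches ι ℝ} (hb : b.Positive) {s : ℝ} {μ : ℝ →₀ ℝ}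
    (h : μ ∈ b.trace s) {y : ℝ} (hy : μ y ≠ 0) : y ∈ Set.Icc s (s + b.total) := by
  rcases h with ⟨z, hz, rfl⟩ | ⟨C, hC, hμ⟩
  · rwa [eq_of_dirac_ne_zero hy]
  · exact Set.Ioo_subset_Icc_self (b.nodeCorners_mem_Ioo s hb C hC y (hμ.1 y hy)).1

theorem Lobe.mem_Icc_of_mem_trace {v : Lobe ι ℝ} (hv : v.Positive) {s : ℝ} {μ : ℝ →₀ ℝ}
    (h : μ ∈ v.trace s) {y : ℝ} (hy : μ y ≠ 0) : y ∈ Set.Icc s (s + v.total) := by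
  rcases h with ⟨z, hz, rfl⟩ | ⟨C, hC, hμ⟩
  · rwa [eq_of_dirac_ne_zero hy]
  · exact Set.Ioo_subset_Icc_self (v.nodeCorners_mem_Ioo s hv C hC y (hμ.1 y hy))

theorem diracs_union {s m e : ℝ} (h : s ≤ m) (h' : m ≤ e) :
    diracs s e = diracs s m ∪ diracs m e := by
  ext μ
  constructor
  · rintro ⟨y, hy, rfl⟩
    rcases le_total y m with hm | hm
    · exact Or.inl ⟨y, ⟨hy.1, hm⟩, rfl⟩
    · exact Or.inr ⟨y, ⟨hm, hy.2⟩, rfl⟩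
  · rintro (⟨y, hy, rfl⟩ | ⟨y, hy, rfl⟩)
    · exact ⟨y, ⟨hy.1, hy.2.trans h'⟩, rfl⟩
    · exact ⟨y, ⟨h.trans hy.1, hy.2⟩, rfl⟩

theorem Branches.trace_cons (i : ι) {v : Lobe ι ℝ} {rest : Branches ι ℝ} (hv : v.Positive)
    (hr : rest.Positive) (s : ℝ) :
    (Branches.cons i v rest).trace s = v.trace s ∪ rest.trace (s + v.total) := by
  have h1 := Lobe.total_pos v hv
  have h2 := Branches.total_nonneg rest hr
  simp only [Branches.trace, Lobe.trace, Branches.total, Branches.nodeCorners]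
  rw [diracs_union (m := s + v.total) (by linarith) (by linarith), add_assoc]
  ext μ
  simp only [Set.mem_union, Set.mem_ofPred_eq, List.mem_append, or_and_right, exists_or]
  grind

theorem Lobe.trace_arc {x : ℝ} {b : Branches ι ℝ} {rest : Lobe ι ℝ} (hx : 0 < x)
    (hb : b.Positive) (hr : rest.Positive) (s : ℝ) :
    (Lobe.arc x b rest).trace s = diracs s (s + x) ∪ hull (b.corners (s + x)) ∪
      b.trace (s + x) ∪ rest.trace (s + x + b.total) := by
  have h1 := Lobe.total_pos rest hr
  have h2 := Branches.total_nonneg b hb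
  simp only [Branches.trace, Lobe.trace, Lobe.total, Lobe.nodeCorners]
  rw [diracs_union (m := s + x) (by linarith) (by linarith),
    diracs_union (s := s + x) (m := s + x + b.total) (by linarith) (by linarith)]
  have e : s + (x + (b.total + rest.total)) = s + x + b.total + rest.total := by ring
  rw [e]
  ext μ
  simp only [Set.mem_union, Set.mem_ofPred_eq, List.mem_append, List.mem_cons, or_and_right,
    exists_or, exists_eq_left]
  grind

mutual

theorem Branches.isBouquetLike_union_trace {a₀ : ℝ →₀ ℝ} : ∀ (b : Branches ι ℝ) (s : ℝ),
    b.Positive → ∀ (A : Set (ℝ →₀ ℝ)) (m : ℕ), IsBouquetLike a₀ A m →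
    (∀ c ∈ b.corners s, dirac c ∈ A) →
    (∀ μ ∈ A, ∀ y ∈ Set.Icc s (s + b.total), μ y ≠ 0 → y ∈ b.corners s) →
    IsBouquetLike a₀ (A ∪ b.trace s) (m + b.labels.length)
  | .nil, s, _, A, m, hA, hc, _ => by
      have : A ∪ (Branches.nil : Branches ι ℝ).trace s = A := by
        refine Set.union_eq_left.2 ?_
        rintro μ (⟨y, hy, rfl⟩ | ⟨C, hC, -⟩)
        · simp only [Branches.total, add_zero, Set.Icc_self, Set.mem_singleton_iff] at hy
          exact hc y (by simp [Branches.corners, hy])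
        · simp [Branches.nodeCorners] at hC
      rw [this]
      exact hA
  | .cons i v rest, s, h, A, m, hA, hc, hs => by
      rw [Branches.positive_cons] at h
      have h1 := Lobe.total_pos v h.1
      have h2 := Branches.total_nonneg rest h.2
      rw [Branches.trace_cons i h.1 h.2, ← Set.union_assoc]
      simp only [Branches.corners, Branches.total, List.mem_cons] at hc hs
      have key := Lobe.isBouquetLike_union_trace v s h.1 A m hA (hc _ (Or.inl rfl))
        (hc _ (Or.inr (rest.start_mem_corners _))) fun μ hμ y hy hyI => by
          rcases hs μ hμ y ⟨hyI.1.le, by linarith [hyI.2]⟩ hy with rfl | hy'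
          · exact lt_irrefl _ hyI.1
          · linarith [(rest.corners_mem_Icc h.2 _ y hy').1, hyI.2]
      have := Branches.isBouquetLike_union_trace rest (s + v.total) h.2 _ _ key
        (fun c hc' => Or.inl (hc c (Or.inr hc'))) fun μ hμ y hyI hy => by
          rcases hμ with hμ | hμ
          · exact (hs μ hμ y ⟨by linarith [hyI.1], by linarith [hyI.2]⟩ hy).resolve_left
              fun hy' => by linarith [hyI.1]
          · have := (Lobe.mem_Icc_of_mem_trace h.1 hμ hy).2
            rw [le_antisymm this hyI.1]
            exact rest.start_mem_corners _
      convert this using 1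
      simp only [Branches.labels, List.length_cons, List.length_append]
      omega

theorem Lobe.isBouquetLike_union_trace {a₀ : ℝ →₀ ℝ} : ∀ (v : Lobe ι ℝ) (s : ℝ),
    v.Positive → ∀ (A : Set (ℝ →₀ ℝ)) (m : ℕ), IsBouquetLike a₀ A m →
    dirac s ∈ A → dirac (s + v.total) ∈ A →
    (∀ μ ∈ A, ∀ y, μ y ≠ 0 → y ∉ Set.Ioo s (s + v.total)) →
    IsBouquetLike a₀ (A ∪ v.trace s) (m + v.labels.length + 1)
  | .close x, s, h, A, m, hA, h0, h1, hs => by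
      rw [Lobe.positive_close] at h
      simp only [Lobe.total] at h1 hs
      have hinj : ∀ y z, dirac y = dirac z → y = z := fun y z e =>
        Finsupp.single_left_injective one_ne_zero e
      let p : C(I, ℝ →₀ ℝ) := ⟨fun t => dirac (s + t * x), continuous_single.comp (by fun_prop)⟩
      have hp : Set.range p = (Lobe.close x : Lobe ι ℝ).trace s := by
        ext μ
        simp only [Lobe.trace, Lobe.total, Lobe.nodeCorners, List.not_mem_nil, false_and,
          exists_false, Set.ofPred_false, Set.union_empty]
        constructor
        · rintro ⟨t, rfl⟩
          exact ⟨s + t * x, ⟨by nlinarith [t.2.1], by nlinarith [t.2.2]⟩, rfl⟩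
        · rintro ⟨y, hy, rfl⟩
          refine ⟨⟨(y - s) / x, div_nonneg (by linarith [hy.1]) h.le,
            (div_le_one h).2 (by linarith [hy.2])⟩, ?_⟩
          simp only [p, ContinuousMap.coe_mk]
          congr 1
          field_simp
          ring
      rw [← hp]
      refine hA.loop p (by simpa [p] using h0) (by simpa [p] using h1) (fun t ht => ?_)
        fun t t' e => ?_
      · have := hs _ ht _ (dirac_self_ne_zero _)
        by_contra hne
        push Not at hne
        have ht0 : (0 : ℝ) < t := lt_of_le_of_ne t.2.1 fun e => hne.1 (Subtype.ext e.symm)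
        have ht1 : (t : ℝ) < 1 := lt_of_le_of_ne t.2.2 fun e => hne.2 (Subtype.ext e)
        exact this ⟨by nlinarith, by nlinarith⟩
      · have := hinj _ _ e
        exact Or.inl (Subtype.ext (mul_right_cancel₀ h.ne' (add_left_cancel this)))
  | .arc x b rest, s, h, A, m, hA, h0, h1, hs => by
      rw [Lobe.positive_arc] at h
      obtain ⟨hx, -, hb, hr⟩ := h
      have t1 := Branches.total_nonneg b hb
      have t2 := Lobe.total_pos rest hr
      simp only [Lobe.total] at h1 hs
      have e : s + (x + (b.total + rest.total)) = s + x + b.total + rest.total := by ring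
      rw [e] at h1 hs
      have k1 := hA.wedge (isCompact_diracs s (s + x)) (strongContractible_diracs (by linarith)) h0
        (by
          rintro _ hμ ⟨y, hy, rfl⟩
          have := hs _ hμ y (dirac_self_ne_zero _)
          by_contra hne
          exact this ⟨lt_of_le_of_ne hy.1 fun e => hne (e ▸ rfl), by linarith [hy.2]⟩)
      have k2 := k1.wedge (isCompact_hull (b.corners (s + x)))
        (strongContractible_hull (b.start_mem_corners _))
        (Or.inr ⟨_, ⟨by linarith, le_rfl⟩, rfl⟩) (by
          rintro μ (hμ | ⟨y, hy, rfl⟩) hμ'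
          · obtain ⟨y, hy, hy'⟩ := exists_ne_zero_of_mem_hull hμ'
            have := b.corners_mem_Icc hb _ y hy
            exact (hs μ hμ y hy' ⟨by linarith [this.1], by linarith [this.2]⟩).elim
          · have := b.corners_mem_Icc hb _ y (hμ'.1 y (dirac_self_ne_zero y))
            rw [le_antisymm hy.2 this.1])
      have k3 := Branches.isBouquetLike_union_trace b (s + x) hb _ _ k2
        (fun c hc => Or.inr (dirac_mem_hull hc)) (by
          rintro μ ((hμ | ⟨z, hz, rfl⟩) | hμ) y hyI hy
          · exact (hs μ hμ y hy ⟨by linarith [hyI.1], by linarith [hyI.2]⟩).elim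
          · obtain rfl := eq_of_dirac_ne_zero hy
            rw [le_antisymm hz.2 hyI.1]
            exact b.start_mem_corners _
          · exact hμ.1 y hy)
      have k4 := Lobe.isBouquetLike_union_trace rest (s + x + b.total) hr _ _ k3
        (Or.inl (Or.inr (dirac_mem_hull (b.end_mem_corners _)))) (Or.inl (Or.inl (Or.inl h1))) (by
          rintro μ (((hμ | ⟨z, hz, rfl⟩) | hμ) | hμ) y hy hyI
          · exact hs μ hμ y hy ⟨by linarith [hyI.1], hyI.2⟩
          · obtain rfl := eq_of_dirac_ne_zero hy
            linarith [hz.2, hyI.1]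
          · linarith [(b.corners_mem_Icc hb _ y (hμ.1 y hy)).2, hyI.1]
          · linarith [(Branches.mem_Icc_of_mem_trace hb hμ hy).2, hyI.1])
      rw [Lobe.trace_arc hx hb hr]
      convert k4 using 1
      · simp only [Set.union_assoc]
      · simp only [Lobe.labels, List.length_append]
        omega

end

theorem Branches.isBouquetLike_chordMeasures {t : Branches ι ℝ} (ht : t.Positive) :
    IsBouquetLike (dirac 0) t.chordMeasures t.labels.length := by
  have h1 := (IsBouquetLike.singleton (dirac 0)).wedge (isCompact_hull (t.corners 0))
    (strongContractible_hull (t.start_mem_corners 0)) rfl fun x hx _ => hx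
  have h2 := Branches.isBouquetLike_union_trace t 0 ht _ _ h1
    (fun c hc => Or.inr (dirac_mem_hull hc)) (by
      rintro μ (rfl | hμ) y - hy
      · rw [eq_of_dirac_ne_zero hy]
        exact t.start_mem_corners 0
      · exact hμ.1 y hy)
  have e : {dirac 0} ∪ hull (t.corners 0) ∪ t.trace 0 = t.chordMeasures := by
    ext μ
    simp only [Branches.chordMeasures, Branches.trace, Branches.allCorners, List.mem_cons,
      zero_add, Set.mem_union, Set.mem_ofPred_eq, Set.mem_singleton_iff, or_and_right, exists_or,
      exists_eq_left]
    constructor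
    · rintro ((rfl | h) | h | h)
      · exact Or.inl ⟨0, ⟨le_rfl, t.total_nonneg ht⟩, rfl⟩
      · exact Or.inr (Or.inl h)
      · exact Or.inl h
      · exact Or.inr (Or.inr h)
    · rintro (h | h | h)
      · exact Or.inr (Or.inl h)
      · exact Or.inl (Or.inr h)
      · exact Or.inr (Or.inr h)
  rwa [e, zero_add] at h2

end Trace

end Cacti

namespace Cacti

open scoped unitInterval

/-! ### Circles attached one after the other -/

section Circles

variable {ι : Type} {X : Type} [TopologicalSpace X] [T2Space X]

theorem eq_or_eq_of_coe_mul_eq {a : ℝ} (ha : 0 < a) {s t : I}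
    (h : ((s * a : ℝ) : AddCircle a) = ((t * a : ℝ) : AddCircle a)) : s = t ∨ s = 0 ∨ s = 1 := by
  rw [← sub_eq_zero, ← AddCircle.coe_sub, AddCircle.coe_eq_zero_iff] at h
  obtain ⟨k, hk⟩ := h
  have hk' : (k : ℝ) = s - t := by
    rw [zsmul_eq_mul] at hk
    refine mul_right_cancel₀ ha.ne' ?_
    rw [hk]
    ring
  have h1 : k ≤ 1 := by
    have : (k : ℝ) ≤ 1 := by linarith [s.2.2, t.2.1]
    exact_mod_cast this
  have h2 : -1 ≤ k := by
    have : (-1 : ℝ) ≤ k := by linarith [s.2.1, t.2.2]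
    exact_mod_cast this
  have h3 : k = -1 ∨ k = 0 ∨ k = 1 := by omega
  rcases h3 with rfl | rfl | rfl <;> push_cast at hk'
  · exact Or.inr (Or.inl (Subtype.ext (by
      change (s : ℝ) = 0
      linarith [s.2.1, t.2.2])))
  · exact Or.inl (Subtype.ext (by linarith))
  · exact Or.inr (Or.inr (Subtype.ext (by
      change (s : ℝ) = 1
      linarith [s.2.2, t.2.1])))

/-- A circle that meets a bouquet exactly in its base point. -/
theorem IsBouquetLike.circle {a₀ : X} {A : Set X} {m : ℕ} (h : IsBouquetLike a₀ A m) {a : ℝ}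
    (ha : 0 < a) {γ : AddCircle a → X} (hc : Continuous γ) (hi : Function.Injective γ)
    (h0 : γ 0 ∈ A) (hA : ∀ u, γ u ∈ A → u = 0) :
    IsBouquetLike a₀ (A ∪ Set.range γ) (m + 1) := by
  let p : C(I, X) := ⟨fun t => γ ((t * a : ℝ) : AddCircle a),
    hc.comp ((AddCircle.continuous_mk' a).comp (by fun_prop))⟩
  have hp : Set.range p = Set.range γ := by
    refine Set.Subset.antisymm (by rintro _ ⟨t, rfl⟩; exact ⟨_, rfl⟩) ?_
    rintro _ ⟨u, rfl⟩
    have : Fact (0 < a) := ⟨ha⟩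
    have hu : u ∈ ((↑) : ℝ → AddCircle a) '' Set.Icc 0 (0 + a) := by
      rw [AddCircle.coe_image_Icc_eq]
      trivial
    obtain ⟨y, hy, rfl⟩ := hu
    refine ⟨⟨y / a, div_nonneg hy.1 ha.le, (div_le_one ha).2 (by linarith [hy.2])⟩, ?_⟩
    simp only [p, ContinuousMap.coe_mk]
    rw [div_mul_cancel₀ _ ha.ne']
  rw [← hp]
  refine h.loop p (by simpa [p] using h0) (by simpa [p, AddCircle.coe_period] using h0) (fun t ht => ?_) fun s t e => ?_
  · have ht' : ((t * a : ℝ) : AddCircle a) = (((0 : I) * a : ℝ) : AddCircle a) := by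
      simpa using hA _ ht
    rcases eq_or_eq_of_coe_mul_eq ha ht' with h | h
    · exact Or.inl h
    · exact h
  · exact eq_or_eq_of_coe_mul_eq ha (hi e)

/-- Circles, each of which meets the earlier ones and the base point exactly in one point. -/
theorem isBouquetLike_circles {r : ι → ℝ} (hr : ∀ i, 0 < r i) (f : ∀ i, AddCircle (r i) → X)
    (hc : ∀ i, Continuous (f i)) (hi : ∀ i, Function.Injective (f i)) (a₀ : X) (l : List ι)
    (h : ∀ P j S, l = P ++ j :: S → ∀ u, f j u ∈ {a₀} ∪ ⋃ i ∈ P, Set.range (f i) ↔ u = 0) :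
    IsBouquetLike a₀ ({a₀} ∪ ⋃ i ∈ l, Set.range (f i)) l.length := by
  suffices H : ∀ P S, l = P ++ S →
      IsBouquetLike a₀ ({a₀} ∪ ⋃ i ∈ P, Set.range (f i)) P.length from H l [] (by simp)
  intro P
  induction P using List.reverseRecOn with
  | nil =>
    intro S _
    simpa using IsBouquetLike.singleton a₀
  | append_singleton P j ih =>
    intro S hS
    rw [List.append_assoc, List.singleton_append] at hS
    have := (ih _ hS).circle (hr j) (hc j) (hi j) ((h P j S hS 0).2 rfl)
      fun u hu => (h P j S hS u).1 hu
    convert this using 1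
    · rw [Set.union_assoc]
      congr 1
      ext x
      simp only [Set.mem_iUnion, List.mem_append, List.mem_singleton, exists_prop, Set.mem_union,
        or_and_right, exists_or, exists_eq_left]
    · simp

end Circles

/-! ### Planar configurations -/

section Tree

variable {ι : Type}

theorem not_sublist_swap {l : List ι} (hl : l.Nodup) {i j : ι} (h : [i, j].Sublist l) :
    ¬ [j, i].Sublist l := by
  induction l with
  | nil => simp at h
  | cons a l ih =>
    rw [List.nodup_cons] at hl
    intro h'
    cases h with
    | cons _ h =>
      cases h' with
      | cons _ h' => exact ih hl.2 h h'
      | cons_cons _ h' => exact hl.1 (h.subset (by simp))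
    | cons_cons _ h =>
      cases h' with
      | cons _ h' => exact hl.1 (h'.subset (by simp))
      | cons_cons _ h' => exact hl.1 (List.singleton_sublist.1 h)

theorem Branches.heads_sublist (b : Branches ι ℝ) :
    (b.heads.map Prod.fst).Sublist b.labels ∧ ∀ p ∈ b.heads, p.2 = 0 := by
  induction b using Branches.rec (motive_2 := fun _ => True) with
  | nil => simp [Branches.heads]
  | cons i v rest _ ih =>
    simp only [Branches.heads, Branches.labels, List.map_cons, List.mem_cons]
    refine ⟨(ih.1.trans (List.sublist_append_right _ _)).cons_cons _, ?_⟩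
    rintro p (rfl | hp)
    · rfl
    · exact ih.2 p hp
  | close => trivial
  | arc => trivial

mutual

theorem Branches.nodes_sublist : ∀ (b : Branches ι ℝ), ∀ C ∈ b.nodes,
    (C.map Prod.fst).Sublist b.labels ∧ ∀ p ∈ C.tail, p.2 = 0
  | .nil, C, h => by simp [Branches.nodes] at h
  | .cons i v rest, C, h => by
      rw [Branches.nodes, List.mem_append] at h
      simp only [Branches.labels]
      rcases h with h | h
      · have := Lobe.nodes_sublist v i 0 C h
        exact ⟨this.1.trans ((List.sublist_append_left _ _).cons_cons _), this.2⟩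
      · have := Branches.nodes_sublist rest C h
        exact ⟨(this.1.trans (List.sublist_append_right _ _)).cons _, this.2⟩

theorem Lobe.nodes_sublist : ∀ (v : Lobe ι ℝ) (i : ι) (u : ℝ), ∀ C ∈ v.nodes i u,
    (C.map Prod.fst).Sublist (i :: v.labels) ∧ ∀ p ∈ C.tail, p.2 = 0
  | .close x, i, u, C, h => by simp [Lobe.nodes] at h
  | .arc x b rest, i, u, C, h => by
      rw [Lobe.nodes, List.mem_cons, List.mem_append] at h
      simp only [Lobe.labels]
      rcases h with rfl | h | h
      · exact ⟨(b.heads_sublist.1.trans (List.sublist_append_left _ _)).cons_cons _,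
          b.heads_sublist.2⟩
      · have := Branches.nodes_sublist b C h
        exact ⟨(this.1.trans (List.sublist_append_left _ _)).cons _, this.2⟩
      · have := Lobe.nodes_sublist rest i _ C h
        exact ⟨this.1.trans ((List.sublist_append_right _ _).cons_cons _), this.2⟩

end

mutual

theorem Branches.exists_node_of_mem_labels : ∀ (b : Branches ι ℝ), ∀ j ∈ b.labels,
    (j, 0) ∈ b.heads ∨ ∃ C ∈ b.nodes, (j, 0) ∈ C.tail
  | .nil, j, h => by simp [Branches.labels] at h
  | .cons i v rest, j, h => by
      simp only [Branches.labels, List.mem_cons, List.mem_append] at h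
      simp only [Branches.heads, Branches.nodes, List.mem_cons, List.mem_append]
      rcases h with rfl | h | h
      · exact Or.inl (Or.inl rfl)
      · obtain ⟨C, hC, hj⟩ := Lobe.exists_node_of_mem_labels v i 0 j h
        exact Or.inr ⟨C, Or.inl hC, hj⟩
      · rcases Branches.exists_node_of_mem_labels rest j h with h | ⟨C, hC, hj⟩
        · exact Or.inl (Or.inr h)
        · exact Or.inr ⟨C, Or.inr hC, hj⟩

theorem Lobe.exists_node_of_mem_labels : ∀ (v : Lobe ι ℝ) (i : ι) (u : ℝ), ∀ j ∈ v.labels,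
    ∃ C ∈ v.nodes i u, (j, 0) ∈ C.tail
  | .close x, i, u, j, h => by simp [Lobe.labels] at h
  | .arc x b rest, i, u, j, h => by
      simp only [Lobe.labels, List.mem_append] at h
      simp only [Lobe.nodes, List.mem_cons, List.mem_append]
      rcases h with h | h
      · rcases Branches.exists_node_of_mem_labels b j h with h | ⟨C, hC, hj⟩
        · exact ⟨_, Or.inl rfl, h⟩
        · exact ⟨C, Or.inr (Or.inl hC), hj⟩
      · obtain ⟨C, hC, hj⟩ := Lobe.exists_node_of_mem_labels rest i (u + x) j h
        exact ⟨C, Or.inr (Or.inr hC), hj⟩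

end

/-- A family of circles whose incidences are those of a tree is a bouquet up to homotopy. -/
theorem Branches.isBouquetLike_circles {X : Type} [TopologicalSpace X] [T2Space X] {r : ι → ℝ}
    (hr : ∀ i, 0 < r i) (f : ∀ i, AddCircle (r i) → X) (hc : ∀ i, Continuous (f i))
    (hi : ∀ i, Function.Injective (f i)) (t : Branches ι ℝ) (hl : t.labels.Nodup) {h : ι} {l : List ι} (ht : t.labels = h :: l)
    (hh : (h, 0) ∈ t.heads)
    (hf : ∀ a b : Σ i, AddCircle (r i), f a.1 a.2 = f b.1 b.2 ↔
      a = b ∨ ∃ C ∈ t.heads :: t.nodes, ∃ u v : ℝ, (a.1, u) ∈ C ∧ (b.1, v) ∈ C ∧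
        a.2 = (u : AddCircle (r a.1)) ∧ b.2 = (v : AddCircle (r b.1))) :
    IsBouquetLike (f h 0) ({f h 0} ∪ ⋃ i ∈ t.labels, Set.range (f i)) t.labels.length := by
  refine Cacti.isBouquetLike_circles hr f hc hi _ _ fun P j S hS u => ?_
  have before : ∀ i ∈ P, [i, j].Sublist t.labels := by
    intro i hi
    rw [hS, show [i, j] = [i] ++ [j] from rfl]
    exact (List.singleton_sublist.2 hi).append (List.singleton_sublist.2 (by simp))
  have hjP : j ∉ P := by
    intro hj
    rw [hS, List.nodup_append] at hl
    exact hl.2.2 j hj j (by simp) rfl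
  have zero : ∀ i ∈ P, ∀ w, f i w = f j u → u = 0 := by
    intro i hiP w hw
    rcases (hf ⟨j, u⟩ ⟨i, w⟩).1 hw.symm with e | ⟨C, hC, u', v', h1, h2, h3, -⟩
    · cases e
      exact (hjP hiP).elim
    · simp only at h1 h2 h3
      have h0 : ∀ D : List (ι × ℝ), (∀ p ∈ D, p.2 = 0) → (j, u') ∈ D → u = 0 := by
        intro D hD h1
        have : u' = 0 := hD _ h1
        rw [h3, this]
        rfl
      rw [List.mem_cons] at hC
      rcases hC with rfl | hC
      · exact h0 _ t.heads_sublist.2 h1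
      · obtain ⟨k1, k2⟩ := t.nodes_sublist C hC
        rcases C with _ | ⟨c, C⟩
        · simp at h1
        · rcases List.mem_cons.1 h1 with rfl | h1
          · rcases List.mem_cons.1 h2 with e | h2
            · rw [Prod.mk.injEq] at e
              exact (hjP (e.1 ▸ hiP)).elim
            · refine (not_sublist_swap hl (before i hiP) (List.Sublist.trans ?_ k1)).elim
              rw [List.map_cons]
              exact (List.singleton_sublist.2 (List.mem_map_of_mem (f := Prod.fst) h2)).cons_cons _
          · exact h0 _ k2 h1
  constructor
  · rintro (hu | hu)
    · rw [ht] at hS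
      rcases P with _ | ⟨k, P⟩
      · rw [List.nil_append, List.cons.injEq] at hS
        obtain ⟨rfl, -⟩ := hS
        exact hi h hu
      · rw [List.cons_append, List.cons.injEq] at hS
        exact zero h (by simp [hS.1]) 0 hu.symm
    · simp only [Set.mem_iUnion, exists_prop] at hu
      obtain ⟨i, hiP, w, hw⟩ := hu
      exact zero i hiP w hw
  · rintro rfl
    have hj : j ∈ t.labels := by simp [hS]
    rcases t.exists_node_of_mem_labels j hj with h1 | ⟨C, hC, h1⟩
    · exact Or.inl ((hf ⟨j, 0⟩ ⟨h, 0⟩).2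
        (Or.inr ⟨_, List.mem_cons_self, 0, 0, h1, hh, rfl, rfl⟩))
    · right
      rcases C with _ | ⟨⟨i, x⟩, C⟩
      · simp at h1
      · have k1 := (t.nodes_sublist _ hC).1
        have k3 : [i, j].Sublist t.labels := by
          refine List.Sublist.trans ?_ k1
          rw [List.map_cons]
          exact (List.singleton_sublist.2 (List.mem_map_of_mem (f := Prod.fst) h1)).cons_cons _
        have hiP : i ∈ P := by
          have : i ∈ t.labels := k3.subset (by simp)
          rw [hS, List.mem_append, List.mem_cons] at this
          rcases this with h | rfl | h
          · exact h
          · exact (not_sublist_swap hl k3 k3).elim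
          · refine (not_sublist_swap hl k3 ?_).elim
            rw [hS]
            exact ((List.singleton_sublist.2 h).cons_cons j).trans
              (List.sublist_append_right _ _)
        simp only [Set.mem_iUnion, exists_prop]
        exact ⟨i, hiP, x, (hf ⟨i, x⟩ ⟨j, 0⟩).2 (Or.inr ⟨_, List.mem_cons_of_mem _ hC, x, 0,
          List.mem_cons_self, List.mem_cons_of_mem _ h1, rfl, rfl⟩)⟩

end Tree

/-! ### Bouquets -/

section Bouquet

variable {n : ℕ}

/-- The `i`-th of `n` circles in `ℂⁿ` that only have the origin in common. -/
noncomputable def axisCircle (i : Fin n) (u : AddCircle (1 : ℝ)) : Fin n → ℂ :=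
  Pi.single i ((AddCircle.toCircle u : ℂ) - 1)

theorem axisCircle_zero (i : Fin n) : axisCircle i 0 = 0 := by
  simp [axisCircle]

theorem continuous_axisCircle (i : Fin n) : Continuous (axisCircle i) :=
  (_root_.continuous_single i).comp
    ((continuous_subtype_val.comp AddCircle.continuous_toCircle).sub continuous_const)

theorem axisCircle_injective (i : Fin n) : Function.Injective (axisCircle i) := by
  intro u v h
  have := Pi.single_injective i h
  exact AddCircle.injective_toCircle one_ne_zero (Subtype.ext (sub_left_injective this))

theorem isBouquetLike_axisCircles (n : ℕ) : IsBouquetLike (0 : Fin n → ℂ)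
    ({0} ∪ ⋃ i ∈ List.finRange n, Set.range (axisCircle i)) n := by
  have := Cacti.isBouquetLike_circles (fun _ : Fin n => zero_lt_one) axisCircle
    continuous_axisCircle axisCircle_injective 0 (List.finRange n) fun P j S hS u => by
      constructor
      · have h0 : axisCircle j u = 0 → u = 0 := fun h =>
          axisCircle_injective j (h.trans (axisCircle_zero j).symm)
        rintro (hu | hu)
        · exact h0 hu
        · simp only [Set.mem_iUnion, exists_prop] at hu
          obtain ⟨i, hi, w, hw⟩ := hu
          have hij : i ≠ j := by
            rintro rfl
            have := List.nodup_finRange n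
            rw [hS, List.nodup_append] at this
            exact this.2.2 i hi i (by simp) rfl
          refine h0 (funext fun k => ?_)
          by_cases hk : k = j
          · rw [← hw, axisCircle, hk, Pi.single_eq_of_ne hij.symm]
            rfl
          · rw [axisCircle, Pi.single_eq_of_ne hk]
            rfl
      · rintro rfl
        exact Or.inl (axisCircle_zero j)
  rwa [List.length_finRange] at this

theorem nonempty_bouquet_homeomorph (n : ℕ) : Nonempty (Bouquet n ≃ₜ
    ({0} ∪ ⋃ i ∈ List.finRange n, Set.range (axisCircle i) : Set (Fin n → ℂ))) := by
  let g : Unit ⊕ (Fin n × Circle) → (Fin n → ℂ) :=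
    Sum.elim (fun _ => 0) fun p => Pi.single p.1 ((p.2 : ℂ) - 1)
  have hg : Continuous g := by
    refine continuous_const.sumElim ?_
    refine continuous_prod_of_discrete_left.2 fun i => ?_
    exact (_root_.continuous_single i).comp (by fun_prop)
  let F : Bouquet n → (Fin n → ℂ) := Quot.lift g (by
    rintro _ _ ⟨i⟩
    simp [g])
  have hF : Continuous F := continuous_quot_lift _ hg
  have hs : ∀ (i : Fin n) (z : Circle), (z : ℂ) - 1 = 0 →
      (Quot.mk _ (Sum.inr (i, z)) : Bouquet n) = Quot.mk _ (Sum.inl ()) := by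
    intro i z hz
    have : z = 1 := Subtype.ext (sub_eq_zero.1 hz)
    rw [this]
    exact (Quot.sound (.base i)).symm
  have hI : Function.Injective F := by
    rintro ⟨⟨⟩ | ⟨i, z⟩⟩ ⟨⟨⟩ | ⟨j, w⟩⟩ h
    · rfl
    · refine (hs j w ?_).symm
      simpa [F, g] using (congrFun h j).symm
    · refine hs i z ?_
      simpa [F, g] using congrFun h i
    · by_cases hij : i = j
      · subst hij
        have : z = w := Subtype.ext (sub_left_injective (Pi.single_injective i h))
        rw [this]
      · have h1 := congrFun h i
        have h2 := congrFun h j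
        simp only [F, g, Sum.elim_inr, Pi.single_eq_same, Pi.single_eq_of_ne hij,
          Pi.single_eq_of_ne (Ne.symm hij)] at h1 h2
        exact (hs i z h1).trans (hs j w h2.symm).symm
  have hR : Set.range F = {0} ∪ ⋃ i ∈ List.finRange n, Set.range (axisCircle i) := by
    ext x
    constructor
    · rintro ⟨⟨⟨⟩ | ⟨i, z⟩⟩, rfl⟩
      · exact Or.inl rfl
      · right
        simp only [Set.mem_iUnion, exists_prop]
        obtain ⟨u, rfl⟩ := (AddCircle.homeomorphCircle (T := 1) one_ne_zero).surjective z
        exact ⟨i, List.mem_finRange i, u, by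
          simp [F, g, axisCircle, AddCircle.homeomorphCircle_apply]⟩
    · rintro (rfl | hx)
      · exact ⟨Quot.mk _ (Sum.inl ()), rfl⟩
      · simp only [Set.mem_iUnion, exists_prop] at hx
        obtain ⟨i, -, u, rfl⟩ := hx
        exact ⟨Quot.mk _ (Sum.inr (i, AddCircle.toCircle u)), rfl⟩
  have : CompactSpace (Bouquet n) := inferInstanceAs (CompactSpace (Quot (BouquetGlue n)))
  exact ⟨(hF.isClosedEmbedding hI).isEmbedding.toHomeomorph.trans (Homeomorph.setCongr hR)⟩

end Bouquet

end Cacti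

namespace Cacti

section Final

variable {n : ℕ}

mutual

theorem Branches.labels_scale {ι : Type} (r : ι → ℝ) : ∀ b : Branches ι ℝ,
    (b.scale r).labels = b.labels
  | .nil => rfl
  | .cons i v rest => by
      simp [Branches.scale, Branches.labels, Lobe.labels_scale r _ v, Branches.labels_scale r rest]

theorem Lobe.labels_scale {ι : Type} (r : ι → ℝ) (a : ℝ) : ∀ v : Lobe ι ℝ,
    (v.scale r a).labels = v.labels
  | .close x => rfl
  | .arc x b rest => by
      simp [Lobe.scale, Lobe.labels, Lobe.labels_scale r _ rest, Branches.labels_scale r b]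

end

theorem labels_metricTree (c : Cact n) : (metricTree c).labels = c.1.1.labels :=
  Branches.labels_scale _ _

theorem length_labels_metricTree (c : Cact n) : (metricTree c).labels.length = n := by
  rw [labels_metricTree]
  exact length_eq_of_count_eq_one c.1.2.count_labels

theorem isBouquetLike_planarImage (hn : 1 ≤ n) {c : Cact n}
    {f : ∀ i, AddCircle (c.2 i : ℝ) → ℂ} (hf : IsPlanarRepresentative c f) :
    ∃ a₀, IsBouquetLike a₀ (planarImage f) n := by
  have hlen := length_labels_metricTree c
  obtain ⟨h, l, hl, hh⟩ : ∃ h l, (metricTree c).labels = h :: l ∧ (h, 0) ∈ (metricTree c).heads := by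
    generalize metricTree c = t at hlen ⊢
    rcases t with _ | ⟨i, v, rest⟩
    · change 0 = n at hlen
      omega
    · exact ⟨i, _, rfl, List.mem_cons_self⟩
  have key := Branches.isBouquetLike_circles (fun i => (c.2 i).2) f
    (fun i => (hf.circle i).continuous) (fun i => (hf.circle i).injective) (metricTree c)
    (by rw [labels_metricTree]; exact c.1.2.nodup) hl hh hf.incidence
  have hU : {f h 0} ∪ ⋃ i ∈ (metricTree c).labels, Set.range (f i) = planarImage f := by
    have hall : ∀ i, i ∈ (metricTree c).labels := fun i => by
      rw [labels_metricTree, ← List.count_pos_iff, c.1.2.count_labels]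
      exact one_pos
    ext z
    simp only [planarImage, Set.mem_union, Set.mem_singleton_iff, Set.mem_iUnion, hall,
      exists_true_left]
    exact or_iff_right_of_imp fun hz => ⟨h, 0, hz.symm⟩
  rw [hU, hlen] at key
  exact ⟨_, key⟩

theorem nonempty_fibre_homotopyEquiv (c : Cact n) {X : Type} [TopologicalSpace X] {a : X}
    {A : Set X} (hA : IsBouquetLike a A n) :
    Nonempty (ContinuousMap.HomotopyEquiv (Fibre forgetLobe' c.1) A) := by
  obtain ⟨e⟩ := nonempty_fibre_homeomorph (fun i => (c.2 i).2) c.1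
  have h := Branches.isBouquetLike_chordMeasures (metricTree_positive c)
  rw [length_labels_metricTree] at h
  obtain ⟨e'⟩ := h.homotopyEquiv hA
  exact ⟨e.toHomotopyEquiv.trans e'⟩

theorem nonempty_fibre_homotopyEquiv_fibre (c : Cact n) :
    Nonempty (ContinuousMap.HomotopyEquiv (Fibre forgetLobe c) (Fibre forgetLobe' c.1)) := by
  have : ContractibleSpace (Set.Ioi (0 : ℝ)) :=
    (convex_Ioi (0 : ℝ)).contractibleSpace ⟨1, Set.mem_Ioi.2 zero_lt_one⟩
  obtain ⟨e⟩ := ContractibleSpace.hequiv_unit (Set.Ioi (0 : ℝ))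
  exact ⟨((fibreHomeomorph c).toHomotopyEquiv.trans
    ((ContinuousMap.HomotopyEquiv.refl _).prodCongr e)).trans
      (Homeomorph.prodPUnit _).toHomotopyEquiv⟩

theorem nonempty_homotopyEquiv_bouquet {X : Type} [TopologicalSpace X]
    (h : Nonempty (ContinuousMap.HomotopyEquiv X
      ({0} ∪ ⋃ i ∈ List.finRange n, Set.range (axisCircle i) : Set (Fin n → ℂ)))) :
    Nonempty (ContinuousMap.HomotopyEquiv X (Bouquet n)) := by
  obtain ⟨e⟩ := h
  obtain ⟨e'⟩ := nonempty_bouquet_homeomorph n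
  exact ⟨e.trans e'.symm.toHomotopyEquiv⟩

end Final

end Cacti

theorem mainTheorem9 (n : ℕ) (hn : 1 ≤ n) :
    (∀ c : Cacti.Cact n,
      Nonempty (Cacti.Fibre Cacti.forgetLobe c ≃ₜ
        (Cacti.metricTree c).CompletedChordDiagram × Set.Ioi (0 : ℝ))) ∧
    (∀ c : Cacti.NCact n,
      Nonempty (Cacti.Fibre Cacti.forgetLobe' c ≃ₜ c.1.CompletedChordDiagram)) ∧
    (∀ c : Cacti.Cact n,
      (∀ f : (∀ i, AddCircle (c.2 i : ℝ) → ℂ), Cacti.IsPlanarRepresentative c f →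
        Nonempty (ContinuousMap.HomotopyEquiv (Cacti.Fibre Cacti.forgetLobe c)
          (Cacti.planarImage f))) ∧
      Nonempty (ContinuousMap.HomotopyEquiv (Cacti.Fibre Cacti.forgetLobe c)
        (Cacti.Bouquet n))) ∧
    (∀ c : Cacti.NCact n,
      (∀ f : (∀ i, AddCircle (c.toCact.2 i : ℝ) → ℂ),
        Cacti.IsPlanarRepresentative c.toCact f →
          Nonempty (ContinuousMap.HomotopyEquiv (Cacti.Fibre Cacti.forgetLobe' c)
            (Cacti.planarImage f))) ∧
      Nonempty (ContinuousMap.HomotopyEquiv (Cacti.Fibre Cacti.forgetLobe' c)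
        (Cacti.Bouquet n))) := by
  refine ⟨fun c => ?_, fun c => ?_, fun c => ⟨fun f hf => ?_, ?_⟩, fun c => ⟨fun f hf => ?_, ?_⟩⟩
  · obtain ⟨e⟩ := Cacti.nonempty_fibre_homeomorph_diagram c
    exact ⟨(Cacti.fibreHomeomorph c).trans (e.prodCongr (Homeomorph.refl _))⟩
  · have := Cacti.nonempty_fibre_homeomorph_diagram c.toCact
    rwa [Cacti.metricTree_toCact] at this
  · obtain ⟨a, ha⟩ := Cacti.isBouquetLike_planarImage hn hf
    obtain ⟨e⟩ := Cacti.nonempty_fibre_homotopyEquiv_fibre c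
    obtain ⟨e'⟩ := Cacti.nonempty_fibre_homotopyEquiv c ha
    exact ⟨e.trans e'⟩
  · obtain ⟨e⟩ := Cacti.nonempty_fibre_homotopyEquiv_fibre c
    obtain ⟨e'⟩ := Cacti.nonempty_homotopyEquiv_bouquet
      (Cacti.nonempty_fibre_homotopyEquiv c (Cacti.isBouquetLike_axisCircles n))
    exact ⟨e.trans e'⟩
  · obtain ⟨a, ha⟩ := Cacti.isBouquetLike_planarImage hn hf
    exact Cacti.nonempty_fibre_homotopyEquiv c.toCact ha
  · exact Cacti.nonempty_homotopyEquiv_bouquet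
      (Cacti.nonempty_fibre_homotopyEquiv c.toCact (Cacti.isBouquetLike_axisCircles n))
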